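/- **Conventions.** $\log$ is the natural logarithm, $[n]$ is a set of $n$ elements, and $\mathbf x_H$ is the restriction of $\mathbf x$ to the coordinates in $H$. Time is the number of steps of a program on a real RAM: unit-cost integer addition, subtraction and comparison, real arithmetic and comparison, pairs, and read-only arrays. A program, with the tables stored in it, may depend on the object it is made for (the code, or the realized random matrix). *Weak identification.* Let $\tau>0$. A random $m\times n$ matrix $\mathcal M$ is a $(k,\zeta,\eta)$-weak identification matrix with $(\ell,p)$-guarantee, threshold $\tau$ and identification time $t$ if there is an algorithm, depending on the realized $\mathcal M$, that on input $\mathcal M\mathbf x$ and $S\subseteq[n]$ always outputs in time $t$ a set $I\subseteq S$ such that the following holds. For all $\mathbf x\in\mathbb R^n$, all $S\subseteq [n]$ and every head $H\subseteq[n]$ with $|H|\le k$ (in particular for the $k$ largest coordinates of $\mathbf x$), with probability at least $1-p$: $|I|\le \ell$, and at most $\zeta k$ of the $i\in H\cap S$ with $|x_i|>\tau\sqrt{\eta/k}\,\|\mathbf x-\mathbf x_H\|_2$ are not in $I$. *Codes.* A code $C:[n]\to[q]^r$ is *uniform* if every coordinate of $C(x)$ is uniform on $[q]$ for uniform $x$.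 For $S_1,\dots,S_r\subseteq[q]$ let $\mathrm{Rec}(S_1,\dots,S_r)$ be the set of $x\in[n]$ with $C(x)_i\in S_i$ for at least $(1-\rho)r$ indices $i$. $C$ is $(\rho,\ell,L)$-*list recoverable in time $T$* if $|\mathrm{Rec}(S_1,\dots,S_r)|\le L$ whenever all $|S_i|\le\ell$, and then this set is computed from lists of the $S_i$ in time $T$. **Theorem.** Fix an integer $r\ge2$, reals $b>1$, $0<\alpha<\frac12$, $\rho_0<1$, constants $\tau,c_\ell,c_p,c_t>0$ and an integer $d\ge0$. There are constants $C,c>0$, depending only on these, such that for all $0<\zeta,\eta<1$ there is $N_0$ with the following property for all $N\ge N_0$ and all integers $k\ge1$. Suppose given: 1. a real $g$ (which may depend on $\zeta,\eta$) and, for each $n\ge\zeta^{-2}$ with $n>k$, a random $m(n)\times n$ matrix $\mathcal M_n$ with $m(n)\le g\,k\log(n/k)$ that is a $(k,\zeta,\eta)$-weak identification matrix with $(c_\ell k/\eta,\,(n/k)^{-c_p\zeta k})$-guarantee, threshold $\tau$ and identification time $c_t\zeta^{-3}\eta^{-2}(|S|+1)\log n$, where $S$ is given as a list; 2. an integer $h\ge0$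 such that the numbers $n_j=N^{1/b^j}$, $0\le j\le h$, are integers, and such that $A=n_h$ satisfies $A>k$ and $A\ge C\zeta^{-6}\eta^{-2}k^{\frac{1-\alpha}{1-2\alpha}}(\log(N/k))^2$; 3. a real $\rho$ with $0\le\rho\le\rho_0$, an integer $L\ge1$, and for $0\le j<h$ a uniform code $[n_j]\to[n_{j+1}]^r$ that is $(\rho,\ell,L)$-list recoverable in time $T(\ell,n_j,b)$, where $\ell=\lfloor c_\ell k/\eta\rfloor$. All programs for size $n$ in 1 and 3 have size (with stored tables) at most $n^{d}$. Then there are an integer $\mathcal N\le C(\log_AN)^{\log r/\log b}$ and a random $m'\times N$ matrix $\mathcal M^*$ that is a $(k,\zeta',\eta)$-weak identification matrix with $(Ck/\eta,p')$-guarantee, threshold $C$ and identification time $D$ (for all $S\subseteq[N]$, with $S$ given by its array of membership bits), with programs of size at most $N^{C}$, such that $h\le C\log_r\log_AN$ and - $\zeta'\le\zeta\,\mathcal N^{\,C\log(1/\rho)/\log r}$ if $\rho>0$, and $\zeta'\le\zeta\,\mathcal N$ if $\rho=0$; - $p'\le\mathcal N\,(A/k)^{-c\zeta k}$; - $m'\le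 C\,g\,k\log(N/k)\sum_{j=0}^h(r/b)^j$, and, if $b<r$, also $m'\le C\,g\,k\log(N/k)\,(\log_AN)^{\log(r/b)/\log b}$; - $D\le C\zeta^{-3}\eta^{-2}\mathcal N A\log A+\sum_{j=0}^{h-1}r^j\bigl(T(\ell,n_j,b)+C\zeta^{-3}\eta^{-2}L\log n_j\bigr)$. -/

import Mathlib

noncomputable section

namespace SparseRec

open scoped Classical

/-! ### The machine model: while-programs on a real random access machine

Data are integers, real numbers, pairs, and read-only arrays. A program is a finite piece of code
with constants (its stored tables). Every primitive operation, variable access, constant access,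
test and loop iteration costs one step. A pair is a cell with two pointers and an array is a
pointer, so all of them are handed over by reference. -/

/-- Values. `arr n f` is the read-only array with the `n` entries `f 0, …, f (n - 1)`; the other
values of `f` cannot be read. -/
inductive Val : Type
  | int (z : ℤ) : Val
  | real (x : ℝ) : Val
  | nil : Val
  | pair (u v : Val) : Val
  | arr (n : ℕ) (f : ℕ → Val) : Val

/-- The number of memory cells that a value occupies. -/
def Val.size : Val → ℕ
  | .int _ => 1
  | .real _ => 1
  | .nil => 1
  | .pair u v => 1 + u.size + v.size
  | .arr n f => 1 + ∑ i ∈ Finset.range n, (f i).size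

/-- Unary primitives: the two projections of a pair and the test for `nil`. -/
inductive UnOp : Type
  | fst | snd | isNil

/-- Binary primitives: integer arithmetic and comparison, real arithmetic and comparison,
pair formation, reading an array entry, and passing to the sub-array of an array that starts at
a given position (`drop`) or has a given length (`take`). -/
inductive BinOp : Type
  | intAdd | intSub | intLt
  | realAdd | realSub | realMul | realDiv | realLt
  | mkPair | get | drop | take

/-- Result of a unary primitive (`none`: the machine is stuck). -/
def UnOp.apply : UnOp → Val → Option Val
  | .fst, .pair u _ => some u
  | .snd, .pair _ v => some v
  | .isNil, .nil => some (.int 1)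
  | .isNil, .pair _ _ => some (.int 0)
  | _, _ => none

/-- Result of a binary primitive (`none`: the machine is stuck). -/
def BinOp.apply : BinOp → Val → Val → Option Val
  | .intAdd, .int a, .int b => some (.int (a + b))
  | .intSub, .int a, .int b => some (.int (a - b))
  | .intLt, .int a, .int b => some (.int (if a < b then 1 else 0))
  | .realAdd, .real a, .real b => some (.real (a + b))
  | .realSub, .real a, .real b => some (.real (a - b))
  | .realMul, .real a, .real b => some (.real (a * b))
  | .realDiv, .real a, .real b => if b = 0 then none else some (.real (a / b))
  | .realLt, .real a, .real b => some (.int (if a < b then 1 else 0))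
  | .mkPair, u, v => some (.pair u v)
  | .get, .arr n f, .int i => if 0 ≤ i ∧ i < n then some (f i.toNat) else none
  | .drop, .arr n f, .int i =>
      if 0 ≤ i ∧ i ≤ n then some (.arr (n - i.toNat) (fun j => f (j + i.toNat))) else none
  | .take, .arr n f, .int i =>
      if 0 ≤ i ∧ i ≤ n then some (.arr i.toNat (fun j => if j < i.toNat then f j else .nil))
      else none
  | _, _, _ => none

/-- Programs. `var i` reads the `i`-th variable (counted from the innermost binder), `bind p q`
runs `p`, binds the result to a new variable and runs `q`; `loop start test body` starts from the
value of `start`, bound to a new variable, and replaces it by the value of `body` as long as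
`test` evaluates to a non-zero integer. -/
inductive Prog : Type
  | var (i : ℕ) : Prog
  | const (v : Val) : Prog
  | un (o : UnOp) (p : Prog) : Prog
  | bin (o : BinOp) (p q : Prog) : Prog
  | bind (p q : Prog) : Prog
  | cond (test p q : Prog) : Prog
  | loop (start test body : Prog) : Prog

/-- The size of a program together with the tables stored in it. -/
def Prog.size : Prog → ℕ
  | .var _ => 1
  | .const v => v.size
  | .un _ p => 1 + p.size
  | .bin _ p q => 1 + p.size + q.size
  | .bind p q => 1 + p.size + q.size
  | .cond t p q => 1 + t.size + p.size + q.size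
  | .loop s t p => 1 + s.size + t.size + p.size

/-- `Eval Γ p v t`: with the variables `Γ`, the program `p` halts after `t` steps with value `v`. -/
inductive Eval : List Val → Prog → Val → ℕ → Prop
  | var {Γ : List Val} {i : ℕ} {v : Val} (hv : Γ[i]? = some v) : Eval Γ (.var i) v 1
  | const {Γ : List Val} {v : Val} : Eval Γ (.const v) v 1
  | un {Γ : List Val} {o : UnOp} {p : Prog} {u v : Val} {t : ℕ}
      (hp : Eval Γ p u t) (hv : o.apply u = some v) : Eval Γ (.un o p) v (t + 1)
  | bin {Γ : List Val} {o : BinOp} {p q : Prog} {u v w : Val} {t₁ t₂ : ℕ}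
      (hp : Eval Γ p u t₁) (hq : Eval Γ q v t₂) (hw : o.apply u v = some w) :
      Eval Γ (.bin o p q) w (t₁ + t₂ + 1)
  | bind {Γ : List Val} {p q : Prog} {u v : Val} {t₁ t₂ : ℕ}
      (hp : Eval Γ p u t₁) (hq : Eval (u :: Γ) q v t₂) : Eval Γ (.bind p q) v (t₁ + t₂ + 1)
  | condTrue {Γ : List Val} {c p q : Prog} {z : ℤ} {v : Val} {t₁ t₂ : ℕ}
      (hc : Eval Γ c (.int z) t₁) (hz : z ≠ 0) (hp : Eval Γ p v t₂) :
      Eval Γ (.cond c p q) v (t₁ + t₂ + 1)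
  | condFalse {Γ : List Val} {c p q : Prog} {v : Val} {t₁ t₂ : ℕ}
      (hc : Eval Γ c (.int 0) t₁) (hq : Eval Γ q v t₂) : Eval Γ (.cond c p q) v (t₁ + t₂ + 1)
  | loopStop {Γ : List Val} {s c p : Prog} {v : Val} {t₁ t₂ : ℕ}
      (hs : Eval Γ s v t₁) (hc : Eval (v :: Γ) c (.int 0) t₂) :
      Eval Γ (.loop s c p) v (t₁ + t₂ + 1)
  | loopStep {Γ : List Val} {s c p : Prog} {z : ℤ} {u v w : Val} {t₁ t₂ t₃ t₄ : ℕ}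
      (hs : Eval Γ s u t₁) (hc : Eval (u :: Γ) c (.int z) t₂) (hz : z ≠ 0)
      (hp : Eval (u :: Γ) p v t₃) (hl : Eval Γ (.loop (.const v) c p) w t₄) :
      Eval Γ (.loop s c p) w (t₁ + t₂ + t₃ + t₄ + 1)

/-- On input `u` the program `p` outputs `v` within time `T`. -/
def Prog.Computes (p : Prog) (u v : Val) (T : ℝ) : Prop :=
  ∃ t : ℕ, Eval [u] p v t ∧ (t : ℝ) ≤ T

/-! ### Encodings of inputs and outputs -/

/-- A linked list. -/
def encSeq : List Val → Val
  | [] => .nil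
  | v :: l => .pair v (encSeq l)

/-- A set of indices, listed by its elements. -/
def encList {n : ℕ} (s : List (Fin n)) : Val :=
  encSeq (s.map fun i => .int (i : ℕ))

/-- A set of indices, given by the array of its membership bits. -/
def encBits {n : ℕ} (s : List (Fin n)) : Val :=
  .arr n fun i =>
    if hi : i < n then .int (if (⟨i, hi⟩ : Fin n) ∈ s then 1 else 0) else .nil

/-- A real vector, as an array. -/
def encVec {m : ℕ} (y : Fin m → ℝ) : Val :=
  .arr m fun i => if hi : i < m then .real (y ⟨i, hi⟩) else .nil

/-! ### Codes -/

section Codes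

variable {n r q : ℕ}

/-- Every coordinate of `C x` is uniformly distributed over the alphabet for uniform `x`. -/
def IsUniform (C : Fin n → Fin r → Fin q) : Prop :=
  ∀ (i : Fin r) (a : Fin q), q * (Finset.univ.filter fun x => C x i = a).card = n

/-- The messages whose codewords satisfy `C x i ∈ S i` for at least `(1 - ρ) r` indices `i`. -/
def recovered (C : Fin n → Fin r → Fin q) (ρ : ℝ) (S : Fin r → Finset (Fin q)) :
    Finset (Fin n) :=
  Finset.univ.filter fun x =>
    (1 - ρ) * (r : ℝ) ≤ ((Finset.univ.filter fun i => C x i ∈ S i).card : ℝ)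

/-- `(ρ, ℓ, L)`-list recoverability. -/
def IsListRecoverable (C : Fin n → Fin r → Fin q) (ρ : ℝ) (ℓ L : ℕ) : Prop :=
  ∀ S : Fin r → Finset (Fin q), (∀ i, (S i).card ≤ ℓ) → (recovered C ρ S).card ≤ L

/-- List recovery from sets of size at most `ℓ` is done in time `T` by a program of size at most
`space`. -/
def IsRecoverableInTime (C : Fin n → Fin r → Fin q) (ρ : ℝ) (ℓ : ℕ) (T space : ℝ) : Prop :=
  ∃ p : Prog, (p.size : ℝ) ≤ space ∧
    ∀ S : Fin r → List (Fin q), (∀ i, (S i).Nodup ∧ (S i).length ≤ ℓ) →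
      ∃ out : List (Fin n), out.Nodup ∧
        out.toFinset = recovered C ρ (fun i => (S i).toFinset) ∧
        p.Computes (encSeq (List.ofFn fun i => encList (S i))) (encList out) T

end Codes

/-! ### Weak identification matrices -/

/-- The Euclidean norm of the part of `x` outside the head `H`. -/
def tailNorm {n : ℕ} (x : Fin n → ℝ) (H : Finset (Fin n)) : ℝ :=
  Real.sqrt (∑ i ∈ Hᶜ, x i ^ 2)

/-- The indices `i` in the head `H` and in the candidate list `s` that are heavy, namely
`|x i| > τ √(η / k) ‖x - x_H‖₂`, but do not occur in the output `I`. -/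
def missed {n : ℕ} (k : ℕ) (η τ : ℝ) (x : Fin n → ℝ) (H : Finset (Fin n))
    (s I : List (Fin n)) : Finset (Fin n) :=
  H.filter fun i => i ∈ s ∧ τ * Real.sqrt (η / k) * tailNorm x H < |x i| ∧ i ∉ I

/-- The random matrix `M` is a `(k, ζ, η)`-weak identification matrix with `(ℓ, p)`-guarantee
(and threshold constant `τ`). The algorithm knows the matrix: its program and tables (of size at
most `space`) may depend on the random choice `ω`. Given `M x` and a candidate set `S` (a list `s`
without repetitions, presented to the machine as `encS s`), it always outputs a subset `I` of `S`
within time `time |S|`; for each `x`, `S` and each head `H` of at most `k` coordinates, with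
probability at least `1 - p`, `I` has at most `ℓ` elements and misses at most `ζ k` of the heavy
elements of `H ∩ S`. -/
def IsWeakIdentification {Ω : Type} [MeasurableSpace Ω] (μ : MeasureTheory.Measure Ω)
    {m n : ℕ} (M : Ω → Matrix (Fin m) (Fin n) ℝ) (encS : List (Fin n) → Val)
    (k : ℕ) (ζ η τ ℓ p : ℝ) (time : ℕ → ℝ) (space : ℝ) : Prop :=
  (∀ i j, Measurable fun ω => M ω i j) ∧
  ∃ (prog : Ω → Prog) (out : List (Fin n) → (Fin n → ℝ) → Ω → List (Fin n)),
    (∀ ω, ((prog ω).size : ℝ) ≤ space) ∧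
    ∀ s : List (Fin n), s.Nodup → ∀ x : Fin n → ℝ,
      (∀ ω, (out s x ω).Nodup ∧ out s x ω ⊆ s ∧
        (prog ω).Computes (.pair (encVec ((M ω).mulVec x)) (encS s))
          (encList (out s x ω)) (time s.length)) ∧
      (∀ I : List (Fin n), MeasurableSet {ω | out s x ω = I}) ∧
      ∀ H : Finset (Fin n), H.card ≤ k →
        μ {ω | ¬ (((out s x ω).length : ℝ) ≤ ℓ ∧
            ((missed k η τ x H s (out s x ω)).card : ℝ) ≤ ζ * k)} ≤ ENNReal.ofReal p

end SparseRec

end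

noncomputable section

namespace SparseRec

open scoped Classical
open Finset MeasureTheory

/-! ### Sums over tuples of pairwise compatible elements -/

/-- The entries of a tuple are pairwise related. -/
def Compat {α : Type*} (R : α → α → Prop) {t : ℕ} (a : Fin t → α) : Prop :=
  ∀ l l', l ≠ l' → R (a l) (a l')

theorem compat_cons {α : Type*} {R : α → α → Prop} (hR : ∀ x y, R x y → R y x) {t : ℕ}
    (x : α) (a : Fin t → α) :
    Compat R (Fin.cons x a : Fin (t + 1) → α) ↔ Compat R a ∧ ∀ l, R x (a l) := by
  constructor
  · intro h
    refine ⟨fun l l' hl => ?_, fun l => ?_⟩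
    · have := h l.succ l'.succ (by simpa using hl)
      simpa using this
    · have := h 0 l.succ (Fin.succ_ne_zero l).symm
      simpa using this
  · rintro ⟨h1, h2⟩ l l'
    refine Fin.cases ?_ (fun l => ?_) l <;> refine Fin.cases ?_ (fun l' => ?_) l'
    · intro h; exact absurd rfl h
    · intro _; simpa using h2 l'
    · intro _; simpa using hR _ _ (h2 l)
    · intro h; simpa using h1 l l' (by simpa using h)

theorem pow_le_sum_compat {α : Type*} [Fintype α] {R : α → α → Prop}
    (hR : ∀ x y, R x y → R y x) (φ : α → ℝ) (hφ : ∀ x, 0 ≤ φ x) {M : ℝ} (hM : 0 ≤ M) (t : ℕ)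
    (h : ∀ u < t, ∀ a : Fin u → α, (∀ l, φ (a l) ≠ 0) → M ≤ ∑ x with (∀ l, R x (a l)), φ x) :
    M ^ t ≤ ∑ a : Fin t → α, if Compat R a then ∏ l, φ (a l) else 0 := by
  induction t with
  | zero => simp [Compat]
  | succ t ih =>
    have ih' := ih fun u hu a => h u (by omega) a
    rw [← Equiv.sum_comp (Fin.consEquiv fun _ : Fin (t + 1) => α), Fintype.sum_prod_type,
      Finset.sum_comm]
    calc M ^ (t + 1) = M ^ t * M := pow_succ _ _
      _ ≤ (∑ a : Fin t → α, if Compat R a then ∏ l, φ (a l) else 0) * M := by gcongr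
      _ = ∑ a : Fin t → α, (if Compat R a then ∏ l, φ (a l) else 0) * M := by
        rw [Finset.sum_mul]
      _ ≤ _ := by
        refine Finset.sum_le_sum fun a _ => ?_
        by_cases ha : Compat R a
        · rw [if_pos ha]
          calc (∏ l, φ (a l)) * M ≤ (∏ l, φ (a l)) * ∑ x with (∀ l, R x (a l)), φ x := by
                by_cases h0 : ∀ l, φ (a l) ≠ 0
                · exact mul_le_mul_of_nonneg_left (h t (by omega) a h0)
                    (Finset.prod_nonneg fun _ _ => hφ _)
                · push Not at h0
                  obtain ⟨l, hl⟩ := h0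
                  rw [Finset.prod_eq_zero (mem_univ l) hl, zero_mul, zero_mul]
            _ = _ := by
              rw [Finset.mul_sum, Finset.sum_filter]
              refine Finset.sum_congr rfl fun x _ => ?_
              simp only [Fin.consEquiv, Equiv.coe_fn_mk, compat_cons hR, ha, true_and,
                Fin.prod_univ_succ, Fin.cons_zero, Fin.cons_succ]
              split_ifs <;> ring
        · rw [if_neg ha, zero_mul]
          refine Finset.sum_nonneg fun x _ => ?_
          split_ifs
          · exact Finset.prod_nonneg fun _ _ => hφ _
          · exact le_rfl

/-! ### Uniform random permutations -/

/-- All fibres have the same size. -/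
def Balanced {N n : ℕ} (f : Fin N → Fin n) : Prop :=
  ∀ a, n * (univ.filter fun i => f i = a).card = N

/-- The permutations that send the points of `I` to prescribed fibres of `f`. -/
def permFibre {N n : ℕ} (f : Fin N → Fin n) (I : Finset (Fin N)) (a : Fin N → Fin n) :
    Finset (Equiv.Perm (Fin N)) :=
  univ.filter fun π => ∀ i ∈ I, f (π i) = a i

theorem card_permFibre_insert {N n : ℕ} (f : Fin N → Fin n) (I : Finset (Fin N))
    (a : Fin N → Fin n) {i₀ : Fin N} (hi₀ : i₀ ∉ I) :
    (permFibre f (insert i₀ I) a).card * (N - I.card) ≤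
      (permFibre f I a).card * (univ.filter fun i => f i = a i₀).card := by
  have h1 : ((permFibre f (insert i₀ I) a).sigma fun π => (I.image π)ᶜ).card =
      (permFibre f (insert i₀ I) a).card * (N - I.card) := by
    rw [Finset.card_sigma]
    have : ∀ π : Equiv.Perm (Fin N), ((I.image π)ᶜ).card = N - I.card := fun π => by
      rw [Finset.card_compl, Fintype.card_fin, Finset.card_image_of_injective _ π.injective]
    simp [this]
  rw [← h1, ← Finset.card_product]
  refine Finset.card_le_card_of_injOn
    (fun p => (Equiv.swap p.2 (p.1 i₀) * p.1, p.1 i₀)) ?_ ?_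
  · rintro ⟨π, v⟩ hp
    simp only [permFibre, coe_sigma, Set.mem_sigma_iff, mem_coe, mem_filter, mem_univ, true_and,
      mem_compl, mem_image, not_exists, not_and, mem_insert, forall_eq_or_imp] at hp
    obtain ⟨⟨h0, hI⟩, hv⟩ := hp
    simp only [permFibre, coe_product, Set.mem_prod, mem_coe, mem_filter, mem_univ, true_and,
      Equiv.Perm.coe_mul, Function.comp_apply]
    refine ⟨fun i hi => ?_, h0⟩
    rw [Equiv.swap_apply_of_ne_of_ne (hv i hi)]
    · exact hI i hi
    · intro h
      exact hi₀ (π.injective h ▸ hi)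
  · rintro ⟨π, v⟩ _ ⟨π', v'⟩ _ h
    simp only [Prod.mk.injEq] at h
    obtain ⟨h1, h2⟩ := h
    have hv : v = v' := by
      have := congrArg (fun p : Equiv.Perm (Fin N) => p i₀) h1
      simpa using this
    subst hv
    rw [h2] at h1
    have := mul_left_cancel h1
    subst this
    rfl

theorem card_permFibre_le {N n : ℕ} {f : Fin N → Fin n} (hf : Balanced f) (a : Fin N → Fin n)
    (I : Finset (Fin N)) (hI : 2 * I.card ≤ N) :
    (permFibre f I a).card * n ^ I.card ≤ 2 ^ I.card * N.factorial := by
  induction I using Finset.induction_on with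
  | empty => simp [permFibre, Fintype.card_perm]
  | insert i₀ I hi₀ ih =>
    rw [Finset.card_insert_of_notMem hi₀] at hI ⊢
    have ih' := ih (by omega)
    have hs := card_permFibre_insert f I a hi₀
    have hw := hf (a i₀)
    set w := (univ.filter fun i => f i = a i₀).card
    set x := (permFibre f (insert i₀ I) a).card
    set y := (permFibre f I a).card
    have hpos : 0 < N - I.card := by omega
    have h1 : x * n * (N - I.card) ≤ 2 * y * (N - I.card) := by
      calc x * n * (N - I.card) = x * (N - I.card) * n := by ring
        _ ≤ y * w * n := by gcongr
        _ = y * N := by rw [← hw]; ring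
        _ ≤ y * (2 * (N - I.card)) := by gcongr; omega
        _ = _ := by ring
    have h2 := Nat.le_of_mul_le_mul_right h1 hpos
    calc x * n ^ (I.card + 1) = x * n * n ^ I.card := by ring
      _ ≤ 2 * y * n ^ I.card := by gcongr
      _ = 2 * (y * n ^ I.card) := by ring
      _ ≤ 2 * (2 ^ I.card * N.factorial) := by gcongr
      _ = _ := by ring

theorem card_perm_blocks_le {N n : ℕ} {f : Fin N → Fin n} (hf : Balanced f) {t j : ℕ}
    (a : Fin t → Fin n) (e : Fin t → Finset (Fin N)) (he : Compat Disjoint e)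
    (hc : ∀ l, (e l).card = j) (hN : 2 * (j * t) ≤ N) :
    ((univ.filter fun π : Equiv.Perm (Fin N) => ∀ l, ∀ i ∈ e l, f (π i) = a l).card : ℝ) *
      (n : ℝ) ^ (j * t) ≤ 2 ^ (j * t) * N.factorial := by
  rcases isEmpty_or_nonempty (Fin t → Fin N → Prop) with h | _
  · exact (h.false fun _ _ => True).elim
  have hcard : (univ.biUnion e).card = j * t := by
    rw [Finset.card_biUnion fun l _ l' _ h => he l l' h]
    simp [hc, mul_comm]
  by_cases hex : ∃ π : Equiv.Perm (Fin N), ∀ l, ∀ i ∈ e l, f (π i) = a l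
  · obtain ⟨π₀, hπ₀⟩ := hex
    have := card_permFibre_le hf (fun i => f (π₀ i)) (univ.biUnion e) (by omega)
    rw [hcard] at this
    have heq : (univ.filter fun π : Equiv.Perm (Fin N) => ∀ l, ∀ i ∈ e l, f (π i) = a l) =
        permFibre f (univ.biUnion e) (fun i => f (π₀ i)) := by
      ext π
      simp only [permFibre, mem_filter, mem_univ, true_and, mem_biUnion, forall_exists_index]
      exact ⟨fun h i l hi => (h l i hi).trans (hπ₀ l i hi).symm,
        fun h l i hi => (h i l hi).trans (hπ₀ l i hi)⟩
    rw [heq]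
    exact_mod_cast this
  · push Not at hex
    have : (univ.filter fun π : Equiv.Perm (Fin N) => ∀ l, ∀ i ∈ e l, f (π i) = a l) = ∅ := by
      ext π
      simp only [mem_filter, mem_univ, true_and, notMem_empty, iff_false]
      intro h
      obtain ⟨l, i, hi, hne⟩ := hex π
      exact hne (h l i hi)
    rw [this]
    simp

/-! ### Random signs -/

/-- The sign of a bit. -/
def sgn (b : Bool) : ℝ := if b then 1 else -1

theorem sgn_not (b : Bool) : sgn (!b) = -sgn b := by cases b <;> simp [sgn]

theorem sgn_mul_self (b : Bool) : sgn b * sgn b = 1 := by cases b <;> simp [sgn]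

theorem abs_sgn (b : Bool) : |sgn b| = 1 := by cases b <;> simp [sgn]

/-- The character of the sign vectors that belongs to a set of coordinates. -/
def chi {N : ℕ} (e : Finset (Fin N)) (σ : Fin N → Bool) : ℝ := ∏ i ∈ e, sgn (σ i)

/-- The sign vector with the `i`-th sign flipped. -/
def flipAt {N : ℕ} (i : Fin N) (σ : Fin N → Bool) : Fin N → Bool := Function.update σ i (!σ i)

theorem flipAt_involutive {N : ℕ} (i : Fin N) : Function.Involutive (flipAt i) := by
  intro σ
  ext j
  by_cases h : j = i
  · subst h; simp [flipAt]
  · simp [flipAt, h]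

theorem sum_flipAt {N : ℕ} (i : Fin N) (F : (Fin N → Bool) → ℝ) :
    ∑ σ, F (flipAt i σ) = ∑ σ, F σ :=
  Equiv.sum_comp ((flipAt_involutive i).toPerm (flipAt i)) F

theorem chi_flipAt_of_notMem {N : ℕ} {i : Fin N} {e : Finset (Fin N)} (h : i ∉ e)
    (σ : Fin N → Bool) : chi e (flipAt i σ) = chi e σ := by
  refine Finset.prod_congr rfl fun j hj => ?_
  have : j ≠ i := fun hji => h (hji ▸ hj)
  simp [flipAt, this]

theorem chi_flipAt_of_mem {N : ℕ} {i : Fin N} {e : Finset (Fin N)} (h : i ∈ e)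
    (σ : Fin N → Bool) : chi e (flipAt i σ) = -chi e σ := by
  have h1 := Finset.mul_prod_erase e (fun j => sgn (flipAt i σ j)) h
  have h2 := Finset.mul_prod_erase e (fun j => sgn (σ j)) h
  have h3 : ∏ j ∈ e.erase i, sgn (flipAt i σ j) = ∏ j ∈ e.erase i, sgn (σ j) :=
    chi_flipAt_of_notMem (Finset.notMem_erase i e) σ
  unfold chi
  rw [← h1, ← h2, h3]
  simp [flipAt, sgn_not]

theorem chi_mul_self {N : ℕ} (e : Finset (Fin N)) (σ : Fin N → Bool) :
    chi e σ * chi e σ = 1 := by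
  unfold chi
  rw [← Finset.prod_mul_distrib]
  exact Finset.prod_eq_one fun i _ => sgn_mul_self _

theorem sum_chi_mul_chi {N : ℕ} {e e' : Finset (Fin N)} (hne : e ≠ e')
    (G : (Fin N → Bool) → ℝ) (hG : ∀ i ∈ e ∪ e', ∀ σ, G (flipAt i σ) = G σ) :
    ∑ σ, chi e σ * chi e' σ * G σ = 0 := by
  have key : ∀ i, i ∈ e ∪ e' → (∀ σ, chi e (flipAt i σ) * chi e' (flipAt i σ) =
      -(chi e σ * chi e' σ)) → ∑ σ, chi e σ * chi e' σ * G σ = 0 := by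
    intro i hi h
    have h1 := sum_flipAt i fun σ => chi e σ * chi e' σ * G σ
    simp only [h, hG i hi, neg_mul, Finset.sum_neg_distrib] at h1
    linarith
  by_cases hsub : e ⊆ e'
  · obtain ⟨i, hi, hni⟩ := Finset.exists_of_ssubset (lt_of_le_of_ne hsub hne)
    exact key i (Finset.mem_union_right _ hi) fun σ => by
      rw [chi_flipAt_of_notMem hni, chi_flipAt_of_mem hi]; ring
  · obtain ⟨i, hi, hni⟩ := Finset.not_subset.mp hsub
    exact key i (Finset.mem_union_left _ hi) fun σ => by
      rw [chi_flipAt_of_notMem hni, chi_flipAt_of_mem hi]; ring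

theorem sum_sq_chi {N : ℕ} (𝓔 : Finset (Finset (Fin N))) (c : Finset (Fin N) → ℝ)
    (G : (Fin N → Bool) → ℝ) (hG : ∀ e ∈ 𝓔, ∀ i ∈ e, ∀ σ, G (flipAt i σ) = G σ) :
    ∑ σ, (∑ e ∈ 𝓔, c e * chi e σ) ^ 2 * G σ = (∑ e ∈ 𝓔, c e ^ 2) * ∑ σ, G σ := by
  calc ∑ σ, (∑ e ∈ 𝓔, c e * chi e σ) ^ 2 * G σ
      = ∑ σ, ∑ e ∈ 𝓔, ∑ e' ∈ 𝓔, c e * c e' * (chi e σ * chi e' σ * G σ) := by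
        refine Finset.sum_congr rfl fun σ _ => ?_
        rw [sq, Finset.sum_mul_sum, Finset.sum_mul]
        refine Finset.sum_congr rfl fun e _ => ?_
        rw [Finset.sum_mul]
        exact Finset.sum_congr rfl fun e' _ => by ring
    _ = ∑ e ∈ 𝓔, ∑ e' ∈ 𝓔, c e * c e' * ∑ σ, (chi e σ * chi e' σ * G σ) := by
        rw [Finset.sum_comm]
        refine Finset.sum_congr rfl fun e _ => ?_
        rw [Finset.sum_comm]
        exact Finset.sum_congr rfl fun e' _ => by rw [Finset.mul_sum]
    _ = ∑ e ∈ 𝓔, c e ^ 2 * ∑ σ, G σ := by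
        refine Finset.sum_congr rfl fun e he => ?_
        rw [Finset.sum_eq_single e]
        · simp only [chi_mul_self, one_mul]; ring
        · intro e' he' hne
          rw [sum_chi_mul_chi hne.symm G, mul_zero]
          intro i hi
          rcases Finset.mem_union.mp hi with h | h
          · exact hG e he i h
          · exact hG e' he' i h
        · exact fun h => absurd he h
    _ = _ := by rw [Finset.sum_mul]

theorem sum_prod_sq_chi {N : ℕ} {ι : Type*} (s : Finset ι) (𝓔 : ι → Finset (Finset (Fin N)))
    (h𝓔 : ∀ a ∈ s, ∀ a' ∈ s, a ≠ a' → ∀ e ∈ 𝓔 a, ∀ e' ∈ 𝓔 a', Disjoint e e')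
    (c : Finset (Fin N) → ℝ) :
    ∑ σ, ∏ a ∈ s, (∑ e ∈ 𝓔 a, c e * chi e σ) ^ 2 = 2 ^ N * ∏ a ∈ s, ∑ e ∈ 𝓔 a, c e ^ 2 := by
  induction s using Finset.induction_on with
  | empty => simp
  | insert a s ha ih =>
    simp only [Finset.prod_insert ha]
    rw [sum_sq_chi, ih]
    · ring
    · exact fun b hb b' hb' => h𝓔 b (mem_insert_of_mem hb) b' (mem_insert_of_mem hb')
    · intro e he i hi σ
      refine Finset.prod_congr rfl fun b hb => ?_
      congr 1
      refine Finset.sum_congr rfl fun e' he' => ?_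
      rw [chi_flipAt_of_notMem]
      have hab : a ≠ b := fun h => ha (h ▸ hb)
      exact Finset.disjoint_left.mp
        (h𝓔 a (mem_insert_self _ _) b (mem_insert_of_mem hb) hab e he e' he') hi

/-! ### Moments of the bucket polynomials -/

/-- The sets of `j` indices that a hash function `f ∘ π` puts into bucket `a`. -/
def mono {N n : ℕ} (f : Fin N → Fin n) (j : ℕ) (π : Equiv.Perm (Fin N)) (a : Fin n) :
    Finset (Finset (Fin N)) :=
  (powersetCard j univ).filter fun e => ∀ i ∈ e, f (π i) = a

/-- The random multilinear form of degree `j` in bucket `a`. -/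
def bucketPoly {N n : ℕ} (f : Fin N → Fin n) (j : ℕ) (c : Finset (Fin N) → ℝ)
    (π : Equiv.Perm (Fin N)) (σ : Fin N → Bool) (a : Fin n) : ℝ :=
  ∑ e ∈ mono f j π a, c e * chi e σ

/-- The weight of a disjoint tuple of index sets that lie in the given buckets. -/
def blockTerm {N n : ℕ} (f : Fin N → Fin n) (j : ℕ) {t : ℕ} (c : Finset (Fin N) → ℝ)
    (π : Equiv.Perm (Fin N)) (a : Fin t → Fin n) (e : Fin t → Finset (Fin N)) : ℝ :=
  if Compat Disjoint e ∧ (∀ l, e l ∈ mono f j π (a l)) then ∏ l, c (e l) ^ 2 else 0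

theorem blockTerm_nonneg {N n : ℕ} (f : Fin N → Fin n) (j : ℕ) {t : ℕ}
    (c : Finset (Fin N) → ℝ) (π : Equiv.Perm (Fin N)) (a : Fin t → Fin n)
    (e : Fin t → Finset (Fin N)) : 0 ≤ blockTerm f j c π a e := by
  unfold blockTerm
  split_ifs
  · exact Finset.prod_nonneg fun _ _ => sq_nonneg _
  · exact le_rfl

/-- The sum over all disjoint tuples of index sets and all buckets that contain them. -/
def blockSum {N n : ℕ} (f : Fin N → Fin n) (j t : ℕ) (c : Finset (Fin N) → ℝ)
    (π : Equiv.Perm (Fin N)) : ℝ :=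
  ∑ a : Fin t → Fin n, ∑ e : Fin t → Finset (Fin N), blockTerm f j c π a e

theorem sum_blockSum_le {N n : ℕ} {f : Fin N → Fin n} (hf : Balanced f) (hn : 0 < n) {j t : ℕ}
    (hN : 2 * (j * t) ≤ N) (c : Finset (Fin N) → ℝ) :
    ∑ π, blockSum f j t c π ≤
      N.factorial * (n * (2 / n) ^ j * ∑ e ∈ powersetCard j univ, c e ^ 2) ^ t := by
  have hn' : (0 : ℝ) < n := by exact_mod_cast hn
  have h1 : ∀ (a : Fin t → Fin n) (e : Fin t → Finset (Fin N)),
      ∑ π : Equiv.Perm (Fin N), blockTerm f j c π a e ≤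
      if (∀ l, e l ∈ powersetCard j (univ : Finset (Fin N))) then
        (N.factorial * (2 / n) ^ (j * t)) * ∏ l, c (e l) ^ 2 else 0 := by
    intro a e
    unfold blockTerm
    have hP : 0 ≤ ∏ l, c (e l) ^ 2 := Finset.prod_nonneg fun _ _ => sq_nonneg _
    by_cases hc : (∀ l, e l ∈ powersetCard j (univ : Finset (Fin N)))
    · rw [if_pos hc]
      by_cases hd : Compat Disjoint e
      · rw [← Finset.sum_filter, Finset.sum_const, nsmul_eq_mul]
        refine mul_le_mul_of_nonneg_right ?_ hP
        have := card_perm_blocks_le hf a e hd (fun l => (mem_powersetCard.mp (hc l)).2) hN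
        rw [div_pow, mul_div_assoc', le_div_iff₀ (by positivity), mul_comm (N.factorial : ℝ)]
        refine le_trans ?_ this
        gcongr with π
        rintro ⟨-, h⟩ l i hi
        exact (mem_filter.mp (h l)).2 i hi
      · simp only [hd, false_and, if_false, Finset.sum_const_zero]
        positivity
    · rw [if_neg hc]
      refine le_of_eq (Finset.sum_eq_zero fun π _ => if_neg ?_)
      rintro ⟨-, h⟩
      exact hc fun l => (mem_filter.mp (h l)).1
  unfold blockSum
  rw [Finset.sum_comm]
  calc _ = ∑ a : Fin t → Fin n, ∑ e : Fin t → Finset (Fin N), ∑ π : Equiv.Perm (Fin N),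
        blockTerm f j c π a e :=
        Finset.sum_congr rfl fun a _ => Finset.sum_comm
    _ ≤ ∑ a : Fin t → Fin n, ∑ e : Fin t → Finset (Fin N),
        if (∀ l, e l ∈ powersetCard j (univ : Finset (Fin N))) then
        (N.factorial * (2 / n) ^ (j * t)) * ∏ l, c (e l) ^ 2 else 0 :=
        Finset.sum_le_sum fun a _ => Finset.sum_le_sum fun e _ => h1 a e
    _ = (n : ℝ) ^ t * ((N.factorial * (2 / n) ^ (j * t)) *
          (∑ e ∈ powersetCard j (univ : Finset (Fin N)), c e ^ 2) ^ t) := by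
        rw [Finset.sum_const, card_univ, Fintype.card_fun, Fintype.card_fin, Fintype.card_fin,
          nsmul_eq_mul, Nat.cast_pow]
        congr 1
        rw [← Finset.sum_filter, ← Finset.mul_sum]
        congr 1
        have := Finset.prod_univ_sum
          (fun _ : Fin t => powersetCard j (univ : Finset (Fin N))) (fun _ e => c e ^ 2)
        rw [Finset.prod_const, card_univ, Fintype.card_fin] at this
        rw [this]
        refine Finset.sum_congr ?_ fun _ _ => rfl
        ext e
        simp [Fintype.mem_piFinset]
    _ = _ := by rw [mul_pow, mul_pow, ← pow_mul]; ring

theorem card_mul_pow_le {α : Type*} [Fintype α] (p : α → Prop) [DecidablePred p] (F : α → ℝ) (hF : ∀ x, 0 ≤ F x)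
    {M K : ℝ} (h : ∀ x, p x → M ≤ F x) (hK : ∑ x, F x ≤ K) :
    ((univ.filter p).card : ℝ) * M ≤ K := by
  calc ((univ.filter p).card : ℝ) * M = ∑ x ∈ univ.filter p, M := by
        rw [Finset.sum_const, nsmul_eq_mul]
    _ ≤ ∑ x ∈ univ.filter p, F x := Finset.sum_le_sum fun x hx => h x (mem_filter.mp hx).2
    _ ≤ ∑ x, F x := Finset.sum_le_univ_sum_of_nonneg hF
    _ ≤ K := hK

theorem blockSum_nonneg {N n : ℕ} (f : Fin N → Fin n) (j t : ℕ) (c : Finset (Fin N) → ℝ)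
    (π : Equiv.Perm (Fin N)) : 0 ≤ blockSum f j t c π := by
  exact Finset.sum_nonneg fun a _ => Finset.sum_nonneg fun e _ => blockTerm_nonneg f j c π a e

/-- Few permutations admit many disjoint index sets of size `j` with all indices in one bucket. -/
theorem card_unsigned_le {N n : ℕ} {f : Fin N → Fin n} (hf : Balanced f) (hn : 0 < n) {j t : ℕ}
    (hN : 2 * (j * t) ≤ N) (c : Finset (Fin N) → ℝ) {M : ℝ} (hM : 0 ≤ M) :
    ((univ.filter fun π : Equiv.Perm (Fin N) => ∀ D : Finset (Fin N), D.card + j ≤ j * t →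
      M ≤ ∑ e ∈ powersetCard j univ with (Disjoint e D ∧ ∃ a, e ∈ mono f j π a), c e ^ 2).card
        : ℝ) * M ^ t ≤
      N.factorial * (n * (2 / n) ^ j * ∑ e ∈ powersetCard j univ, c e ^ 2) ^ t := by
  refine card_mul_pow_le _ (blockSum f j t c) (blockSum_nonneg f j t c) ?_
    (sum_blockSum_le hf hn hN c)
  intro π hπ
  set φ : Finset (Fin N) → ℝ := fun e => if (∃ a, e ∈ mono f j π a) then c e ^ 2 else 0 with hφdef
  have hφ : ∀ e, 0 ≤ φ e := fun e => by
    simp only [hφdef]; split_ifs <;> positivity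
  have hex : ∀ e, (∃ a, e ∈ mono f j π a) → e.card = j := fun e ⟨a, h⟩ =>
    (mem_powersetCard.mp (mem_filter.mp h).1).2
  have h1 := pow_le_sum_compat (R := (Disjoint : Finset (Fin N) → Finset (Fin N) → Prop))
    (fun x y h => h.symm) φ hφ hM t ?_
  · refine h1.trans ?_
    unfold blockSum
    rw [Finset.sum_comm]
    refine Finset.sum_le_sum fun e _ => ?_
    by_cases hd : Compat Disjoint e
    · rw [if_pos hd]
      by_cases hm : ∀ l, ∃ a, e l ∈ mono f j π a
      · choose a ha using hm
        refine le_trans (le_of_eq ?_) (Finset.single_le_sum (f := fun a => blockTerm f j c π a e)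
          (fun a _ => blockTerm_nonneg f j c π a e) (mem_univ a))
        unfold blockTerm
        rw [if_pos ⟨hd, ha⟩]
        refine Finset.prod_congr rfl fun l _ => ?_
        simp only [hφdef]
        rw [if_pos ⟨a l, ha l⟩]
      · push Not at hm
        obtain ⟨l, hl⟩ := hm
        have : ∏ l, φ (e l) = 0 := Finset.prod_eq_zero (mem_univ l) (by
          simp only [hφdef]
          rw [if_neg]
          push Not
          exact hl)
        rw [this]
        exact Finset.sum_nonneg fun a _ => blockTerm_nonneg f j c π a e
    · rw [if_neg hd]
      exact Finset.sum_nonneg fun a _ => blockTerm_nonneg f j c π a e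
  · intro u hu a ha
    have hD : (univ.biUnion a).card + j ≤ j * t := by
      have h1 : ∀ l, (a l).card ≤ j := fun l => by
        by_cases h : ∃ b, a l ∈ mono f j π b
        · exact (hex _ h).le
        · exact absurd (if_neg h) (ha l)
      have : (univ.biUnion a).card ≤ u * j := by
        refine (Finset.card_biUnion_le).trans ?_
        refine (Finset.sum_le_sum fun l _ => h1 l).trans ?_
        simp
      calc (univ.biUnion a).card + j ≤ u * j + j := by gcongr
        _ = (u + 1) * j := by ring
        _ ≤ t * j := Nat.mul_le_mul_right j hu
        _ = j * t := mul_comm _ _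
    refine (hπ _ hD).trans (le_of_eq ?_)
    simp only [hφdef]
    rw [← Finset.sum_filter, Finset.filter_filter]
    refine Finset.sum_congr ?_ fun _ _ => rfl
    ext e
    simp only [mem_filter, mem_univ, true_and, Finset.disjoint_biUnion_right, true_implies,
      mem_powersetCard, subset_univ]
    exact ⟨fun h => h.2, fun h => ⟨hex e h.2, h⟩⟩

/-- Few pairs of a permutation and a sign vector give bucket polynomials with a large sum of
squares outside every small set of buckets. -/
theorem card_signed_le {N n : ℕ} {f : Fin N → Fin n} (hf : Balanced f) (hn : 0 < n) {j t : ℕ}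
    (hN : 2 * (j * t) ≤ N) (c : Finset (Fin N) → ℝ) {M : ℝ} (hM : 0 ≤ M) :
    ((univ.filter fun p : Equiv.Perm (Fin N) × (Fin N → Bool) => ∀ B : Finset (Fin n),
      B.card < t → M ≤ ∑ a ∈ Bᶜ, bucketPoly f j c p.1 p.2 a ^ 2).card : ℝ) * M ^ t ≤
      N.factorial * 2 ^ N * (n * (2 / n) ^ j * ∑ e ∈ powersetCard j univ, c e ^ 2) ^ t := by
  refine card_mul_pow_le _ (fun p => ∑ a : Fin t → Fin n, if Compat (· ≠ ·) a then
    ∏ l, bucketPoly f j c p.1 p.2 (a l) ^ 2 else 0) ?_ ?_ ?_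
  · intro p
    refine Finset.sum_nonneg fun a _ => ?_
    split_ifs
    · exact Finset.prod_nonneg fun _ _ => sq_nonneg _
    · exact le_rfl
  · intro p hp
    refine pow_le_sum_compat (fun x y h => h.symm) _ (fun x => sq_nonneg _) hM t ?_
    intro u hu a _
    have hc : (univ.image a).card < t := by
      refine lt_of_le_of_lt Finset.card_image_le ?_
      simpa using hu
    refine (hp _ hc).trans (le_of_eq ?_)
    refine Finset.sum_congr ?_ fun _ _ => rfl
    ext b
    simp [eq_comm]
  · have key : ∀ π : Equiv.Perm (Fin N), (∑ σ : Fin N → Bool, ∑ a : Fin t → Fin n,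
        if Compat (· ≠ ·) a then ∏ l, bucketPoly f j c π σ (a l) ^ 2 else 0) ≤
        2 ^ N * blockSum f j t c π := by
      intro π
      rw [Finset.sum_comm]
      unfold blockSum
      rw [Finset.mul_sum]
      refine Finset.sum_le_sum fun a _ => ?_
      have hdis : Compat (· ≠ ·) a → ∀ l l', l ≠ l' → ∀ e ∈ mono f j π (a l),
          ∀ e' ∈ mono f j π (a l'), Disjoint e e' := by
        intro ha l l' hl e he e' he'
        refine Finset.disjoint_left.mpr fun i hi hi' => ha l l' hl ?_
        rw [← (mem_filter.mp he).2 i hi, ← (mem_filter.mp he').2 i hi']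
      by_cases ha : Compat (· ≠ ·) a
      · simp only [ha, if_true]
        unfold bucketPoly
        rw [sum_prod_sq_chi univ (fun l => mono f j π (a l))
          fun l _ l' _ hl => hdis ha l l' hl, Finset.prod_univ_sum]
        refine le_of_eq ?_
        congr 1
        unfold blockTerm
        rw [← Finset.sum_filter]
        refine Finset.sum_congr ?_ fun _ _ => rfl
        ext e
        simp only [Fintype.mem_piFinset, mem_filter, mem_univ, true_and]
        exact ⟨fun h => ⟨fun l l' hl => hdis ha l l' hl _ (h l) _ (h l'), h⟩, fun h => h.2⟩
      · simp only [ha, if_false, Finset.sum_const_zero]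
        exact mul_nonneg (by positivity)
          (Finset.sum_nonneg fun e _ => blockTerm_nonneg f j c π a e)
    rw [Fintype.sum_prod_type]
    calc _ ≤ ∑ π, 2 ^ N * blockSum f j t c π := Finset.sum_le_sum fun π _ => key π
      _ = 2 ^ N * ∑ π, blockSum f j t c π := by rw [Finset.mul_sum]
      _ ≤ 2 ^ N * (N.factorial * (n * (2 / n) ^ j * ∑ e ∈ powersetCard j univ, c e ^ 2) ^ t) := by
        gcongr
        exact sum_blockSum_le hf hn hN c
      _ = _ := by ring

/-! ### Folding a vector along a hash function -/

/-- The vector of bucket sums. -/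
def fold {N n : ℕ} (f : Fin N → Fin n) (x : Fin N → ℝ) : Fin n → ℝ :=
  fun a => ∑ i with f i = a, x i

/-- The vector with signs attached. -/
def signed {N : ℕ} (σ : Fin N → Bool) (x : Fin N → ℝ) : Fin N → ℝ := fun i => sgn (σ i) * x i

theorem fold_fold {N n n' : ℕ} (f : Fin N → Fin n) (f' : Fin n → Fin n') (x : Fin N → ℝ) :
    fold f' (fold f x) = fold (f' ∘ f) x := by
  funext a
  simp only [fold, Function.comp_apply]
  rw [← Finset.sum_fiberwise_of_maps_to (s := univ.filter fun i => f' (f i) = a)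
    (t := univ.filter fun b => f' b = a) (g := f) (by simp)]
  refine Finset.sum_congr rfl fun b hb => Finset.sum_congr ?_ fun _ _ => rfl
  ext i
  simp only [mem_filter, mem_univ, true_and] at hb ⊢
  exact ⟨fun h => ⟨h ▸ hb, h⟩, fun h => h.2⟩

/-- All but `β` of the elements of `X` are hashed injectively to heavy entries of a head of
`y`. -/
def NodeGood {ι : Type*} [DecidableEq ι] {n : ℕ} (k : ℕ) (θ β : ℝ) (y : Fin n → ℝ) (X : Finset ι)
    (φ : ι → Fin n) : Prop :=
  ∃ Bad : Finset ι, (Bad.card : ℝ) ≤ β ∧ ∃ H' : Finset (Fin n), H'.card ≤ k ∧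
    Set.InjOn φ (X \ Bad : Finset ι) ∧
    ∀ i ∈ X \ Bad, φ i ∈ H' ∧ θ * tailNorm y H' < |y (φ i)|

theorem exists_smallest {ι : Type*} [DecidableEq ι] (w : ι → ℝ) (s : Finset ι) (m : ℕ) (hm : m ≤ s.card) :
    ∃ U ⊆ s, U.card = m ∧ ∀ v ∈ U, ∀ i ∈ s \ U, w v ≤ w i := by
  induction m with
  | zero => exact ⟨∅, empty_subset _, rfl, by simp⟩
  | succ m ih =>
    obtain ⟨U, hU, hc, hle⟩ := ih (by omega)
    have hne : (s \ U).Nonempty := by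
      rw [← Finset.card_pos, Finset.card_sdiff_of_subset hU]
      omega
    obtain ⟨v₀, hv₀, hmin⟩ := Finset.exists_min_image (s \ U) w hne
    rw [mem_sdiff] at hv₀
    refine ⟨insert v₀ U, insert_subset hv₀.1 hU, by rw [card_insert_of_notMem hv₀.2, hc], ?_⟩
    intro v hv i hi
    simp only [mem_sdiff, mem_insert, not_or] at hi
    have hi' : i ∈ s \ U := mem_sdiff.mpr ⟨hi.1, hi.2.2⟩
    rcases mem_insert.mp hv with rfl | hv
    · exact hmin i hi'
    · exact hle v hv i hi'

/-! ### Collisions -/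

/-- The elements of `S` that are not the first ones in their buckets. -/
def nonFirst {N n : ℕ} (g : Fin N → Fin n) (S : Finset (Fin N)) : Finset (Fin N) :=
  S.filter fun i => ∃ j ∈ S, j < i ∧ g j = g i

/-- The elements of `S` that share their bucket with another element of `S`. -/
def colliding {N n : ℕ} (g : Fin N → Fin n) (S : Finset (Fin N)) : Finset (Fin N) :=
  S.filter fun i => ∃ j ∈ S, j ≠ i ∧ g j = g i

theorem card_nonFirst_add {N n : ℕ} (g : Fin N → Fin n) (S : Finset (Fin N)) :
    (nonFirst g S).card + (S.image g).card = S.card := by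
  have h1 : (S.image g) = (S.filter fun i => ¬ ∃ j ∈ S, j < i ∧ g j = g i).image g := by
    refine Finset.Subset.antisymm ?_ (Finset.image_subset_image (filter_subset _ _))
    intro a ha
    obtain ⟨i, hi, rfl⟩ := mem_image.mp ha
    have hne : (S.filter fun j => g j = g i).Nonempty := ⟨i, by simp [hi]⟩
    obtain ⟨m, hm, hmin⟩ := Finset.exists_min_image _ id hne
    rw [mem_filter] at hm
    refine mem_image.mpr ⟨m, mem_filter.mpr ⟨hm.1, ?_⟩, hm.2⟩
    rintro ⟨j, hj, hlt, hg⟩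
    exact absurd (hmin j (mem_filter.mpr ⟨hj, hg.trans hm.2⟩)) (not_le.mpr hlt)
  rw [h1, Finset.card_image_of_injOn, nonFirst, Finset.card_filter_add_card_filter_not]
  intro i hi i' hi' h
  simp only [coe_filter, Set.mem_ofPred_eq, not_exists, not_and] at hi hi'
  rcases lt_trichotomy i i' with hlt | heq | hlt
  · exact absurd h (hi'.2 i hi.1 hlt)
  · exact heq
  · exact absurd h.symm (hi.2 i' hi'.1 hlt)

theorem card_colliding_le {N n : ℕ} (g : Fin N → Fin n) (S : Finset (Fin N)) :
    (colliding g S).card ≤ 2 * (nonFirst g S).card := by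
  have h1 : ∀ i : Fin N, ∃ j, i ∈ colliding g S \ nonFirst g S →
      j ∈ nonFirst g S ∧ g j = g i := by
    intro i
    by_cases hi : i ∈ colliding g S \ nonFirst g S
    · obtain ⟨hc, hn⟩ := mem_sdiff.mp hi
      obtain ⟨hS, j, hj, hne, hg⟩ := mem_filter.mp hc
      refine ⟨j, fun _ => ⟨mem_filter.mpr ⟨hj, i, hS, ?_, hg.symm⟩, hg⟩⟩
      refine lt_of_le_of_ne (not_lt.mp fun hlt => hn ?_) hne.symm
      exact mem_filter.mpr ⟨hS, j, hj, hlt, hg⟩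
    · exact ⟨i, fun h => absurd h hi⟩
  choose p hp using h1
  have h2 : (colliding g S \ nonFirst g S).card ≤ (nonFirst g S).card := by
    refine Finset.card_le_card_of_injOn p (fun i hi => (hp i hi).1) ?_
    intro i hi i' hi' h
    have hg : g i = g i' := by rw [← (hp i hi).2, ← (hp i' hi').2, h]
    obtain ⟨hc, hn⟩ := mem_sdiff.mp hi
    obtain ⟨hc', hn'⟩ := mem_sdiff.mp hi'
    have hS := (mem_filter.mp hc).1
    have hS' := (mem_filter.mp hc').1
    rcases lt_trichotomy i i' with hlt | heq | hlt
    · exact absurd (mem_filter.mpr ⟨hS', i, hS, hlt, hg⟩) hn'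
    · exact heq
    · exact absurd (mem_filter.mpr ⟨hS, i', hS', hlt, hg.symm⟩) hn
  have h3 := Finset.card_le_card_sdiff_add_card (t := nonFirst g S) (s := colliding g S)
  omega

/-! ### The deterministic condition for a good hash function -/

/-- The signed sum over the part of a bucket outside the head. -/
def tailSum {N n : ℕ} (g : Fin N → Fin n) (σ : Fin N → Bool) (x : Fin N → ℝ)
    (H : Finset (Fin N)) (a : Fin n) : ℝ :=
  ∑ i with i ∉ H ∧ g i = a, signed σ x i

theorem fold_eq_head_add_tail {N n : ℕ} (g : Fin N → Fin n) (σ : Fin N → Bool)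
    (x : Fin N → ℝ) (H : Finset (Fin N)) (a : Fin n) :
    fold g (signed σ x) a = ∑ i ∈ H with g i = a, signed σ x i + tailSum g σ x H a := by
  unfold fold tailSum
  rw [← Finset.sum_filter_add_sum_filter_not (univ.filter fun i => g i = a) (fun i => i ∈ H),
    Finset.filter_filter, Finset.filter_filter]
  congr 1
  · refine Finset.sum_congr ?_ fun _ _ => rfl
    ext i; simp [and_comm]
  · refine Finset.sum_congr ?_ fun _ _ => rfl
    ext i; simp [and_comm]

theorem abs_signed {N : ℕ} (σ : Fin N → Bool) (x : Fin N → ℝ) (i : Fin N) :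
    |signed σ x i| = |x i| := by
  simp [signed, abs_mul, abs_sgn]

theorem signed_sq {N : ℕ} (σ : Fin N → Bool) (x : Fin N → ℝ) (i : Fin N) :
    signed σ x i ^ 2 = x i ^ 2 := by
  rw [← sq_abs, abs_signed, sq_abs]

theorem nodeGood_of_events {N n k u : ℕ} {τ η Γ Z θ : ℝ} (hk : 1 ≤ k) (hτ : 0 < τ) (hη : 0 < η)
    (hη1 : η < 1) (hZ : 0 < Z) (hu : 32 * τ ^ 2 * u ≤ k) (hΓ : 288 * τ ^ 2 ≤ Γ ^ 2)
    (hθ : 4 * θ ^ 2 = Γ ^ 2 * (η / k) * Z)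
    (g : Fin N → Fin n) (σ : Fin N → Bool) (x : Fin N → ℝ) (H X : Finset (Fin N))
    (hH : H.card ≤ k) (hXH : X ⊆ H) (hX : ∀ i ∈ X, Γ ^ 2 * (η / k) * Z < x i ^ 2)
    (hcol : (nonFirst g H).card ≤ 3 * u)
    (hbad : ((X \ colliding g H).filter fun i => θ < |tailSum g σ x H (g i)|).card ≤ 2 * u)
    (B : Finset (Fin n)) (hB : B.card ≤ 2 * u)
    (hBs : ∑ a ∈ Bᶜ, tailSum g σ x H a ^ 2 ≤ 18 * Z) :
    NodeGood k (τ * Real.sqrt (η / k)) ((10 * u : ℕ) : ℝ) (fold g (signed σ x)) X g := by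
  have hk' : (0 : ℝ) < k := by exact_mod_cast hk
  set V := colliding g H with hV
  have hVc : V.card ≤ 6 * u := (card_colliding_le g H).trans (by omega)
  set T := (X \ V).filter fun i => θ < |tailSum g σ x H (g i)| with hT
  rcases Nat.lt_or_ge (X \ V).card (2 * u) with hsmall | hlarge
  · refine ⟨X, ?_, ∅, by simp, by simp, by simp⟩
    have := Finset.card_le_card_sdiff_add_card (t := V) (s := X)
    exact_mod_cast (by omega : X.card ≤ 10 * u)
  obtain ⟨U, hU, hUc, hUle⟩ := exists_smallest (fun i => |x i|) (X \ V) (2 * u) hlarge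
  have hUH : U ⊆ H := fun i hi => hXH (mem_sdiff.mp (hU hi)).1
  refine ⟨V ∪ U ∪ T, ?_, (H \ U).image g ∪ B, ?_, ?_, ?_⟩
  · have h1 := Finset.card_union_le (V ∪ U) T
    have h2 := Finset.card_union_le V U
    exact_mod_cast (by omega : (V ∪ U ∪ T).card ≤ 10 * u)
  · have h1 := Finset.card_union_le ((H \ U).image g) B
    have h2 : ((H \ U).image g).card ≤ (H \ U).card := Finset.card_image_le
    have h3 := Finset.card_sdiff_of_subset hUH
    have h4 := Finset.card_le_card hUH
    omega
  · intro i hi i' hi' h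
    simp only [coe_sdiff, Set.mem_sdiff, mem_coe, mem_union, not_or] at hi hi'
    by_contra hne
    exact hi.2.1.1 (mem_filter.mpr ⟨hXH hi.1, i', hXH hi'.1, fun h => hne h.symm, h.symm⟩)
  · intro i hi
    simp only [mem_sdiff, mem_union, not_or] at hi
    obtain ⟨hiX, ⟨hiV, hiU⟩, hiT⟩ := hi
    have hiW : i ∈ X \ V := mem_sdiff.mpr ⟨hiX, hiV⟩
    have hiH : i ∈ H := hXH hiX
    have hgi : g i ∈ (H \ U).image g ∪ B :=
      mem_union_left _ (mem_image_of_mem _ (mem_sdiff.mpr ⟨hiH, hiU⟩))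
    refine ⟨hgi, ?_⟩
    have hxi := hX i hiX
    have hY : |tailSum g σ x H (g i)| ≤ θ := by
      by_contra hlt
      exact hiT (mem_filter.mpr ⟨hiW, not_le.mp hlt⟩)
    have h2θ : 2 * θ < |x i| := by
      refine lt_of_pow_lt_pow_left₀ 2 (abs_nonneg _) ?_
      rw [sq_abs]
      nlinarith
    have hhead : H.filter (fun j => g j = g i) = {i} := by
      ext j
      simp only [mem_filter, mem_singleton]
      refine ⟨fun h => ?_, fun h => by subst h; exact ⟨hiH, rfl⟩⟩
      by_contra hne
      exact hiV (mem_filter.mpr ⟨hiH, j, h.1, hne, h.2⟩)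
    have hyi : |x i| / 2 < |fold g (signed σ x) (g i)| := by
      rw [fold_eq_head_add_tail g σ x H, hhead, Finset.sum_singleton]
      have h1 := abs_sub_abs_le_abs_sub (signed σ x i) (-tailSum g σ x H (g i))
      rw [sub_neg_eq_add, abs_neg, abs_signed] at h1
      linarith
    have htail : ∑ a ∈ ((H \ U).image g ∪ B)ᶜ, fold g (signed σ x) a ^ 2 ≤
        2 * (2 * u * x i ^ 2) + 2 * (18 * Z) := by
      have h1 : ∀ a ∈ ((H \ U).image g ∪ B)ᶜ, fold g (signed σ x) a ^ 2 ≤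
          2 * ∑ j ∈ U with g j = a, x j ^ 2 + 2 * tailSum g σ x H a ^ 2 := by
        intro a ha
        simp only [mem_compl, mem_union, mem_image, mem_sdiff, not_or, not_exists, not_and,
          and_imp] at ha
        have hHU : H.filter (fun j => g j = a) = U.filter (fun j => g j = a) := by
          ext j
          simp only [mem_filter]
          refine ⟨fun h => ⟨?_, h.2⟩, fun h => ⟨hUH h.1, h.2⟩⟩
          by_contra hj
          exact ha.1 j h.1 hj h.2
        have hsq : (∑ j ∈ U with g j = a, signed σ x j) ^ 2 = ∑ j ∈ U with g j = a, x j ^ 2 := by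
          have hc : (U.filter (fun j => g j = a)).card ≤ 1 := by
            rw [Finset.card_le_one]
            intro j hj j' hj'
            rw [mem_filter] at hj hj'
            by_contra hne
            exact (mem_sdiff.mp (hU hj.1)).2 (mem_filter.mpr ⟨hUH hj.1, j', hUH hj'.1,
              fun h => hne h.symm, hj'.2.trans hj.2.symm⟩)
          rcases Nat.le_one_iff_eq_zero_or_eq_one.mp hc with h | h
          · rw [Finset.card_eq_zero.mp h]; simp
          · obtain ⟨j, hj⟩ := Finset.card_eq_one.mp h
            rw [hj]; simp [signed_sq]
        rw [fold_eq_head_add_tail g σ x H, hHU, ← hsq]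
        nlinarith [sq_nonneg (∑ j ∈ U with g j = a, signed σ x j - tailSum g σ x H a)]
      refine (Finset.sum_le_sum h1).trans ?_
      rw [Finset.sum_add_distrib, ← Finset.mul_sum, ← Finset.mul_sum]
      have h2 : ∑ a ∈ ((H \ U).image g ∪ B)ᶜ, ∑ j ∈ U with g j = a, x j ^ 2 ≤
          2 * u * x i ^ 2 := by
        calc _ ≤ ∑ a, ∑ j ∈ U with g j = a, x j ^ 2 :=
              Finset.sum_le_univ_sum_of_nonneg fun a => Finset.sum_nonneg fun _ _ => sq_nonneg _
          _ = ∑ j ∈ U, x j ^ 2 := Finset.sum_fiberwise U g _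
          _ ≤ ∑ j ∈ U, x i ^ 2 := by
            refine Finset.sum_le_sum fun j hj => ?_
            exact sq_le_sq.mpr (hUle j hj i (mem_sdiff.mpr ⟨hiW, hiU⟩))
          _ = _ := by rw [Finset.sum_const, hUc, nsmul_eq_mul]; push_cast; ring
      have h3 : ∑ a ∈ ((H \ U).image g ∪ B)ᶜ, tailSum g σ x H a ^ 2 ≤ 18 * Z := by
        refine le_trans (Finset.sum_le_sum_of_subset_of_nonneg ?_ fun _ _ _ => sq_nonneg _) hBs
        exact Finset.compl_subset_compl.mpr subset_union_right
      gcongr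
    refine lt_of_le_of_lt ?_ hyi
    unfold tailNorm
    rw [mul_assoc, ← Real.sqrt_mul (by positivity)]
    have h4 : η / k * ∑ a ∈ ((H \ U).image g ∪ B)ᶜ, fold g (signed σ x) a ^ 2 ≤
        (|x i| / (2 * τ)) ^ 2 := by
      rw [div_pow, sq_abs, le_div_iff₀ (by positivity)]
      calc (η / k * ∑ a ∈ ((H \ U).image g ∪ B)ᶜ, fold g (signed σ x) a ^ 2) * (2 * τ) ^ 2
          ≤ η / k * (2 * (2 * u * x i ^ 2) + 2 * (18 * Z)) * (2 * τ) ^ 2 := by gcongr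
        _ = η * ((16 * τ ^ 2 * u) / k * x i ^ 2) + 144 * τ ^ 2 * (η / k * Z) := by ring
        _ ≤ 1 * (1 / 2 * x i ^ 2) + Γ ^ 2 / 2 * (η / k * Z) := by
          have : 16 * τ ^ 2 * u / k ≤ 1 / 2 := by
            rw [div_le_iff₀ hk']; linarith
          gcongr
          · linarith
        _ ≤ x i ^ 2 := by nlinarith
    calc τ * Real.sqrt (η / k * ∑ a ∈ ((H \ U).image g ∪ B)ᶜ, fold g (signed σ x) a ^ 2)
        ≤ τ * (|x i| / (2 * τ)) := by
          gcongr
          exact Real.sqrt_le_iff.mpr ⟨by positivity, h4⟩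
      _ = |x i| / 2 := by field_simp

/-- An injective hash function is good. -/
theorem nodeGood_of_injective {N n k : ℕ} {θ β : ℝ} (hβ : 0 ≤ β)
    (g : Fin N → Fin n) (hg : Function.Bijective g) (σ : Fin N → Bool) (x : Fin N → ℝ)
    (H X : Finset (Fin N)) (hH : H.card ≤ k) (hXH : X ⊆ H)
    (hX : ∀ i ∈ X, θ * tailNorm x H < |x i|) :
    NodeGood k θ β (fold g (signed σ x)) X g := by
  have hfold : ∀ i, fold g (signed σ x) (g i) = signed σ x i := by
    intro i
    unfold fold
    have : univ.filter (fun j => g j = g i) = {i} := by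
      ext j; simp [hg.1.eq_iff]
    rw [this, Finset.sum_singleton]
  refine ⟨∅, by simpa using hβ, H.image g, Finset.card_image_le.trans hH, hg.1.injOn, ?_⟩
  intro i hi
  rw [sdiff_empty] at hi
  refine ⟨mem_image_of_mem _ (hXH hi), ?_⟩
  rw [hfold, abs_signed]
  refine lt_of_le_of_lt (le_of_eq ?_) (hX i hi)
  have : (H.image g)ᶜ = Hᶜ.image g := by
    ext a
    obtain ⟨j, rfl⟩ := hg.2 a
    simp [hg.1.eq_iff]
  unfold tailNorm
  rw [this, Finset.sum_image fun a _ b _ h => hg.1 h]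
  simp only [hfold, signed_sq]

/-! ### Random hash functions are good -/

/-- The monomial coefficients of the tail. -/
def tailCoef {N : ℕ} (H : Finset (Fin N)) (κ : ℝ) (x : Fin N → ℝ) (e : Finset (Fin N)) : ℝ :=
  if Disjoint e H then κ * ∏ i ∈ e, x i else 0

/-- The coefficients that couple one element of the head with one of the tail. -/
def mixedCoef {N : ℕ} (H : Finset (Fin N)) (x : Fin N → ℝ) (e : Finset (Fin N)) : ℝ :=
  if (e ∩ H).card = 1 then ∑ i ∈ e \ H, x i else 0

/-- The indicator of the subsets of the head. -/
def headCoef {N : ℕ} (H e : Finset (Fin N)) : ℝ := if e ⊆ H then 1 else 0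

theorem sq_sum_eq {ι : Type*} [DecidableEq ι] (v : ι → ℝ) (S : Finset ι) :
    (∑ i ∈ S, v i) ^ 2 = ∑ i ∈ S, v i ^ 2 + 2 * ∑ e ∈ powersetCard 2 S, ∏ i ∈ e, v i := by
  induction S using Finset.induction_on with
  | empty => rw [Finset.powersetCard_eq_empty.mpr (by simp)]; simp
  | insert a S ha ih =>
    rw [Finset.sum_insert ha, Finset.sum_insert ha, Finset.powersetCard_succ_insert ha,
      Finset.sum_union, Finset.sum_image, add_sq, ih]
    · have : ∑ e ∈ powersetCard 1 S, ∏ i ∈ insert a e, v i = v a * ∑ i ∈ S, v i := by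
        rw [Finset.powersetCard_one, Finset.sum_map, Finset.mul_sum]
        refine Finset.sum_congr rfl fun i hi => ?_
        have : a ≠ i := fun h => ha (h ▸ hi)
        simp [Finset.prod_pair this]
      rw [this]
      ring
    · intro e he e' he' h
      have h1 : a ∉ e := fun h => ha ((mem_powersetCard.mp he).1 h)
      have h2 : a ∉ e' := fun h => ha ((mem_powersetCard.mp he').1 h)
      rw [← Finset.erase_insert h1, ← Finset.erase_insert h2, h]
    · refine Finset.disjoint_left.mpr fun e he he' => ?_
      obtain ⟨e', -, rfl⟩ := mem_image.mp he'
      exact ha ((mem_powersetCard.mp he).1 (mem_insert_self _ _))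

theorem chi_mul_prod {N : ℕ} (e : Finset (Fin N)) (σ : Fin N → Bool) (x : Fin N → ℝ) :
    (∏ i ∈ e, x i) * chi e σ = ∏ i ∈ e, signed σ x i := by
  unfold chi signed
  rw [← Finset.prod_mul_distrib]
  exact Finset.prod_congr rfl fun i _ => mul_comm _ _

theorem bucketPoly_tailCoef {N n : ℕ} (f : Fin N → Fin n) (j : ℕ) (H : Finset (Fin N)) (κ : ℝ)
    (x : Fin N → ℝ) (π : Equiv.Perm (Fin N)) (σ : Fin N → Bool) (a : Fin n) :
    bucketPoly f j (tailCoef H κ x) π σ a =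
      κ * ∑ e ∈ powersetCard j (univ.filter fun i => i ∉ H ∧ f (π i) = a),
        ∏ i ∈ e, signed σ x i := by
  unfold bucketPoly tailCoef
  rw [Finset.mul_sum]
  simp only [ite_mul, zero_mul]
  rw [← Finset.sum_filter]
  refine Finset.sum_congr ?_ fun e _ => by rw [mul_assoc, chi_mul_prod]
  ext e
  simp only [mono, mem_filter, mem_powersetCard, Finset.subset_iff, true_and,
    mem_univ, Finset.disjoint_left]
  exact ⟨fun h => ⟨fun i hi => ⟨h.2 hi, h.1.2 i hi⟩, h.1.1.2⟩,
    fun h => ⟨⟨⟨fun _ _ => trivial, h.2⟩, fun i hi => (h.1 hi).2⟩, fun i hi => (h.1 hi).1⟩⟩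

theorem bucketPoly_tailCoef_one {N n : ℕ} (f : Fin N → Fin n) (H : Finset (Fin N))
    (x : Fin N → ℝ) (π : Equiv.Perm (Fin N)) (σ : Fin N → Bool) (a : Fin n) :
    bucketPoly f 1 (tailCoef H 1 x) π σ a = tailSum (f ∘ π) σ x H a := by
  rw [bucketPoly_tailCoef, one_mul, Finset.powersetCard_one, Finset.sum_map]
  simp [tailSum]

theorem tailSum_sq {N n : ℕ} (f : Fin N → Fin n) (H : Finset (Fin N))
    (x : Fin N → ℝ) (π : Equiv.Perm (Fin N)) (σ : Fin N → Bool) (a : Fin n) :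
    tailSum (f ∘ π) σ x H a ^ 2 = ∑ i with i ∉ H ∧ f (π i) = a, x i ^ 2 +
      bucketPoly f 2 (tailCoef H 2 x) π σ a := by
  rw [bucketPoly_tailCoef]
  unfold tailSum
  rw [sq_sum_eq]
  simp only [signed_sq, Function.comp_apply]

theorem sum_tailCoef_sq {N : ℕ} (H : Finset (Fin N)) (κ : ℝ) (x : Fin N → ℝ) (j : ℕ) :
    ∑ e ∈ powersetCard j univ, tailCoef H κ x e ^ 2 =
      κ ^ 2 * ∑ e ∈ powersetCard j Hᶜ, ∏ i ∈ e, x i ^ 2 := by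
  unfold tailCoef
  rw [Finset.mul_sum]
  simp only [ite_pow, ne_eq, OfNat.ofNat_ne_zero, not_false_eq_true, zero_pow]
  rw [← Finset.sum_filter]
  refine Finset.sum_congr ?_ fun e _ => by rw [mul_pow, Finset.prod_pow]
  ext e
  simp only [mem_filter, mem_powersetCard, subset_univ, true_and, ← le_compl_iff_disjoint_right]
  exact and_comm

theorem sum_tailCoef_one_sq {N : ℕ} (H : Finset (Fin N)) (x : Fin N → ℝ) :
    ∑ e ∈ powersetCard 1 univ, tailCoef H 1 x e ^ 2 = ∑ i ∈ Hᶜ, x i ^ 2 := by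
  rw [sum_tailCoef_sq, Finset.powersetCard_one, Finset.sum_map]
  simp

theorem sum_tailCoef_two_sq_le {N : ℕ} (H : Finset (Fin N)) (x : Fin N → ℝ) :
    ∑ e ∈ powersetCard 2 univ, tailCoef H 2 x e ^ 2 ≤ 2 * (∑ i ∈ Hᶜ, x i ^ 2) ^ 2 := by
  rw [sum_tailCoef_sq, sq_sum_eq]
  have : 0 ≤ ∑ i ∈ Hᶜ, (x i ^ 2) ^ 2 := Finset.sum_nonneg fun _ _ => sq_nonneg _
  linarith

theorem mixedCoef_pair {N : ℕ} {H : Finset (Fin N)} (x : Fin N → ℝ) {i i' : Fin N}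
    (hi : i ∈ H) (hi' : i' ∉ H) : mixedCoef H x {i, i'} = x i' := by
  have h1 : ({i, i'} : Finset (Fin N)) ∩ H = {i} := by
    ext j; simp only [mem_inter, mem_insert, mem_singleton]
    constructor
    · rintro ⟨rfl | rfl, h⟩
      · rfl
      · exact absurd h hi'
    · rintro rfl; exact ⟨Or.inl rfl, hi⟩
  have h2 : ({i, i'} : Finset (Fin N)) \ H = {i'} := by
    ext j; simp only [mem_sdiff, mem_insert, mem_singleton]
    constructor
    · rintro ⟨rfl | rfl, h⟩
      · exact absurd hi h
      · rfl
    · rintro rfl; exact ⟨Or.inr rfl, hi'⟩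
  rw [mixedCoef, h1, h2, if_pos (card_singleton _), sum_singleton]

theorem eq_pair_of_mixedCoef_ne {N : ℕ} {H e : Finset (Fin N)} {x : Fin N → ℝ}
    (he : e.card = 2) (h : mixedCoef H x e ≠ 0) :
    ∃ i ∈ H, ∃ i' ∉ H, e = {i, i'} := by
  have h1 : (e ∩ H).card = 1 := by
    by_contra hne
    exact h (if_neg hne)
  have h2 : (e \ H).card = 1 := by
    have := Finset.card_sdiff_add_card_inter e H
    omega
  obtain ⟨i, hi⟩ := Finset.card_eq_one.mp h1
  obtain ⟨i', hi'⟩ := Finset.card_eq_one.mp h2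
  refine ⟨i, (mem_inter.mp (hi ▸ mem_singleton_self i)).2, i',
    (mem_sdiff.mp (hi' ▸ mem_singleton_self i')).2, ?_⟩
  rw [← Finset.sdiff_union_inter e H, hi, hi']
  ext j; simp [or_comm]

theorem sum_mixedCoef_sq_le {N k : ℕ} {H : Finset (Fin N)} (hH : H.card ≤ k) (x : Fin N → ℝ) :
    ∑ e ∈ powersetCard 2 univ, mixedCoef H x e ^ 2 ≤ k * ∑ i ∈ Hᶜ, x i ^ 2 := by
  set P := (powersetCard 2 univ).filter fun e => mixedCoef H x e ≠ 0
  have h1 : ∑ e ∈ powersetCard 2 univ, mixedCoef H x e ^ 2 = ∑ e ∈ P, mixedCoef H x e ^ 2 := by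
    rw [Finset.sum_filter]
    refine Finset.sum_congr rfl fun e _ => ?_
    split_ifs with h
    · rfl
    · rw [not_not.mp h]; simp
  have h2 : P ⊆ (H ×ˢ Hᶜ).image fun p => ({p.1, p.2} : Finset (Fin N)) := by
    intro e he
    obtain ⟨hc, hne⟩ := mem_filter.mp he
    obtain ⟨i, hi, i', hi', rfl⟩ := eq_pair_of_mixedCoef_ne (mem_powersetCard.mp hc).2 hne
    exact mem_image.mpr ⟨(i, i'), by simp [hi, hi'], rfl⟩
  have hinj : Set.InjOn (fun p : Fin N × Fin N => ({p.1, p.2} : Finset (Fin N)))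
      (H ×ˢ Hᶜ : Finset (Fin N × Fin N)) := by
    rintro ⟨i, i'⟩ hi ⟨j, j'⟩ hj h
    simp only [coe_product, Set.mem_prod, mem_coe, mem_compl] at hi hj
    simp only at h
    have e1 : i ∈ ({j, j'} : Finset (Fin N)) := h ▸ mem_insert_self _ _
    have e2 : i' ∈ ({j, j'} : Finset (Fin N)) := h ▸ mem_insert_of_mem (mem_singleton_self _)
    simp only [mem_insert, mem_singleton] at e1 e2
    have h3 : i = j := e1.resolve_right fun h => hj.2 (h ▸ hi.1)
    have h4 : i' = j' := e2.resolve_left fun h => hi.2 (h ▸ hj.1)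
    rw [h3, h4]
  rw [h1]
  calc ∑ e ∈ P, mixedCoef H x e ^ 2
      ≤ ∑ e ∈ (H ×ˢ Hᶜ).image fun p => ({p.1, p.2} : Finset (Fin N)), mixedCoef H x e ^ 2 :=
        Finset.sum_le_sum_of_subset_of_nonneg h2 fun _ _ _ => sq_nonneg _
    _ = ∑ p ∈ H ×ˢ Hᶜ, x p.2 ^ 2 := by
        rw [Finset.sum_image hinj]
        refine Finset.sum_congr rfl fun p hp => ?_
        simp only [mem_product, mem_compl] at hp
        rw [mixedCoef_pair x hp.1 hp.2]
    _ = H.card * ∑ i ∈ Hᶜ, x i ^ 2 := by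
        rw [Finset.sum_product]
        simp only [Finset.sum_const, nsmul_eq_mul]
    _ ≤ k * ∑ i ∈ Hᶜ, x i ^ 2 := by gcongr

theorem bucketPoly_mixedCoef {N n : ℕ} (f : Fin N → Fin n) (H : Finset (Fin N))
    (x : Fin N → ℝ) (π : Equiv.Perm (Fin N)) (σ : Fin N → Bool) {i : Fin N} (hi : i ∈ H)
    (hnc : i ∉ colliding (f ∘ π) H) :
    bucketPoly f 2 (mixedCoef H x) π σ (f (π i)) =
      sgn (σ i) * tailSum (f ∘ π) σ x H (f (π i)) := by
  unfold bucketPoly tailSum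
  set S := univ.filter fun i' => i' ∉ H ∧ (f ∘ π) i' = f (π i) with hS
  have hne : ∀ i' ∈ S, i ≠ i' := fun i' hi' h => (mem_filter.mp hi').2.1 (h ▸ hi)
  have hsub : S.image (fun i' => ({i, i'} : Finset (Fin N))) ⊆ mono f 2 π (f (π i)) := by
    intro e he
    obtain ⟨i', hi', rfl⟩ := mem_image.mp he
    refine mem_filter.mpr ⟨mem_powersetCard.mpr ⟨subset_univ _, card_pair (hne i' hi')⟩, ?_⟩
    intro j hj
    rcases mem_insert.mp hj with rfl | hj
    · rfl
    · rw [mem_singleton.mp hj]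
      exact (mem_filter.mp hi').2.2
  rw [← Finset.sum_subset hsub, Finset.sum_image, Finset.mul_sum]
  · refine Finset.sum_congr rfl fun i' hi' => ?_
    rw [mixedCoef_pair x hi (mem_filter.mp hi').2.1, chi, Finset.prod_pair (hne i' hi'), signed]
    ring
  · intro a ha b hb h
    have h : ({i, a} : Finset (Fin N)) = {i, b} := h
    have : a ∈ ({i, b} : Finset (Fin N)) := h ▸ mem_insert_of_mem (mem_singleton_self _)
    rcases mem_insert.mp this with h | h
    · exact absurd h.symm (hne a ha)
    · exact mem_singleton.mp h
  · intro e he hnot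
    by_contra hc
    obtain ⟨hp, hm⟩ := mem_filter.mp he
    obtain ⟨j, hj, i', hi', rfl⟩ := eq_pair_of_mixedCoef_ne (mem_powersetCard.mp hp).2
      (left_ne_zero_of_mul hc)
    have hji : j = i := by
      by_contra hji
      exact hnc (mem_filter.mpr ⟨hi, j, hj, hji, hm j (mem_insert_self _ _)⟩)
    subst hji
    exact hnot (mem_image.mpr ⟨i', mem_filter.mpr ⟨mem_univ _, hi',
      hm i' (mem_insert_of_mem (mem_singleton_self _))⟩, rfl⟩)

theorem sum_headCoef_sq_le {N k : ℕ} {H : Finset (Fin N)} (hH : H.card ≤ k) :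
    ∑ e ∈ powersetCard 2 univ, headCoef H e ^ 2 ≤ (k : ℝ) ^ 2 / 2 := by
  have h1 : ∑ e ∈ powersetCard 2 univ, headCoef H e ^ 2 = ((powersetCard 2 H).card : ℝ) := by
    unfold headCoef
    simp only [ite_pow, one_pow, ne_eq, OfNat.ofNat_ne_zero, not_false_eq_true, zero_pow]
    rw [← Finset.sum_filter, Finset.sum_const, nsmul_eq_mul, mul_one]
    congr 2
    ext e
    simp only [mem_filter, mem_powersetCard, subset_univ, true_and]
    exact and_comm
  rw [h1, card_powersetCard, Nat.cast_choose_two]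
  have : (H.card : ℝ) ≤ k := by exact_mod_cast hH
  have : (0 : ℝ) ≤ H.card := by positivity
  nlinarith

theorem card_nonFirst_le_of_exists {N n t : ℕ} (f : Fin N → Fin n) (H : Finset (Fin N))
    (π : Equiv.Perm (Fin N))
    (h : ∃ D : Finset (Fin N), D.card + 2 ≤ 2 * t ∧
      ∑ e ∈ powersetCard 2 univ with (Disjoint e D ∧ ∃ a, e ∈ mono f 2 π a),
        headCoef H e ^ 2 < (t : ℝ)) :
    (nonFirst (f ∘ π) H).card ≤ 3 * (t - 1) := by
  obtain ⟨D, hD, hlt⟩ := h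
  by_contra hgt
  set S := H \ D with hS
  have hNF : t ≤ (nonFirst (f ∘ π) S).card := by
    have h1 := card_nonFirst_add (f ∘ π) S
    have h2 := card_nonFirst_add (f ∘ π) H
    have h3 : (S.image (f ∘ π)).card ≤ (H.image (f ∘ π)).card :=
      card_le_card (image_subset_image sdiff_subset)
    have h4 := Finset.card_le_card_sdiff_add_card (t := D) (s := H)
    rw [← hS] at h4
    omega
  have h1 : ∀ i : Fin N, ∃ j, i ∈ nonFirst (f ∘ π) S → j ∈ S ∧ j < i ∧ (f ∘ π) j = (f ∘ π) i := by
    intro i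
    by_cases hi : i ∈ nonFirst (f ∘ π) S
    · obtain ⟨-, j, hj⟩ := mem_filter.mp hi
      exact ⟨j, fun _ => hj⟩
    · exact ⟨i, fun h => absurd h hi⟩
  choose p hp using h1
  have hinj : Set.InjOn (fun i => ({p i, i} : Finset (Fin N))) (nonFirst (f ∘ π) S) := by
    intro i hi i' hi' h
    have h : ({p i, i} : Finset (Fin N)) = {p i', i'} := h
    have e1 : i ∈ ({p i', i'} : Finset (Fin N)) := h ▸ mem_insert_of_mem (mem_singleton_self _)
    have e2 : i' ∈ ({p i, i} : Finset (Fin N)) := h ▸ mem_insert_of_mem (mem_singleton_self _)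
    simp only [mem_insert, mem_singleton] at e1 e2
    rcases e1 with e1 | e1
    · rcases e2 with e2 | e2
      · have h1 := (hp i hi).2.1
        have h2 := (hp i' hi').2.1
        rw [← e2] at h1
        rw [← e1] at h2
        exact absurd h1 (not_lt.mpr h2.le)
      · exact e2.symm
    · exact e1
  have hle : (t : ℝ) ≤ ∑ e ∈ powersetCard 2 univ with (Disjoint e D ∧ ∃ a, e ∈ mono f 2 π a),
      headCoef H e ^ 2 := by
    calc (t : ℝ) ≤ ((nonFirst (f ∘ π) S).card : ℝ) := by exact_mod_cast hNF
      _ = ∑ e ∈ (nonFirst (f ∘ π) S).image fun i => ({p i, i} : Finset (Fin N)),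
          headCoef H e ^ 2 := by
        rw [Finset.sum_image hinj, Finset.sum_congr rfl (g := fun _ => (1 : ℝ)), Finset.sum_const,
          nsmul_eq_mul, mul_one]
        intro i hi
        have h2 := (mem_filter.mp hi).1
        have h3 := (hp i hi).1
        rw [hS, mem_sdiff] at h2 h3
        have : ({p i, i} : Finset (Fin N)) ⊆ H := by
          intro j hj
          rcases mem_insert.mp hj with rfl | hj
          · exact h3.1
          · rw [mem_singleton.mp hj]; exact h2.1
        simp [headCoef, this]
      _ ≤ _ := by
        refine Finset.sum_le_sum_of_subset_of_nonneg ?_ fun _ _ _ => sq_nonneg _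
        intro e he
        obtain ⟨i, hi, rfl⟩ := mem_image.mp he
        have h2 := (mem_filter.mp hi).1
        obtain ⟨h3, h4, h5⟩ := hp i hi
        rw [hS, mem_sdiff] at h2 h3
        have hc : ({p i, i} : Finset (Fin N)) ∈ powersetCard 2 univ :=
          mem_powersetCard.mpr ⟨subset_univ _, card_pair h4.ne⟩
        refine mem_filter.mpr ⟨hc, ?_, f (π i), mem_filter.mpr ⟨hc, ?_⟩⟩
        · rw [Finset.disjoint_left]
          intro j hj
          rcases mem_insert.mp hj with rfl | hj
          · exact h3.2
          · rw [mem_singleton.mp hj]; exact h2.2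
        · intro j hj
          rcases mem_insert.mp hj with rfl | hj
          · exact h5
          · rw [mem_singleton.mp hj]
  exact absurd hlt (not_lt.mpr hle)

theorem card_large_le_of_exists {n t : ℕ} (P : Fin n → ℝ) {θ : ℝ}
    (h : ∃ B : Finset (Fin n), B.card < t ∧ ∑ a ∈ Bᶜ, P a ^ 2 < t * θ ^ 2) (hθ : 0 < θ) :
    (univ.filter fun a => θ < |P a|).card ≤ 2 * (t - 1) := by
  obtain ⟨B, hB, hlt⟩ := h
  set S := univ.filter fun a => θ < |P a| with hS
  have h1 : ((S \ B).card : ℝ) * θ ^ 2 < t * θ ^ 2 := by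
    refine lt_of_le_of_lt ?_ hlt
    calc ((S \ B).card : ℝ) * θ ^ 2 = ∑ a ∈ S \ B, θ ^ 2 := by
          rw [Finset.sum_const, nsmul_eq_mul]
      _ ≤ ∑ a ∈ S \ B, P a ^ 2 := by
          refine Finset.sum_le_sum fun a ha => ?_
          have := (mem_filter.mp (mem_sdiff.mp ha).1).2
          rw [← sq_abs (P a)]
          gcongr
      _ ≤ ∑ a ∈ Bᶜ, P a ^ 2 := by
          refine Finset.sum_le_sum_of_subset_of_nonneg ?_ fun _ _ _ => sq_nonneg _
          intro a ha
          exact mem_compl.mpr (mem_sdiff.mp ha).2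
  have h2 : (S \ B).card < t := by
    exact_mod_cast lt_of_mul_lt_mul_right h1 (by positivity)
  have h3 := Finset.card_le_card_sdiff_add_card (t := B) (s := S)
  omega

theorem sum_tailSum_sq_le {N n t s : ℕ} {Z : ℝ} (hs : 1 ≤ s) (hZ : 0 < Z)
    (f : Fin N → Fin n) (H : Finset (Fin N)) (x : Fin N → ℝ) (π : Equiv.Perm (Fin N))
    (σ : Fin N → Bool) (hx : ∑ i ∈ Hᶜ, x i ^ 2 ≤ Z)
    (h2 : (univ.filter fun a =>
      Z / s < |bucketPoly f 2 (tailCoef H 2 x) π σ a|).card ≤ 2 * (t - 1))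
    (h1 : ∃ B : Finset (Fin n), B.card < s ∧
      ∑ a ∈ Bᶜ, bucketPoly f 1 (tailCoef H 1 x) π σ a ^ 2 < 16 * Z) :
    ∃ B : Finset (Fin n), B.card ≤ 2 * (t - 1) ∧
      ∑ a ∈ Bᶜ, tailSum (f ∘ π) σ x H a ^ 2 ≤ 18 * Z := by
  obtain ⟨B, hB, hlt⟩ := h1
  simp only [bucketPoly_tailCoef_one] at hlt
  have hs' : (0 : ℝ) < s := by exact_mod_cast hs
  set W := univ.filter fun a => Z / s < |bucketPoly f 2 (tailCoef H 2 x) π σ a| with hW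
  refine ⟨W, h2, ?_⟩
  have hsub : Wᶜ ⊆ Bᶜ ∪ (B \ W) := by
    intro a ha
    by_cases hb : a ∈ B
    · exact mem_union_right _ (mem_sdiff.mpr ⟨hb, mem_compl.mp ha⟩)
    · exact mem_union_left _ (mem_compl.mpr hb)
  calc ∑ a ∈ Wᶜ, tailSum (f ∘ π) σ x H a ^ 2
      ≤ ∑ a ∈ Bᶜ ∪ (B \ W), tailSum (f ∘ π) σ x H a ^ 2 :=
        Finset.sum_le_sum_of_subset_of_nonneg hsub fun _ _ _ => sq_nonneg _
    _ ≤ ∑ a ∈ Bᶜ, tailSum (f ∘ π) σ x H a ^ 2 + ∑ a ∈ B \ W, tailSum (f ∘ π) σ x H a ^ 2 := by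
        rw [← Finset.sum_union_inter]
        have : 0 ≤ ∑ a ∈ Bᶜ ∩ (B \ W), tailSum (f ∘ π) σ x H a ^ 2 :=
          Finset.sum_nonneg fun _ _ => sq_nonneg _
        linarith
    _ ≤ 16 * Z + (Z + Z) := by
        refine add_le_add hlt.le ?_
        calc ∑ a ∈ B \ W, tailSum (f ∘ π) σ x H a ^ 2
            ≤ ∑ a ∈ B \ W, (∑ i with i ∉ H ∧ f (π i) = a, x i ^ 2 + Z / s) := by
              refine Finset.sum_le_sum fun a ha => ?_
              rw [tailSum_sq]
              have : ¬ Z / s < |bucketPoly f 2 (tailCoef H 2 x) π σ a| := fun h =>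
                (mem_sdiff.mp ha).2 (mem_filter.mpr ⟨mem_univ _, h⟩)
              have := (le_abs_self _).trans (not_lt.mp this)
              linarith
          _ = ∑ a ∈ B \ W, ∑ i with i ∉ H ∧ f (π i) = a, x i ^ 2 + (B \ W).card * (Z / s) := by
              rw [Finset.sum_add_distrib, Finset.sum_const, nsmul_eq_mul]
          _ ≤ Z + s * (Z / s) := by
              gcongr ?_ + ?_
              · calc _ ≤ ∑ a, ∑ i with i ∉ H ∧ f (π i) = a, x i ^ 2 :=
                      Finset.sum_le_univ_sum_of_nonneg fun a =>
                        Finset.sum_nonneg fun _ _ => sq_nonneg _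
                  _ = ∑ i ∈ Hᶜ, x i ^ 2 := by
                      rw [← Finset.sum_fiberwise Hᶜ (fun i => f (π i))]
                      refine Finset.sum_congr rfl fun a _ => Finset.sum_congr ?_ fun _ _ => rfl
                      ext i; simp
                  _ ≤ Z := hx
              · gcongr
                exact_mod_cast (card_le_card sdiff_subset).trans hB.le
          _ = Z + Z := by field_simp
    _ = 18 * Z := by ring

theorem le_mul_div_pow {a b K M : ℝ} {t : ℕ} (hM : 0 < M) (h : a * M ^ t ≤ b * K ^ t) :
    a ≤ b * (K / M) ^ t := by
  rw [div_pow, mul_div_assoc', le_div_iff₀ (by positivity)]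
  exact h

theorem card_not_nodeGood_le {N n k t s : ℕ} {τ η Γ Z θ : ℝ} {f : Fin N → Fin n}
    (hf : Balanced f) (hn : 0 < n) (ht : 1 ≤ t) (hs : 1 ≤ s) (htN : 4 * t ≤ N) (hsN : 2 * s ≤ N)
    (hk : 1 ≤ k) (hτ : 0 < τ) (hη : 0 < η) (hη1 : η < 1) (hZ : 0 < Z)
    (hu : 32 * τ ^ 2 * ((t - 1 : ℕ) : ℝ) ≤ k) (hΓ : 288 * τ ^ 2 ≤ Γ ^ 2)
    (hθ0 : 0 < θ) (hθ : 4 * θ ^ 2 = Γ ^ 2 * (η / k) * Z)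
    (x : Fin N → ℝ) (H X : Finset (Fin N)) (hH : H.card ≤ k) (hXH : X ⊆ H)
    (hX : ∀ i ∈ X, Γ ^ 2 * (η / k) * Z < x i ^ 2) (hxZ : ∑ i ∈ Hᶜ, x i ^ 2 ≤ Z) :
    ((univ.filter fun p : Equiv.Perm (Fin N) × (Fin N → Bool) =>
      ¬ NodeGood k (τ * Real.sqrt (η / k)) ((10 * (t - 1) : ℕ) : ℝ)
        (fold (f ∘ p.1) (signed p.2 x)) X (f ∘ p.1)).card : ℝ) ≤
      N.factorial * 2 ^ N * ((2 * k ^ 2 / n / t) ^ t + (4 * k * Z / n / (t * θ ^ 2)) ^ t +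
        (1 / 8) ^ s + (8 * s ^ 2 / n / t) ^ t) := by
  have hn' : (0 : ℝ) < n := by exact_mod_cast hn
  have ht' : (0 : ℝ) < t := by exact_mod_cast ht
  have hs' : (0 : ℝ) < s := by exact_mod_cast hs
  set F1 := univ.filter fun π : Equiv.Perm (Fin N) => ∀ D : Finset (Fin N), D.card + 2 ≤ 2 * t →
      (t : ℝ) ≤ ∑ e ∈ powersetCard 2 univ with (Disjoint e D ∧ ∃ a, e ∈ mono f 2 π a),
        headCoef H e ^ 2 with hF1
  set F2 := univ.filter fun p : Equiv.Perm (Fin N) × (Fin N → Bool) => ∀ B : Finset (Fin n),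
      B.card < t → t * θ ^ 2 ≤ ∑ a ∈ Bᶜ, bucketPoly f 2 (mixedCoef H x) p.1 p.2 a ^ 2 with hF2
  set F3 := univ.filter fun p : Equiv.Perm (Fin N) × (Fin N → Bool) => ∀ B : Finset (Fin n),
      B.card < s → 16 * Z ≤ ∑ a ∈ Bᶜ, bucketPoly f 1 (tailCoef H 1 x) p.1 p.2 a ^ 2 with hF3
  set F4 := univ.filter fun p : Equiv.Perm (Fin N) × (Fin N → Bool) => ∀ B : Finset (Fin n),
      B.card < t → t * (Z / s) ^ 2 ≤
        ∑ a ∈ Bᶜ, bucketPoly f 2 (tailCoef H 2 x) p.1 p.2 a ^ 2 with hF4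
  have hsub : (univ.filter fun p : Equiv.Perm (Fin N) × (Fin N → Bool) =>
      ¬ NodeGood k (τ * Real.sqrt (η / k)) ((10 * (t - 1) : ℕ) : ℝ)
        (fold (f ∘ p.1) (signed p.2 x)) X (f ∘ p.1)) ⊆ ((F1 ×ˢ univ ∪ F2) ∪ F3) ∪ F4 := by
    rintro ⟨π, σ⟩ hp
    by_contra hnot
    simp only [mem_union, mem_product, mem_univ, and_true, not_or, hF1, hF2, hF3, hF4, mem_filter,
      true_and, not_forall, not_le, exists_prop] at hnot
    obtain ⟨⟨⟨h1, h2⟩, h3⟩, h4⟩ := hnot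
    refine (mem_filter.mp hp).2 ?_
    obtain ⟨B, hB, hBs⟩ := sum_tailSum_sq_le hs hZ f H x π σ hxZ
      (card_large_le_of_exists _ h4 (by positivity)) h3
    refine nodeGood_of_events hk hτ hη hη1 hZ hu hΓ hθ (f ∘ π) σ x H X hH hXH hX
      (card_nonFirst_le_of_exists f H π h1) ?_ B hB hBs
    refine le_trans ?_ (card_large_le_of_exists _ h2 hθ0)
    refine Finset.card_le_card_of_injOn (f ∘ π) ?_ ?_
    · intro i hi
      simp only [coe_filter, mem_sdiff, Set.mem_ofPred_eq] at hi
      simp only [coe_filter, Set.mem_ofPred_eq, mem_univ, true_and]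
      have := bucketPoly_mixedCoef f H x π σ (hXH hi.1.1) hi.1.2
      rw [Function.comp_apply, this, abs_mul, abs_sgn, one_mul]
      exact hi.2
    · intro i hi i' hi' h
      simp only [coe_filter, mem_sdiff, Set.mem_ofPred_eq] at hi hi'
      by_contra hne
      exact hi.1.2 (mem_filter.mpr ⟨hXH hi.1.1, i', hXH hi'.1.1, fun h => hne h.symm, h.symm⟩)
  have b1 : ((F1 ×ˢ (univ : Finset (Fin N → Bool))).card : ℝ) ≤
      N.factorial * 2 ^ N * (2 * k ^ 2 / n / t) ^ t := by
    have h := card_unsigned_le hf hn (j := 2) (t := t) (by omega) (headCoef H) ht'.le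
    have h' := le_mul_div_pow ht' (h.trans (c := N.factorial * (2 * (k : ℝ) ^ 2 / n) ^ t) ?_)
    · rw [card_product, card_univ, Fintype.card_fun, Fintype.card_bool, Fintype.card_fin,
        Nat.cast_mul, Nat.cast_pow, Nat.cast_ofNat]
      calc _ ≤ (N.factorial * (2 * (k : ℝ) ^ 2 / n / t) ^ t) * 2 ^ N := by gcongr
        _ = _ := by ring
    · gcongr
      calc _ ≤ (n : ℝ) * (2 / n) ^ 2 * ((k : ℝ) ^ 2 / 2) := by
            gcongr; exact sum_headCoef_sq_le hH
        _ = 2 * k ^ 2 / n := by field_simp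
  have b2 : (F2.card : ℝ) ≤ N.factorial * 2 ^ N * (4 * k * Z / n / (t * θ ^ 2)) ^ t := by
    have hM : 0 < t * θ ^ 2 := by positivity
    have h := card_signed_le hf hn (j := 2) (t := t) (by omega) (mixedCoef H x) hM.le
    refine le_mul_div_pow hM (h.trans ?_)
    gcongr
    calc _ ≤ (n : ℝ) * (2 / n) ^ 2 * (k * Z) := by
          gcongr
          exact (sum_mixedCoef_sq_le hH x).trans (by gcongr)
      _ = _ := by field_simp; ring
  have b3 : (F3.card : ℝ) ≤ N.factorial * 2 ^ N * (1 / 8) ^ s := by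
    have hM : 0 < 16 * Z := by positivity
    have h := card_signed_le hf hn (j := 1) (t := s) (by omega) (tailCoef H 1 x) hM.le
    have h' := le_mul_div_pow hM (h.trans (c := N.factorial * 2 ^ N * (2 * Z) ^ s) ?_)
    · refine h'.trans (le_of_eq ?_)
      congr 2
      field_simp; norm_num
    · rw [sum_tailCoef_one_sq]
      have := Finset.sum_nonneg fun i (_ : i ∈ Hᶜ) => sq_nonneg (x i)
      gcongr
      exact le_of_eq (by field_simp)
  have b4 : (F4.card : ℝ) ≤ N.factorial * 2 ^ N * (8 * s ^ 2 / n / t) ^ t := by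
    have hM : 0 < t * (Z / s) ^ 2 := by positivity
    have h := card_signed_le hf hn (j := 2) (t := t) (by omega) (tailCoef H 2 x) hM.le
    have h' := le_mul_div_pow hM (h.trans (c := N.factorial * 2 ^ N * (8 * Z ^ 2 / n) ^ t) ?_)
    · refine h'.trans (le_of_eq ?_)
      congr 2
      field_simp
    · have h0 := Finset.sum_nonneg fun i (_ : i ∈ Hᶜ) => sq_nonneg (x i)
      have := Finset.sum_nonneg fun e (_ : e ∈ powersetCard 2 (univ : Finset (Fin N))) =>
        sq_nonneg (tailCoef H 2 x e)
      gcongr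
      calc _ ≤ (n : ℝ) * (2 / n) ^ 2 * (2 * Z ^ 2) := by
            gcongr
            exact (sum_tailCoef_two_sq_le H x).trans (by gcongr)
        _ = _ := by field_simp; ring
  have hcard : ((univ.filter fun p : Equiv.Perm (Fin N) × (Fin N → Bool) =>
      ¬ NodeGood k (τ * Real.sqrt (η / k)) ((10 * (t - 1) : ℕ) : ℝ)
        (fold (f ∘ p.1) (signed p.2 x)) X (f ∘ p.1)).card : ℝ) ≤
      (F1 ×ˢ (univ : Finset (Fin N → Bool))).card + F2.card + F3.card + F4.card := by
    have h1 := card_le_card hsub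
    have h2 := Finset.card_union_le ((F1 ×ˢ (univ : Finset (Fin N → Bool)) ∪ F2) ∪ F3) F4
    have h3 := Finset.card_union_le (F1 ×ˢ (univ : Finset (Fin N → Bool)) ∪ F2) F3
    have h4 := Finset.card_union_le (F1 ×ˢ (univ : Finset (Fin N → Bool))) F2
    exact_mod_cast (by omega : _ ≤ _)
  refine hcard.trans ?_
  rw [mul_add, mul_add, mul_add]
  linarith

theorem NodeGood.mono {ι : Type*} [DecidableEq ι] {n k : ℕ} {θ β β' : ℝ} {y : Fin n → ℝ}
    {X : Finset ι} {φ : ι → Fin n} (h : NodeGood k θ β y X φ) (hβ : β ≤ β') :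
    NodeGood k θ β' y X φ := by
  obtain ⟨Bad, hB, h⟩ := h
  exact ⟨Bad, hB.trans hβ, h⟩

/-- The elements of the head that are heavy with respect to the threshold constant `Γ`. -/
def heavy {n : ℕ} (k : ℕ) (η Γ : ℝ) (x : Fin n → ℝ) (H : Finset (Fin n)) : Finset (Fin n) :=
  H.filter fun i => Γ * Real.sqrt (η / k) * tailNorm x H < |x i|

/-- The exponent constant of the hash functions. -/
def hashRate (τ : ℝ) : ℝ := 1 / (1 + 32 * τ ^ 2)

/-- The least admissible normalized number of buckets. -/
def hashBound (τ : ℝ) : ℝ :=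
  2 ^ 48 + (2 / hashRate τ) ^ 2 + (16 / (hashRate τ * (17 * τ) ^ 2)) ^ 2

theorem hashRate_pos (τ : ℝ) : 0 < hashRate τ := by unfold hashRate; positivity

theorem hashRate_le_one (τ : ℝ) : hashRate τ ≤ 1 := by
  unfold hashRate
  rw [div_le_one (by positivity)]
  nlinarith [sq_nonneg τ]

theorem exists_between_tail {n k : ℕ} {η Γ : ℝ} (hk : 1 ≤ k) (hη : 0 < η) (hΓ : 0 < Γ)
    (x : Fin n → ℝ) (H : Finset (Fin n)) :
    ∃ Z : ℝ, 0 < Z ∧ ∑ i ∈ Hᶜ, x i ^ 2 ≤ Z ∧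
      ∀ i ∈ heavy k η Γ x H, Γ ^ 2 * (η / k) * Z < x i ^ 2 := by
  have hk' : (0 : ℝ) < k := by exact_mod_cast hk
  set W := ∑ i ∈ Hᶜ, x i ^ 2 with hW
  have hW0 : 0 ≤ W := Finset.sum_nonneg fun _ _ => sq_nonneg _
  have hlt : ∀ i ∈ heavy k η Γ x H, Γ ^ 2 * (η / k) * W < x i ^ 2 := by
    intro i hi
    have h := (mem_filter.mp hi).2
    have h2 : (Γ * Real.sqrt (η / k) * tailNorm x H) ^ 2 < |x i| ^ 2 := by
      have : 0 ≤ tailNorm x H := Real.sqrt_nonneg _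
      gcongr
    rw [sq_abs, mul_pow, mul_pow, Real.sq_sqrt (by positivity), tailNorm, Real.sq_sqrt hW0] at h2
    exact h2
  rcases (heavy k η Γ x H).eq_empty_or_nonempty with he | hne
  · exact ⟨W + 1, by linarith, by linarith, by simp [he]⟩
  · obtain ⟨i₀, hi₀, hmin⟩ := Finset.exists_min_image _ (fun i => x i ^ 2) hne
    have hpos : 0 < Γ ^ 2 * (η / k) := by positivity
    have h0 : W < x i₀ ^ 2 / (Γ ^ 2 * (η / k)) := by
      rw [lt_div_iff₀ hpos]
      linarith [hlt i₀ hi₀]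
    obtain ⟨Z, h1, h2⟩ := exists_between h0
    refine ⟨Z, by linarith, h1.le, fun i hi => ?_⟩
    rw [lt_div_iff₀ hpos] at h2
    linarith [hmin i hi]

set_option maxHeartbeats 1000000 in
/-- A random hash function is good, except with exponentially small probability. -/
theorem card_not_nodeGood_le_rpow {N n k : ℕ} {τ ζ η A : ℝ} {f : Fin N → Fin n}
    (hf : Balanced f) (hτ : 0 < τ) (hζ : 0 < ζ) (hζ1 : ζ < 1) (hη : 0 < η) (hη1 : η < 1)
    (hk : 1 ≤ k) (hAn : A ≤ n) (hnN : n ≤ N) (hA : hashBound τ ≤ A / k * (ζ * η) ^ 2)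
    (x : Fin N → ℝ) (H : Finset (Fin N)) (hH : H.card ≤ k) :
    ((univ.filter fun p : Equiv.Perm (Fin N) × (Fin N → Bool) =>
      ¬ NodeGood k (τ * Real.sqrt (η / k)) (10 * ζ * k)
        (fold (f ∘ p.1) (signed p.2 x)) (heavy k η (17 * τ) x H) (f ∘ p.1)).card : ℝ) ≤
      N.factorial * 2 ^ N * (4 * (A / k) ^ (-(hashRate τ / 2 * ζ * k))) := by
  have hk' : (1 : ℝ) ≤ k := by exact_mod_cast hk
  set c := hashRate τ with hc
  have hc0 : 0 < c := hashRate_pos τ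
  have hc1 : c ≤ 1 := hashRate_le_one τ
  set Γ := 17 * τ with hΓ
  have hΓ0 : 0 < Γ := by positivity
  set q := A / k with hq
  have hζη0 : 0 < ζ * η := by positivity
  have hζη : ζ * η ≤ 1 := by nlinarith
  have hζη2 : (ζ * η) ^ 2 ≤ 1 := by nlinarith
  have hB : 2 ^ 48 + (2 / c) ^ 2 + (16 / (c * Γ ^ 2)) ^ 2 ≤ q * (ζ * η) ^ 2 := hA
  have hq0 : 0 < q := by
    by_contra h
    have : q * (ζ * η) ^ 2 ≤ 0 := mul_nonpos_of_nonpos_of_nonneg (not_lt.mp h) (by positivity)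
    have : 0 ≤ (2 / c) ^ 2 + (16 / (c * Γ ^ 2)) ^ 2 := by positivity
    linarith
  have hq48 : 2 ^ 48 ≤ q := by
    have : q * (ζ * η) ^ 2 ≤ q := mul_le_of_le_one_right hq0.le hζη2
    have : 0 ≤ (2 / c) ^ 2 + (16 / (c * Γ ^ 2)) ^ 2 := by positivity
    linarith
  have hA0 : A = q * k := by rw [hq]; field_simp
  have hA' : 0 < A := by rw [hA0]; positivity
  have hn : 0 < n := by
    have : (0 : ℝ) < n := lt_of_lt_of_le hA' hAn
    exact_mod_cast this
  have hn' : (0 : ℝ) < n := by exact_mod_cast hn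
  have hqn : q * k ≤ n := hA0 ▸ hAn
  have hnN' : (n : ℝ) ≤ N := by exact_mod_cast hnN
  -- the square root of `q`
  set w := Real.sqrt q with hw
  have hw2 : w * w = q := Real.mul_self_sqrt hq0.le
  have hw0 : 0 < w := Real.sqrt_pos.mpr hq0
  have hroot : ∀ y : ℝ, 0 ≤ y → y ^ 2 ≤ q * (ζ * η) ^ 2 → y ≤ w * (ζ * η) := by
    intro y hy h
    have h1 : y ^ 2 ≤ (w * (ζ * η)) ^ 2 := by
      rw [mul_pow, sq w, hw2]
      exact h
    exact le_of_sq_le_sq h1 (by positivity)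
  have hw1 : 2 / c ≤ w * (ζ * η) := hroot _ (by positivity) (by
    have : 0 ≤ (16 / (c * Γ ^ 2)) ^ 2 := by positivity
    linarith)
  have hw3 : 16 / (c * Γ ^ 2) ≤ w * (ζ * η) := hroot _ (by positivity) (by
    have : 0 ≤ (2 / c) ^ 2 := by positivity
    linarith)
  -- logarithms
  set l := Real.log q with hl
  have hl1 : 1 ≤ l := by
    rw [hl, Real.le_log_iff_exp_le hq0]
    have := Real.exp_one_lt_d9
    linarith
  have hlq : 64 * l ^ 2 ≤ w := by
    have h1 : l ≤ q ^ (1 / 8 : ℝ) / (1 / 8) := Real.log_le_rpow_div hq0.le (by norm_num)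
    have h2 : (q ^ (1 / 8 : ℝ)) ^ 2 = q ^ (1 / 4 : ℝ) := by
      rw [← Real.rpow_natCast, ← Real.rpow_mul hq0.le]; norm_num
    have h3 : q ^ (1 / 4 : ℝ) * q ^ (1 / 4 : ℝ) = w := by
      rw [← Real.rpow_add hq0, hw, Real.sqrt_eq_rpow]; norm_num
    have h4 : (4096 : ℝ) ≤ q ^ (1 / 4 : ℝ) := by
      have : (4096 : ℝ) = (2 ^ 48 : ℝ) ^ (1 / 4 : ℝ) := by
        rw [← Real.rpow_natCast, ← Real.rpow_mul (by norm_num)]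
        norm_num
      rw [this]
      exact Real.rpow_le_rpow (by norm_num) hq48 (by norm_num)
    have h5 : l ^ 2 ≤ 64 * q ^ (1 / 4 : ℝ) := by
      calc l ^ 2 ≤ (q ^ (1 / 8 : ℝ) / (1 / 8)) ^ 2 := by gcongr
        _ = 64 * (q ^ (1 / 8 : ℝ)) ^ 2 := by ring
        _ = _ := by rw [h2]
    rw [← h3]
    nlinarith
  -- the parameters `t` and `s`
  set t := ⌊c * ζ * k⌋₊ + 1 with ht
  have ht0 : c * ζ * k < t := by
    rw [ht]; push_cast
    exact Nat.lt_floor_add_one _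
  have hcζ : c * ζ * k ≤ ζ * k := by
    have : c * ζ * k = c * (ζ * k) := by ring
    rw [this]
    exact mul_le_of_le_one_left (by positivity) hc1
  have hζk : ζ * k ≤ k := mul_le_of_le_one_left (by positivity) hζ1.le
  have hfl : ((t - 1 : ℕ) : ℝ) ≤ c * ζ * k := by
    rw [ht, Nat.add_sub_cancel]
    exact Nat.floor_le (by positivity)
  have ht2 : (t : ℝ) ≤ 2 * k := by
    rw [ht, Nat.add_sub_cancel] at hfl
    rw [ht]; push_cast
    linarith
  have ht1 : (1 : ℝ) ≤ t := by
    rw [ht]; push_cast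
    linarith [Nat.cast_nonneg (α := ℝ) ⌊c * ζ * k⌋₊]
  set s := ⌈t * l⌉₊ with hs
  have hs0 : t * l ≤ s := Nat.le_ceil _
  have htl : 1 ≤ t * l := by nlinarith
  have hs1 : 1 ≤ s := by
    have : (1 : ℝ) ≤ s := htl.trans hs0
    exact_mod_cast this
  have hs2 : (s : ℝ) ≤ 2 * (t * l) := by
    have := (Nat.ceil_lt_add_one (by positivity : 0 ≤ t * l)).le
    rw [← hs] at this
    linarith
  have hww : 2 ^ 24 ≤ w := by
    rw [hw]
    apply Real.le_sqrt_of_sq_le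
    norm_num
    linarith
  have htN : 4 * t ≤ N := by
    have : (4 * t : ℝ) ≤ N := by
      calc (4 * t : ℝ) ≤ 8 * k := by linarith
        _ ≤ q * k := by gcongr; linarith
        _ ≤ N := hqn.trans hnN'
    exact_mod_cast this
  have hsN : 2 * s ≤ N := by
    have h1 : l ≤ l ^ 2 := le_self_pow₀ hl1 (by norm_num)
    have h2 : 8 * l ≤ q := by
      have : w ≤ w * w := le_mul_of_one_le_left hw0.le (by linarith)
      linarith
    have : (2 * s : ℝ) ≤ N := by
      calc (2 * s : ℝ) ≤ 4 * (t * l) := by linarith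
        _ ≤ 4 * (2 * k * l) := by gcongr
        _ = 8 * l * k := by ring
        _ ≤ q * k := by gcongr
        _ ≤ N := hqn.trans hnN'
    exact_mod_cast this
  obtain ⟨Z, hZ, hxZ, hX⟩ := exists_between_tail hk hη hΓ0 x H
  set θ := Real.sqrt (Γ ^ 2 * (η / k) * Z / 4) with hθ
  have hθ0 : 0 < θ := Real.sqrt_pos.mpr (by positivity)
  have hθ2 : θ ^ 2 = Γ ^ 2 * (η / k) * Z / 4 := Real.sq_sqrt (by positivity)
  have hu : 32 * τ ^ 2 * ((t - 1 : ℕ) : ℝ) ≤ k := by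
    have h1 : 32 * τ ^ 2 * c ≤ 1 := by
      rw [hc, hashRate, mul_one_div, div_le_one (by positivity)]
      linarith
    calc 32 * τ ^ 2 * ((t - 1 : ℕ) : ℝ) ≤ 32 * τ ^ 2 * (c * ζ * k) := by gcongr
      _ = (32 * τ ^ 2 * c) * (ζ * k) := by ring
      _ ≤ 1 * k := by gcongr
      _ = k := one_mul _
  have hmain := card_not_nodeGood_le (Γ := Γ) hf hn (by omega) hs1 htN hsN hk hτ hη hη1 hZ hu
    (by rw [hΓ]; nlinarith [sq_nonneg τ]) hθ0 (by rw [hθ2]; ring) x H (heavy k η Γ x H) hH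
    (filter_subset _ _) hX hxZ
  have hmono : ((univ.filter fun p : Equiv.Perm (Fin N) × (Fin N → Bool) =>
      ¬ NodeGood k (τ * Real.sqrt (η / k)) (10 * ζ * k)
        (fold (f ∘ p.1) (signed p.2 x)) (heavy k η Γ x H) (f ∘ p.1)).card : ℝ) ≤
      ((univ.filter fun p : Equiv.Perm (Fin N) × (Fin N → Bool) =>
      ¬ NodeGood k (τ * Real.sqrt (η / k)) ((10 * (t - 1) : ℕ) : ℝ)
        (fold (f ∘ p.1) (signed p.2 x)) (heavy k η Γ x H) (f ∘ p.1)).card : ℝ) := by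
    gcongr with p
    intro h
    refine h.mono ?_
    push_cast
    linarith
  refine hmono.trans (hmain.trans ?_)
  -- the four terms
  have hp : ∀ y : ℝ, 0 ≤ y → y ≤ w⁻¹ → y ^ t ≤ q ^ (-(c / 2 * ζ * k)) := by
    intro y hy hle
    calc y ^ t ≤ w⁻¹ ^ t := by gcongr
      _ = q ^ (-(1 / 2) * t : ℝ) := by
        rw [Real.rpow_mul hq0.le, Real.rpow_neg hq0.le, ← Real.sqrt_eq_rpow, Real.rpow_natCast]
      _ ≤ q ^ (-(c / 2 * ζ * k)) := by
        apply Real.rpow_le_rpow_of_exponent_le (by linarith)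
        linarith
  have h1 : (2 * (k : ℝ) ^ 2 / n / t) ^ t ≤ q ^ (-(c / 2 * ζ * k)) := by
    apply hp _ (by positivity)
    rw [div_div, div_le_iff₀ (by positivity)]
    have h2 : 2 ≤ w * (c * ζ) := by
      have : 2 / c ≤ w * ζ := hw1.trans (by
        have : ζ * η ≤ ζ := mul_le_of_le_one_right hζ.le hη1.le
        gcongr)
      rw [div_le_iff₀ hc0] at this
      linarith
    calc 2 * (k : ℝ) ^ 2 ≤ w * (c * ζ) * (k : ℝ) ^ 2 := by gcongr
      _ = w⁻¹ * ((w * w * k) * (c * ζ * k)) := by field_simp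
      _ ≤ w⁻¹ * (n * t) := by
        rw [hw2]
        gcongr
  have h2 : (4 * k * Z / n / (t * θ ^ 2)) ^ t ≤ q ^ (-(c / 2 * ζ * k)) := by
    apply hp _ (by positivity)
    rw [div_div, div_le_iff₀ (by positivity), hθ2]
    have h3 : 16 ≤ w * (ζ * η) * (c * Γ ^ 2) := by
      rwa [div_le_iff₀ (by positivity)] at hw3
    calc 4 * k * Z = 16 * (k * Z / 4) := by ring
      _ ≤ w * (ζ * η) * (c * Γ ^ 2) * (k * Z / 4) := by gcongr
      _ = w⁻¹ * ((w * w * k) * ((c * ζ * k) * (Γ ^ 2 * (η / k) * Z / 4))) := by field_simp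
      _ ≤ w⁻¹ * (n * (t * (Γ ^ 2 * (η / k) * Z / 4))) := by
        rw [hw2]
        gcongr
  have h4 : (8 * (s : ℝ) ^ 2 / n / t) ^ t ≤ q ^ (-(c / 2 * ζ * k)) := by
    apply hp _ (by positivity)
    rw [div_div, div_le_iff₀ (by positivity)]
    calc 8 * (s : ℝ) ^ 2 ≤ 8 * (2 * (t * l)) ^ 2 := by gcongr
      _ = 32 * t * l ^ 2 * t := by ring
      _ ≤ 32 * (2 * k) * l ^ 2 * t := by gcongr
      _ = (64 * l ^ 2) * k * t := by ring
      _ ≤ w * k * t := by gcongr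
      _ = w⁻¹ * ((w * w * k) * t) := by field_simp
      _ ≤ w⁻¹ * (n * t) := by
        rw [hw2]
        gcongr
  have h3 : (1 / 8 : ℝ) ^ s ≤ q ^ (-(c / 2 * ζ * k)) := by
    calc (1 / 8 : ℝ) ^ s ≤ (Real.exp (-1)) ^ s := by
          gcongr
          rw [Real.exp_neg, one_div]
          gcongr
          have := Real.exp_one_lt_d9
          linarith
      _ = Real.exp (-s) := by rw [← Real.exp_nat_mul]; ring_nf
      _ ≤ Real.exp (l * (-(c / 2 * ζ * k))) := by
          apply Real.exp_le_exp.mpr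
          have : l * (c / 2 * ζ * k) ≤ l * t := by
            gcongr
            have : 0 ≤ c * ζ * k := by positivity
            linarith
          linarith
      _ = q ^ (-(c / 2 * ζ * k)) := by rw [Real.rpow_def_of_pos hq0]
  gcongr
  linarith

/-! ### Running programs -/

/-- The program `p` halts in the environment `Γ` with value `v` after at most `T` steps. -/
def Runs (Γ : List Val) (p : Prog) (v : Val) (T : ℝ) : Prop :=
  ∃ t : ℕ, Eval Γ p v t ∧ (t : ℝ) ≤ T

theorem getElem?_append_of_some {α : Type*} {Γ Δ : List α} {i : ℕ} {v : α}
    (h : Γ[i]? = some v) : (Γ ++ Δ)[i]? = some v := by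
  obtain ⟨hi, -⟩ := List.getElem?_eq_some_iff.mp h
  rw [List.getElem?_append_left hi, h]

theorem Eval.append {Γ : List Val} {p : Prog} {v : Val} {t : ℕ} (h : Eval Γ p v t)
    (Δ : List Val) : Eval (Γ ++ Δ) p v t := by
  induction h with
  | var hv => exact .var (getElem?_append_of_some hv)
  | const => exact .const
  | un _ hv ih => exact .un ih hv
  | bin _ _ hw ih₁ ih₂ => exact .bin ih₁ ih₂ hw
  | bind _ _ ih₁ ih₂ => exact .bind ih₁ ih₂
  | condTrue _ hz _ ih₁ ih₂ => exact .condTrue ih₁ hz ih₂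
  | condFalse _ _ ih₁ ih₂ => exact .condFalse ih₁ ih₂
  | loopStop _ _ ih₁ ih₂ => exact .loopStop ih₁ ih₂
  | loopStep _ _ hz _ _ ih₁ ih₂ ih₃ ih₄ => exact .loopStep ih₁ ih₂ hz ih₃ ih₄

namespace Runs

variable {Γ : List Val} {p q c : Prog} {u v w : Val} {T T₁ T₂ T₃ : ℝ}

theorem of_computes (h : p.Computes u v T) (Δ : List Val) : Runs (u :: Δ) p v T := by
  obtain ⟨t, ht, hT⟩ := h
  exact ⟨t, ht.append Δ, hT⟩

theorem computes (h : Runs [u] p v T) : p.Computes u v T := h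

theorem mono (h : Runs Γ p v T₁) (hT : T₁ ≤ T₂) : Runs Γ p v T₂ := by
  obtain ⟨t, ht, hT'⟩ := h
  exact ⟨t, ht, hT'.trans hT⟩

theorem append (h : Runs Γ p v T) (Δ : List Val) : Runs (Γ ++ Δ) p v T := by
  obtain ⟨t, ht, hT⟩ := h
  exact ⟨t, ht.append Δ, hT⟩

theorem var {i : ℕ} (h : Γ[i]? = some v) : Runs Γ (.var i) v 1 := ⟨1, .var h, by simp⟩

theorem const : Runs Γ (.const v) v 1 := ⟨1, .const, by simp⟩

theorem un {o : UnOp} (h : Runs Γ p u T) (hv : o.apply u = some v) :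
    Runs Γ (.un o p) v (T + 1) := by
  obtain ⟨t, ht, hT⟩ := h
  exact ⟨t + 1, .un ht hv, by push_cast; linarith⟩

theorem bin {o : BinOp} (h₁ : Runs Γ p u T₁) (h₂ : Runs Γ q v T₂) (hw : o.apply u v = some w) :
    Runs Γ (.bin o p q) w (T₁ + T₂ + 1) := by
  obtain ⟨t₁, ht₁, hT₁⟩ := h₁
  obtain ⟨t₂, ht₂, hT₂⟩ := h₂
  exact ⟨t₁ + t₂ + 1, .bin ht₁ ht₂ hw, by push_cast; linarith⟩

theorem bind (h₁ : Runs Γ p u T₁) (h₂ : Runs (u :: Γ) q v T₂) :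
    Runs Γ (.bind p q) v (T₁ + T₂ + 1) := by
  obtain ⟨t₁, ht₁, hT₁⟩ := h₁
  obtain ⟨t₂, ht₂, hT₂⟩ := h₂
  exact ⟨t₁ + t₂ + 1, .bind ht₁ ht₂, by push_cast; linarith⟩

theorem cond {b : Prop} [Decidable b] (hc : Runs Γ c (.int (if b then 1 else 0)) T₁)
    (hp : b → Runs Γ p v T₂) (hq : ¬b → Runs Γ q v T₂) :
    Runs Γ (.cond c p q) v (T₁ + T₂ + 1) := by
  obtain ⟨t₁, ht₁, hT₁⟩ := hc
  by_cases hb : b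
  · obtain ⟨t₂, ht₂, hT₂⟩ := hp hb
    rw [if_pos hb] at ht₁
    exact ⟨t₁ + t₂ + 1, .condTrue ht₁ one_ne_zero ht₂, by push_cast; linarith⟩
  · obtain ⟨t₂, ht₂, hT₂⟩ := hq hb
    rw [if_neg hb] at ht₁
    exact ⟨t₁ + t₂ + 1, .condFalse ht₁ ht₂, by push_cast; linarith⟩

theorem loop_stop (hs : Runs Γ p v T₁) (hc : Runs (v :: Γ) c (.int 0) T₂) :
    Runs Γ (.loop p c q) v (T₁ + T₂ + 1) := by
  obtain ⟨t₁, ht₁, hT₁⟩ := hs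
  obtain ⟨t₂, ht₂, hT₂⟩ := hc
  exact ⟨t₁ + t₂ + 1, .loopStop ht₁ ht₂, by push_cast; linarith⟩

theorem loop_step (hs : Runs Γ p u T₁) (hc : Runs (u :: Γ) c (.int 1) T₂)
    (hq : Runs (u :: Γ) q v T₃) (hl : Runs Γ (.loop (.const v) c q) w T) :
    Runs Γ (.loop p c q) w (T₁ + T₂ + T₃ + T + 1) := by
  obtain ⟨t₁, ht₁, hT₁⟩ := hs
  obtain ⟨t₂, ht₂, hT₂⟩ := hc
  obtain ⟨t₃, ht₃, hT₃⟩ := hq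
  obtain ⟨t₄, ht₄, hT₄⟩ := hl
  exact ⟨t₁ + t₂ + t₃ + t₄ + 1, .loopStep ht₁ ht₂ one_ne_zero ht₃ ht₄, by push_cast; linarith⟩

/-- A loop over a linked list that is the first component of the state. -/
theorem loop_list {ι κ : Type*} (enc : ι → Val) (encS : κ → Val) (step : κ → ι → κ) {T : ℝ}
    (hq : ∀ a l s, Runs (.pair (encSeq ((a :: l).map enc)) (encS s) :: Γ) q
      (.pair (encSeq (l.map enc)) (encS (step s a))) T)
    (l : List ι) (s : κ) (hp : Runs Γ p (.pair (encSeq (l.map enc)) (encS s)) T₁) :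
    Runs Γ (.loop p (.bin .intSub (.const (.int 1)) (.un .isNil (.un .fst (.var 0)))) q)
      (.pair .nil (encS (l.foldl step s))) (l.length * (T + 7) + T₁ + 6) := by
  induction l generalizing s p T₁ with
  | nil =>
    refine (loop_stop hp (T₂ := 5) ?_).mono (by simp; linarith)
    exact (bin const (un (un (var (by rfl)) (by rfl)) (by rfl)) (by rfl)).mono (by norm_num)
  | cons a l ih =>
    refine (loop_step hp (T₂ := 5) ?_ (hq a l s) (ih (step s a) const)).mono ?_
    · exact (bin const (un (un (var (by rfl)) (by rfl)) (by rfl)) (by rfl)).mono (by norm_num)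
    · simp only [List.length_cons]
      push_cast
      linarith

end Runs

/-! ### Building blocks -/

/-- The code of an index. -/
def encIdx {n : ℕ} (i : Fin n) : Val := .int (i : ℕ)

theorem encList_eq {n : ℕ} (s : List (Fin n)) : encList s = encSeq (s.map encIdx) := by
  unfold encList
  congr 1
  induction s with
  | nil => rfl
  | cons a l ih => simpa [encIdx] using ih

/-- Keep a list if it is not too long. -/
def trunc {α : Type*} (ℓ : ℕ) (l : List α) : List α := if l.length ≤ ℓ then l else []

theorem trunc_length_le {α : Type*} (ℓ : ℕ) (l : List α) : (trunc ℓ l).length ≤ ℓ := by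
  unfold trunc
  split_ifs with h
  · exact h
  · exact Nat.zero_le _

theorem trunc_nodup {α : Type*} (ℓ : ℕ) {l : List α} (h : l.Nodup) : (trunc ℓ l).Nodup := by
  unfold trunc
  split_ifs
  · exact h
  · exact List.nodup_nil

/-- The program for `trunc`. -/
def truncProg (ℓ : ℕ) : Prog :=
  .cond (.bin .intLt (.const (.int 0)) (.un .snd (.loop
    (.bin .mkPair (.var 0) (.const (.int (-ℓ))))
    (.bin .intSub (.const (.int 1)) (.un .isNil (.un .fst (.var 0))))
    (.bin .mkPair (.un .snd (.un .fst (.var 0)))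
      (.bin .intAdd (.un .snd (.var 0)) (.const (.int 1)))))))
    (.const .nil) (.var 0)

theorem size_truncProg (ℓ : ℕ) : (truncProg ℓ).size = 23 := by
  simp [truncProg, Prog.size, Val.size]

theorem runs_truncProg {n : ℕ} (ℓ : ℕ) (l : List (Fin n)) (Γ : List Val) :
    Runs (encList l :: Γ) (truncProg ℓ) (encList (trunc ℓ l)) (15 * l.length + 15) := by
  have hloop : Runs (encList l :: Γ) (.loop
      (.bin .mkPair (.var 0) (.const (.int (-ℓ))))
      (.bin .intSub (.const (.int 1)) (.un .isNil (.un .fst (.var 0))))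
      (.bin .mkPair (.un .snd (.un .fst (.var 0)))
        (.bin .intAdd (.un .snd (.var 0)) (.const (.int 1)))))
      (.pair .nil (.int (l.length - ℓ))) (l.length * (8 + 7) + 3 + 6) := by
    have key : ∀ (l : List (Fin n)) (z : ℤ), l.foldl (fun z _ => z + 1) z = z + l.length := by
      intro l
      induction l with
      | nil => intro z; simp
      | cons a l ih => intro z; rw [List.foldl_cons, ih]; push_cast [List.length_cons]; ring
    have h := Runs.loop_list (Γ := encList l :: Γ) (p := .bin .mkPair (.var 0) (.const (.int (-ℓ))))
      (q := .bin .mkPair (.un .snd (.un .fst (.var 0)))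
        (.bin .intAdd (.un .snd (.var 0)) (.const (.int 1))))
      encIdx Val.int (fun z _ => z + 1) (T := 8) (T₁ := 3)
      (fun a l s => (Runs.bin (.un (.un (.var (by rfl)) (by rfl)) (by rfl))
            (.bin (.un (.var (by rfl)) (by rfl)) .const (by rfl)) (by rfl)).mono (by norm_num))
      l (-ℓ) ((Runs.bin (.var (by rfl)) .const (by rw [encList_eq]; rfl)).mono (by norm_num))
    rw [key, neg_add_eq_sub] at h
    exact h
  refine (Runs.cond (b := ℓ < l.length) (T₁ := l.length * (8 + 7) + 12) (T₂ := 1) ?_ ?_ ?_).mono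
    (by linarith)
  · refine (Runs.bin .const (.un hloop (by rfl)) (w := .int (if ℓ < l.length then 1 else 0))
      ?_).mono (by linarith)
    simp [BinOp.apply]
  · intro h
    rw [trunc, if_neg (not_le.mpr h)]
    exact .const
  · intro h
    rw [trunc, if_pos (not_lt.mp h)]
    exact .var (by rfl)

/-- Reading a block of consecutive entries of a vector. -/
theorem Runs.slice {Γ : List Val} {p : Prog} {R : ℕ} {v : Fin R → ℝ} {T : ℝ}
    (h : Runs Γ p (encVec v) T) (o q : ℕ) (hq : o + q ≤ R) :
    Runs Γ (.bin .take (.bin .drop p (.const (.int o))) (.const (.int q)))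
      (encVec fun i : Fin q => v ⟨o + i, by omega⟩) (T + 4) := by
  refine (Runs.bin (.bin h .const (w := .arr (R - o) fun j =>
    if hi : j + o < R then .real (v ⟨j + o, hi⟩) else .nil) ?_) .const ?_).mono
    (by linarith : (T + 1 + 1) + 1 + 1 ≤ T + 4)
  · have : (0 : ℤ) ≤ o ∧ (o : ℤ) ≤ R := ⟨by positivity, by exact_mod_cast (by omega : o ≤ R)⟩
    simp only [encVec, BinOp.apply, this, and_self, if_true, Int.toNat_natCast]
  · have : (0 : ℤ) ≤ q ∧ (q : ℤ) ≤ ((R - o : ℕ) : ℤ) :=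
      ⟨by positivity, by exact_mod_cast (by omega : q ≤ R - o)⟩
    simp only [BinOp.apply, this, and_self, if_true, Int.toNat_natCast, encVec]
    congr 2
    funext j
    by_cases hj : j < q
    · have h1 : j + o < R := by omega
      simp only [hj, h1, if_true, dif_pos]
      congr 3
      exact add_comm _ _
    · simp [hj]

/-- Evaluate a list of programs. -/
def seqProg : List Prog → Prog
  | [] => .const .nil
  | p :: l => .bin .mkPair p (seqProg l)

theorem runs_seqProg {Γ : List Val} {r : ℕ} {T : ℝ} (p : Fin r → Prog) (v : Fin r → Val)
    (h : ∀ c, Runs Γ (p c) (v c) T) :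
    Runs Γ (seqProg (List.ofFn p)) (encSeq (List.ofFn v)) (r * (T + 1) + 1) := by
  induction r with
  | zero => simpa [seqProg, encSeq] using Runs.const
  | succ r ih =>
    rw [List.ofFn_succ, List.ofFn_succ]
    refine (Runs.bin (h 0) (ih (fun c => p c.succ) (fun c => v c.succ) fun c => h c.succ)
      (by rfl)).mono ?_
    push_cast
    linarith

theorem size_seqProg_le {r : ℕ} {B : ℝ} (p : Fin r → Prog) (h : ∀ c, ((p c).size : ℝ) ≤ B) :
    ((seqProg (List.ofFn p)).size : ℝ) ≤ r * (B + 1) + 1 := by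
  induction r with
  | zero => simp [seqProg, Prog.size, Val.size]
  | succ r ih =>
    rw [List.ofFn_succ]
    have h1 := ih (fun c => p c.succ) fun c => h c.succ
    have h2 := h 0
    simp only [seqProg, Prog.size]
    push_cast
    linarith

theorem size_encList {n : ℕ} (l : List (Fin n)) : (encList l).size = 2 * l.length + 1 := by
  rw [encList_eq]
  induction l with
  | nil => rfl
  | cons a l ih =>
    simp only [List.map_cons, encSeq, Val.size, ih, List.length_cons, encIdx]
    ring

/-! ### Measurability of random variables with countably many values -/

/-- All level sets are measurable. -/
def LevelMeasurable {Ω α : Type*} [MeasurableSpace Ω] (F : Ω → α) : Prop :=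
  ∀ a, MeasurableSet {ω | F ω = a}

namespace LevelMeasurable

variable {Ω Ω' α β : Type*} [MeasurableSpace Ω] [MeasurableSpace Ω']

theorem setOf [Countable α] {F : Ω → α} (h : LevelMeasurable F) (P : α → Prop) :
    MeasurableSet {ω | P (F ω)} := by
  have : {ω | P (F ω)} = ⋃ a : {a // P a}, {ω | F ω = a} := by
    ext ω; simp
  rw [this]
  exact MeasurableSet.iUnion fun a => h a

theorem comp [Countable α] {F : Ω → α} (h : LevelMeasurable F) (g : α → β) :
    LevelMeasurable fun ω => g (F ω) :=
  fun b => h.setOf fun a => g a = b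

theorem pi {ι : Type*} [Finite ι] {F : ι → Ω → α} (h : ∀ c, LevelMeasurable (F c)) :
    LevelMeasurable fun ω c => F c ω := by
  intro a
  have : {ω | (fun c => F c ω) = a} = ⋂ c, {ω | F c ω = a c} := by
    ext ω; simp [funext_iff]
  rw [this]
  exact MeasurableSet.iInter fun c => h c _

theorem comp_measurable {F : Ω → α} (h : LevelMeasurable F) {g : Ω' → Ω} (hg : Measurable g) :
    LevelMeasurable fun ω => F (g ω) :=
  fun a => hg (h a)

theorem dependent [Countable α] {G : α → Ω → β} (hG : ∀ a, LevelMeasurable (G a)) {H : Ω' → α}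
    (hH : LevelMeasurable H) : LevelMeasurable fun p : Ω × Ω' => G (H p.2) p.1 := by
  intro b
  have : {p : Ω × Ω' | G (H p.2) p.1 = b} = ⋃ a, {ω | G a ω = b} ×ˢ {ω' | H ω' = a} := by
    ext p; simp
  rw [this]
  exact MeasurableSet.iUnion fun a => (hG a b).prod (hH a)

end LevelMeasurable

/-! ### Identification schemes -/

/-- A random matrix with programs that identify indices from the measurements alone. -/
structure Scheme (n : ℕ) where
  Ω : Type
  mΩ : MeasurableSpace Ω
  μ : Measure Ω
  prob : IsProbabilityMeasure μ
  m : ℕ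
  M : Ω → Matrix (Fin m) (Fin n) ℝ
  prog : Ω → Prog
  out : (Fin n → ℝ) → Ω → List (Fin n)

attribute [instance] Scheme.mΩ Scheme.prob

/-- The scheme is measurable and its programs compute the outputs, which have at most `ℓ`
elements. -/
structure Scheme.Sound {n : ℕ} (S : Scheme n) (ℓ : ℕ) (time space : ℝ) : Prop where
  meas_M : ∀ i j, Measurable fun ω => S.M ω i j
  meas_out : ∀ y, LevelMeasurable (S.out y)
  size_le : ∀ ω, ((S.prog ω).size : ℝ) ≤ space
  nodup : ∀ y ω, (S.out y ω).Nodup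
  length_le : ∀ y ω, (S.out y ω).length ≤ ℓ
  runs : ∀ y ω, Runs [encVec ((S.M ω).mulVec y)] (S.prog ω) (encList (S.out y ω)) time

/-- For inputs with property `good`, more than `F` indices are lost with probability at
most `Q`. -/
def Scheme.Accurate {ι : Type*} {n : ℕ} (S : Scheme n)
    (good : Finset ι → (Fin n → ℝ) → (ι → Fin n) → Prop) (F Q : ℝ) : Prop :=
  ∀ X y φ, good X y φ →
    S.μ {ω | F < ((X.filter fun i => φ i ∉ S.out y ω).card : ℝ)} ≤ ENNReal.ofReal Q

/-- The factor by which list recovery with error fraction `ρ` multiplies losses. -/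
def lossFactor (r : ℕ) (ρ : ℝ) : ℝ := if 0 < ρ then 1 / ρ else r

theorem lossFactor_nonneg (r : ℕ) (ρ : ℝ) : 0 ≤ lossFactor r ρ := by
  unfold lossFactor
  split_ifs <;> positivity

theorem card_not_recovered_le {ι : Type*} [DecidableEq ι] {n r q : ℕ} (hr : 0 < r) {ρ : ℝ}
    (hρ : 0 ≤ ρ) (C : Fin n → Fin r → Fin q) (l : Fin r → List (Fin q)) (X : Finset ι)
    (φ : ι → Fin n) {F : ℝ}
    (hF : ∀ c, ((X.filter fun i => C (φ i) c ∉ l c).card : ℝ) ≤ F) :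
    ((X.filter fun i => φ i ∉ recovered C ρ fun c => (l c).toFinset).card : ℝ) ≤
      lossFactor r ρ * F := by
  have hr' : (0 : ℝ) < r := by exact_mod_cast hr
  set Y := X.filter fun i => φ i ∉ recovered C ρ fun c => (l c).toFinset with hY
  have h1 : ∀ i ∈ Y, (r : ℝ) ≤
      lossFactor r ρ * ((univ.filter fun c => C (φ i) c ∉ l c).card : ℝ) := by
    intro i hi
    have h2 := (mem_filter.mp hi).2
    simp only [recovered, mem_filter, mem_univ, true_and, not_le, List.mem_toFinset] at h2
    have h3 := Finset.card_filter_add_card_filter_not (s := (univ : Finset (Fin r)))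
      (fun c => C (φ i) c ∈ l c)
    rw [card_univ, Fintype.card_fin] at h3
    have h4 : ((univ.filter fun c => C (φ i) c ∈ l c).card : ℝ) +
        ((univ.filter fun c => C (φ i) c ∉ l c).card : ℝ) = r := by exact_mod_cast h3
    have h5 : ρ * r < ((univ.filter fun c => C (φ i) c ∉ l c).card : ℝ) := by linarith
    unfold lossFactor
    split_ifs with h
    · rw [one_div, ← div_eq_inv_mul, le_div_iff₀ h]
      linarith
    · have h6 : (0 : ℝ) < ((univ.filter fun c => C (φ i) c ∉ l c).card : ℝ) :=
        lt_of_le_of_lt (by positivity) h5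
      have h7 : (1 : ℝ) ≤ ((univ.filter fun c => C (φ i) c ∉ l c).card : ℝ) := by
        exact_mod_cast h6
      exact le_mul_of_one_le_right hr'.le h7
  have h2 : (Y.card : ℝ) * r ≤ lossFactor r ρ * (r * F) := by
    calc (Y.card : ℝ) * r = ∑ i ∈ Y, (r : ℝ) := by rw [Finset.sum_const, nsmul_eq_mul]
      _ ≤ ∑ i ∈ Y, lossFactor r ρ * ((univ.filter fun c => C (φ i) c ∉ l c).card : ℝ) :=
        Finset.sum_le_sum h1
      _ = lossFactor r ρ * ∑ c, ((Y.filter fun i => C (φ i) c ∉ l c).card : ℝ) := by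
        rw [← Finset.mul_sum]
        congr 1
        simp only [Finset.card_filter, Nat.cast_sum]
        exact Finset.sum_comm
      _ ≤ lossFactor r ρ * ∑ _c : Fin r, F := by
        have := lossFactor_nonneg r ρ
        gcongr with c
        refine le_trans ?_ (hF c)
        exact_mod_cast card_le_card (filter_subset_filter _ (filter_subset _ _))
      _ = lossFactor r ρ * (r * F) := by simp
  have h3 : (Y.card : ℝ) * r ≤ lossFactor r ρ * F * r := by linarith
  exact le_of_mul_le_mul_right h3 hr'

theorem card_lost_le {ι : Type*} [DecidableEq ι] {n k : ℕ} {η τ β ζ G : ℝ} {y : Fin n → ℝ}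
    {X Bad : Finset ι} {φ : ι → Fin n} (hBad : (Bad.card : ℝ) ≤ β) {H' : Finset (Fin n)}
    (hinj : Set.InjOn φ (X \ Bad : Finset ι))
    (hX : ∀ i ∈ X \ Bad, φ i ∈ H' ∧ τ * Real.sqrt (η / k) * tailNorm y H' < |y (φ i)|)
    (s I : List (Fin n)) (hs : ((X.filter fun i => φ i ∉ s).card : ℝ) ≤ G)
    (hI : ((missed k η τ y H' s I).card : ℝ) ≤ ζ * k) :
    ((X.filter fun i => φ i ∉ I).card : ℝ) ≤ β + ζ * k + G := by
  have h1 : X.filter (fun i => φ i ∉ I) ⊆ (Bad ∪ X.filter fun i => φ i ∉ s) ∪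
      (X \ Bad).filter fun i => φ i ∈ missed k η τ y H' s I := by
    intro i hi
    obtain ⟨hiX, hiI⟩ := mem_filter.mp hi
    by_cases hB : i ∈ Bad
    · exact mem_union_left _ (mem_union_left _ hB)
    by_cases hS : φ i ∈ s
    · have hm := mem_sdiff.mpr ⟨hiX, hB⟩
      have := hX i hm
      exact mem_union_right _ (mem_filter.mpr ⟨hm, mem_filter.mpr ⟨this.1, hS, this.2, hiI⟩⟩)
    · exact mem_union_left _ (mem_union_right _ (mem_filter.mpr ⟨hiX, hS⟩))
  have h2 : ((X \ Bad).filter fun i => φ i ∈ missed k η τ y H' s I).card ≤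
      (missed k η τ y H' s I).card := by
    refine Finset.card_le_card_of_injOn φ (fun i hi => (mem_filter.mp hi).2) ?_
    exact hinj.mono (by exact_mod_cast filter_subset _ _)
  have h3 : (X.filter fun i => φ i ∉ I).card ≤ Bad.card + (X.filter fun i => φ i ∉ s).card +
      (missed k η τ y H' s I).card :=
    (card_le_card h1).trans ((card_union_le _ _).trans
      (add_le_add (card_union_le _ _) h2))
  have h4 : ((X.filter fun i => φ i ∉ I).card : ℝ) ≤ Bad.card +
      (X.filter fun i => φ i ∉ s).card + (missed k η τ y H' s I).card := by exact_mod_cast h3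
  linarith

theorem exists_leaf {Ω : Type} [MeasurableSpace Ω] {μ : Measure Ω} [IsProbabilityMeasure μ]
    {m n k : ℕ} {M : Ω → Matrix (Fin m) (Fin n) ℝ} {ζ η τ b p space : ℝ} {time : ℕ → ℝ}
    (h : IsWeakIdentification μ M encList k ζ η τ b p time space) (ι : Type) [DecidableEq ι] (β : ℝ) :
    ∃ S : Scheme n, S.m = m ∧ S.Sound ⌊b⌋₊ (time n + 15 * n + 30) (space + 2 * n + 30) ∧
      S.Accurate (ι := ι) (fun X y φ => NodeGood k (τ * Real.sqrt (η / k)) β y X φ)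
        (β + ζ * k) p := by
  obtain ⟨hM, prog, out, hsize, hout⟩ := h
  set s := List.finRange n with hs
  have hnd : s.Nodup := List.nodup_finRange n
  have hlen : s.length = n := List.length_finRange
  refine ⟨⟨Ω, inferInstance, μ, inferInstance, m, M, fun ω =>
    .bind (.bind (.bin .mkPair (.var 0) (.const (encList s))) (prog ω)) (truncProg ⌊b⌋₊),
    fun y ω => trunc ⌊b⌋₊ (out s y ω)⟩, rfl, ?_, ?_⟩
  · refine ⟨hM, fun y => ?_, fun ω => ?_, fun y ω => ?_, fun y ω => trunc_length_le _ _,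
      fun y ω => ?_⟩
    · exact LevelMeasurable.comp (hout s hnd y).2.1 (trunc ⌊b⌋₊)
    · have := hsize ω
      simp only [Prog.size, size_truncProg, size_encList, hlen]
      push_cast
      linarith
    · exact trunc_nodup _ ((hout s hnd y).1 ω).1
    · obtain ⟨h1, h2, h3⟩ := (hout s hnd y).1 ω
      have h4 : ((out s y ω).length : ℝ) ≤ n := by
        have := h1.length_le_card
        rw [Fintype.card_fin] at this
        exact_mod_cast this
      rw [hlen] at h3
      refine (Runs.bind (Runs.bind (Runs.bin (.var (by rfl)) .const (by rfl))
        (Runs.of_computes h3 _)) (runs_truncProg _ _ _)).mono ?_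
      linarith
  · rintro X y φ ⟨Bad, hBad, H', hH', hinj, hX⟩
    refine le_trans (measure_mono ?_) ((hout s hnd y).2.2 H' hH')
    intro ω hω
    simp only [Set.mem_ofPred_eq] at hω ⊢
    rintro ⟨h1, h2⟩
    refine absurd hω (not_lt.mpr ?_)
    have h3 : trunc ⌊b⌋₊ (out s y ω) = out s y ω := if_pos (Nat.le_floor h1)
    rw [h3]
    have := card_lost_le (G := 0) hBad hinj hX s (out s y ω) (by simp [hs]) h2
    linarith

/-- The columns of the row block of a child. -/
theorem sum_fold {n q : ℕ} (f : Fin n → Fin q) (v : Fin q → ℝ) (y : Fin n → ℝ) :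
    ∑ a, v (f a) * y a = ∑ a', v a' * fold f y a' := by
  unfold fold
  simp only [Finset.mul_sum]
  rw [← Finset.sum_fiberwise univ f]
  refine Finset.sum_congr rfl fun a' _ => Finset.sum_congr rfl fun a ha => ?_
  rw [(mem_filter.mp ha).2]

/-- The rows of an inner node, followed by the blocks of rows of its children. -/
def nodeMatrix {n r q m m' : ℕ} (C : Fin n → Fin r → Fin q) (M : Matrix (Fin m) (Fin n) ℝ)
    (M' : Fin r → Matrix (Fin m') (Fin q) ℝ) : Matrix (Fin (m + r * m')) (Fin n) ℝ :=
  fun i a => Fin.addCases (fun i => M i a)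
    (fun j => M' (finProdFinEquiv.symm j).1 (finProdFinEquiv.symm j).2
      (C a (finProdFinEquiv.symm j).1)) i

theorem nodeMatrix_own {n r q m m' : ℕ} (C : Fin n → Fin r → Fin q)
    (M : Matrix (Fin m) (Fin n) ℝ) (M' : Fin r → Matrix (Fin m') (Fin q) ℝ) (y : Fin n → ℝ)
    (i : Fin m) (hi : 0 + (i : ℕ) < m + r * m') :
    (nodeMatrix C M M').mulVec y ⟨0 + i, hi⟩ = M.mulVec y i := by
  have : (⟨0 + i, hi⟩ : Fin (m + r * m')) = Fin.castAdd (r * m') i := by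
    ext; simp
  rw [this]
  simp [Matrix.mulVec, dotProduct, nodeMatrix]

theorem nodeMatrix_child {n r q m m' : ℕ} (C : Fin n → Fin r → Fin q)
    (M : Matrix (Fin m) (Fin n) ℝ) (M' : Fin r → Matrix (Fin m') (Fin q) ℝ) (y : Fin n → ℝ)
    (c : Fin r) (i : Fin m') (hi : m + m' * (c : ℕ) + (i : ℕ) < m + r * m') :
    (nodeMatrix C M M').mulVec y ⟨m + m' * c + i, hi⟩ =
      (M' c).mulVec (fold (fun a => C a c) y) i := by
  have : (⟨m + m' * c + i, hi⟩ : Fin (m + r * m')) = Fin.natAdd m (finProdFinEquiv (c, i)) := by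
    ext; simp [finProdFinEquiv]; ring
  rw [this]
  simp only [Matrix.mulVec, dotProduct, nodeMatrix, Fin.addCases_right, Equiv.symm_apply_apply]
  exact sum_fold (fun a => C a c) (M' c i) y

/-- The program of an inner node. -/
def nodeProg {r : ℕ} (m m' ℓ : ℕ) (own recov : Prog) (child : Fin r → Prog) : Prog :=
  .bind (.bind (.bin .mkPair
    (.bin .take (.bin .drop (.var 0) (.const (.int (0 : ℕ)))) (.const (.int m)))
    (.bind (seqProg (List.ofFn fun c : Fin r => .bind
      (.bin .take (.bin .drop (.var 0) (.const (.int (m + m' * c : ℕ)))) (.const (.int m')))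
      (child c))) recov)) own) (truncProg ℓ)

theorem size_nodeProg_le {r : ℕ} (m m' ℓ : ℕ) (own recov : Prog) (child : Fin r → Prog)
    {A B D : ℝ} (hA : (own.size : ℝ) ≤ A) (hB : (recov.size : ℝ) ≤ B)
    (hD : ∀ c, ((child c).size : ℝ) ≤ D) :
    ((nodeProg m m' ℓ own recov child).size : ℝ) ≤ A + B + (7 * r + 40) + r * D := by
  have h := size_seqProg_le (B := D + 6) (fun c : Fin r => .bind
      (.bin .take (.bin .drop (.var 0) (.const (.int (m + m' * c : ℕ)))) (.const (.int m')))
      (child c)) (by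
    intro c
    have := hD c
    simp only [Prog.size, Val.size]
    push_cast
    linarith)
  simp only [nodeProg, Prog.size, Val.size, size_truncProg]
  push_cast at h ⊢
  linarith

theorem runs_nodeProg {n r q m m' ℓ L : ℕ} (C : Fin n → Fin r → Fin q)
    (M : Matrix (Fin m) (Fin n) ℝ) (M' : Fin r → Matrix (Fin m') (Fin q) ℝ) (y : Fin n → ℝ)
    {own recov : Prog} {child : Fin r → Prog} {l : Fin r → List (Fin q)} {s I : List (Fin n)}
    {t₁ t₂ t₃ : ℝ}
    (h₁ : ∀ c, Runs [encVec ((M' c).mulVec (fold (fun a => C a c) y))] (child c)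
      (encList (l c)) t₁)
    (h₂ : Runs [encSeq (List.ofFn fun c => encList (l c))] recov (encList s) t₂)
    (h₃ : Runs [.pair (encVec (M.mulVec y)) (encList s)] own (encList I) t₃)
    (hI : I.length ≤ L) :
    Runs [encVec ((nodeMatrix C M M').mulVec y)] (nodeProg m m' ℓ own recov child)
      (encList (trunc ℓ I)) (t₂ + t₃ + (15 * L + 8 * r + 30) + r * t₁) := by
  set Γ := [encVec ((nodeMatrix C M M').mulVec y)] with hΓ
  have hy : Runs Γ (.var 0) (encVec ((nodeMatrix C M M').mulVec y)) 1 := .var (by rfl)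
  have hown : Runs Γ
      (.bin .take (.bin .drop (.var 0) (.const (.int (0 : ℕ)))) (.const (.int m)))
      (encVec (M.mulVec y)) 5 := by
    have h := (hy.slice 0 m (by omega)).mono (by norm_num : (1 : ℝ) + 4 ≤ 5)
    have he : (fun i : Fin m => (nodeMatrix C M M').mulVec y ⟨0 + i, by omega⟩) = M.mulVec y :=
      funext fun i => nodeMatrix_own C M M' y i _
    rwa [he] at h
  have hle : ∀ c : Fin r, m + m' * (c : ℕ) + m' ≤ m + r * m' := by
    intro c
    have : m' * ((c : ℕ) + 1) ≤ m' * r := Nat.mul_le_mul_left m' c.isLt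
    nlinarith
  have hchild : ∀ c : Fin r, Runs Γ (.bind
      (.bin .take (.bin .drop (.var 0) (.const (.int (m + m' * c : ℕ)))) (.const (.int m')))
      (child c)) (encList (l c)) (t₁ + 6) := by
    intro c
    have h := hy.slice (m + m' * c) m' (hle c)
    have he : (fun i : Fin m' => (nodeMatrix C M M').mulVec y
        ⟨m + m' * c + i, by have := hle c; omega⟩) =
        (M' c).mulVec (fold (fun a => C a c) y) :=
      funext fun i => nodeMatrix_child C M M' y c i _
    rw [he] at h
    exact (h.bind ((h₁ c).append Γ)).mono (by linarith)
  have hI' : (I.length : ℝ) ≤ L := by exact_mod_cast hI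
  refine (Runs.bind (Runs.bind (Runs.bin hown (Runs.bind (runs_seqProg _ _ hchild)
    (h₂.append Γ)) (by rfl)) (h₃.append Γ)) (runs_truncProg ℓ I Γ)).mono ?_
  have : (0 : ℝ) ≤ r := by positivity
  linarith

theorem exists_node {Ω : Type} [MeasurableSpace Ω] {μ : Measure Ω} [IsProbabilityMeasure μ]
    {m n k r q L : ℕ} {M : Ω → Matrix (Fin m) (Fin n) ℝ} {ζ η τ b p space : ℝ} {time : ℕ → ℝ}
    (hr : 0 < r) (hp : 0 ≤ p)
    (h : IsWeakIdentification μ M encList k ζ η τ b p time space)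
    {tL : ℝ} (htL : ∀ a ≤ L, time a ≤ tL)
    {C : Fin n → Fin r → Fin q} {ρ T spC : ℝ} (hρ : 0 ≤ ρ)
    (hL : IsListRecoverable C ρ ⌊b⌋₊ L) (hT : IsRecoverableInTime C ρ ⌊b⌋₊ T spC)
    {S' : Scheme q} {t' sp' : ℝ} (hS' : S'.Sound ⌊b⌋₊ t' sp')
    {ι : Type} [DecidableEq ι] {good' : Finset ι → (Fin q → ℝ) → (ι → Fin q) → Prop} {F' Q' : ℝ} (hQ' : 0 ≤ Q')
    (hacc : S'.Accurate good' F' Q') (β : ℝ) :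
    ∃ S : Scheme n, S.m = m + r * S'.m ∧
      S.Sound ⌊b⌋₊ (T + tL + (15 * L + 8 * r + 30) + r * t')
        (space + spC + (7 * r + 40) + r * sp') ∧
      S.Accurate (fun X y φ => NodeGood k (τ * Real.sqrt (η / k)) β y X φ ∧
          ∀ c, good' X (fold (fun a => C a c) y) (fun i => C (φ i) c))
        (β + ζ * k + lossFactor r ρ * F') (p + r * Q') := by
  obtain ⟨hM, prog, out, hsize, hout⟩ := h
  obtain ⟨recov, hrsize, hrec⟩ := hT
  -- the candidate list recovered from the lists of the children
  have hcand : ∀ l : Fin r → List (Fin q), ∃ s : List (Fin n), s.Nodup ∧ s.length ≤ L ∧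
      ((∀ c, (l c).Nodup ∧ (l c).length ≤ ⌊b⌋₊) →
        s.toFinset = recovered C ρ (fun c => (l c).toFinset) ∧
        recov.Computes (encSeq (List.ofFn fun c => encList (l c))) (encList s) T) := by
    intro l
    by_cases hl : ∀ c, (l c).Nodup ∧ (l c).length ≤ ⌊b⌋₊
    · obtain ⟨s, h1, h2, h3⟩ := hrec l hl
      refine ⟨s, h1, ?_, fun _ => ⟨h2, h3⟩⟩
      rw [← List.toFinset_card_of_nodup h1, h2]
      exact hL _ fun c => (List.toFinset_card_le _).trans (hl c).2
    · exact ⟨[], List.nodup_nil, Nat.zero_le _, fun h => absurd h hl⟩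
  choose cand hcnd hclen hcand using hcand
  set lists : (Fin n → ℝ) → (Fin r → S'.Ω) → Fin r → List (Fin q) :=
    fun y ω' c => S'.out (fold (fun a => C a c) y) (ω' c) with hlists
  have hlok : ∀ y ω' c, (lists y ω' c).Nodup ∧ (lists y ω' c).length ≤ ⌊b⌋₊ := fun y ω' c =>
    ⟨hS'.nodup _ _, hS'.length_le _ _⟩
  have hlm : ∀ y, LevelMeasurable (lists y) := fun y => LevelMeasurable.pi fun c =>
    (hS'.meas_out _).comp_measurable (measurable_pi_apply c)
  have hom : ∀ y, LevelMeasurable fun w : Ω × (Fin r → S'.Ω) =>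
      (cand (lists y w.2), out (cand (lists y w.2)) y w.1) := fun y =>
    LevelMeasurable.dependent (G := fun l ω => (cand l, out (cand l) y ω))
      (fun l => LevelMeasurable.comp (hout _ (hcnd l) y).2.1 (Prod.mk (cand l))) (hlm y)
  refine ⟨⟨Ω × (Fin r → S'.Ω), inferInstance, μ.prod (Measure.pi fun _ => S'.μ), inferInstance,
    m + r * S'.m, fun w => nodeMatrix C (M w.1) fun c => S'.M (w.2 c),
    fun w => nodeProg m S'.m ⌊b⌋₊ (prog w.1) recov fun c => S'.prog (w.2 c),
    fun y w => trunc ⌊b⌋₊ (out (cand (lists y w.2)) y w.1)⟩, rfl, ?_, ?_⟩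
  · refine ⟨fun i j => ?_, fun y => ?_, fun w => ?_, fun y w => ?_,
      fun y w => trunc_length_le _ _, fun y w => ?_⟩
    · refine Fin.addCases (fun i => ?_) (fun i => ?_) i
      · simp only [nodeMatrix, Fin.addCases_left]
        exact (hM i j).comp measurable_fst
      · simp only [nodeMatrix, Fin.addCases_right]
        exact (hS'.meas_M _ _).comp ((measurable_pi_apply _).comp measurable_snd)
    · exact LevelMeasurable.comp (hom y) fun a => trunc ⌊b⌋₊ a.2
    · exact size_nodeProg_le _ _ _ _ _ _ (hsize _) hrsize fun c => hS'.size_le _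
    · exact trunc_nodup _ ((hout _ (hcnd _) y).1 w.1).1
    · obtain ⟨h1, h2, h3⟩ := (hout _ (hcnd (lists y w.2)) y).1 w.1
      refine runs_nodeProg C (M w.1) (fun c => S'.M (w.2 c)) y (l := lists y w.2)
        (s := cand (lists y w.2)) (fun c => hS'.runs _ _)
        (Runs.of_computes (hcand _ (hlok y w.2)).2 [])
        ((Runs.of_computes h3 []).mono (htL _ (hclen _))) ?_
      exact (h1.subperm h2).length_le.trans (hclen (lists y w.2))
  · rintro X y φ ⟨⟨Bad, hBad, H', hH', hinj, hX⟩, hgood⟩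
    set E₁ : Set (Fin r → S'.Ω) := ⋃ c, {ω' | F' < ((X.filter fun i =>
      C (φ i) c ∉ S'.out (fold (fun a => C a c) y) (ω' c)).card : ℝ)} with hE₁
    set E₂ : Set (Ω × (Fin r → S'.Ω)) := {w | ¬ (((out (cand (lists y w.2)) y w.1).length : ℝ) ≤ b ∧
      ((missed k η τ y H' (cand (lists y w.2)) (out (cand (lists y w.2)) y w.1)).card : ℝ) ≤
        ζ * k)} with hE₂
    have hsub : {w : Ω × (Fin r → S'.Ω) | β + ζ * k + lossFactor r ρ * F' <
        ((X.filter fun i => φ i ∉ trunc ⌊b⌋₊ (out (cand (lists y w.2)) y w.1)).card : ℝ)} ⊆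
        Set.univ ×ˢ E₁ ∪ E₂ := by
      intro w hw
      by_contra hnot
      simp only [Set.mem_union, Set.mem_prod, Set.mem_univ, true_and, not_or, hE₁, hE₂,
        Set.mem_iUnion, Set.mem_ofPred_eq, not_exists, not_lt, not_not] at hnot hw
      obtain ⟨h1, h2, h3⟩ := hnot
      have h4 : trunc ⌊b⌋₊ (out (cand (lists y w.2)) y w.1) = out (cand (lists y w.2)) y w.1 :=
        if_pos (Nat.le_floor h2)
      rw [h4] at hw
      refine absurd hw (not_lt.mpr ?_)
      refine card_lost_le hBad hinj hX (cand (lists y w.2)) _ ?_ h3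
      have h5 := card_not_recovered_le hr hρ C (lists y w.2) X φ h1
      rw [← (hcand _ (hlok y w.2)).1] at h5
      simpa only [List.mem_toFinset] using h5
    have hm₂ : MeasurableSet E₂ := (hom y).setOf fun a => ¬ ((a.2.length : ℝ) ≤ b ∧
      ((missed k η τ y H' a.1 a.2).card : ℝ) ≤ ζ * k)
    have hb₁ : (Measure.pi fun _ : Fin r => S'.μ) E₁ ≤ ENNReal.ofReal (r * Q') := by
      refine (measure_iUnion_le _).trans ?_
      rw [tsum_fintype]
      calc _ ≤ ∑ _c : Fin r, ENNReal.ofReal Q' := by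
            refine Finset.sum_le_sum fun c _ => ?_
            have hmp := measurePreserving_eval (fun _ : Fin r => S'.μ) c
            have hms : MeasurableSet {ω | F' < ((X.filter fun i =>
                C (φ i) c ∉ S'.out (fold (fun a => C a c) y) ω).card : ℝ)} :=
              (hS'.meas_out (fold (fun a => C a c) y)).setOf fun I =>
                F' < ((X.filter fun i => C (φ i) c ∉ I).card : ℝ)
            have := hmp.measure_preimage hms.nullMeasurableSet
            refine le_trans (le_of_eq this) ?_
            exact hacc X _ _ (hgood c)
        _ = ENNReal.ofReal (r * Q') := by
            rw [Finset.sum_const, card_univ, Fintype.card_fin, nsmul_eq_mul,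
              ENNReal.ofReal_mul (by positivity), ENNReal.ofReal_natCast]
    have hb₂ : (μ.prod (Measure.pi fun _ : Fin r => S'.μ)) E₂ ≤ ENNReal.ofReal p := by
      rw [Measure.prod_apply_symm hm₂]
      calc _ ≤ ∫⁻ _ω', ENNReal.ofReal p ∂(Measure.pi fun _ : Fin r => S'.μ) := by
            refine lintegral_mono fun ω' => ?_
            exact (hout _ (hcnd (lists y ω')) y).2.2 H' hH'
        _ = ENNReal.ofReal p := by simp
    refine (measure_mono hsub).trans ((measure_union_le _ _).trans ?_)
    rw [Measure.prod_prod, measure_univ, one_mul, add_comm p,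
      ENNReal.ofReal_add (by positivity) hp]
    exact add_le_add hb₁ hb₂

/-! ### The tree of codes -/

/-- At every node of the tree the hashed vector is good. -/
def GoodTree {ι : Type*} [DecidableEq ι] {r : ℕ} (k : ℕ) (θ β : ℝ) (X : Finset ι) :
    (h : ℕ) → (ν : ℕ → ℕ) → (∀ j : Fin h, Fin (ν j) → Fin r → Fin (ν ((j : ℕ) + 1))) →
    (Fin (ν 0) → ℝ) → (ι → Fin (ν 0)) → Prop
  | 0, _, _, y, φ => NodeGood k θ β y X φ
  | h + 1, ν, code, y, φ => NodeGood k θ β y X φ ∧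
      ∀ c, GoodTree k θ β X h (fun j => ν (j + 1)) (fun j => code j.succ)
        (fold (fun a => code ⟨0, Nat.succ_pos h⟩ a c) y)
        (fun i => code ⟨0, Nat.succ_pos h⟩ (φ i) c)

theorem sum_pow_succ (s : ℝ) (w : ℕ → ℝ) (h : ℕ) :
    w 0 + s * ∑ j ∈ range h, s ^ j * w (j + 1) = ∑ j ∈ range (h + 1), s ^ j * w j := by
  rw [Finset.sum_range_succ', Finset.mul_sum, pow_zero, one_mul, add_comm]
  congr 1
  exact Finset.sum_congr rfl fun j _ => by ring

theorem sum_pow_succ_leaf (s : ℝ) (w wl : ℕ → ℝ) (h : ℕ) :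
    w 0 + s * (∑ j ∈ range h, s ^ j * w (j + 1) + s ^ h * wl (h + 1)) =
      ∑ j ∈ range (h + 1), s ^ j * w j + s ^ (h + 1) * wl (h + 1) := by
  rw [← sum_pow_succ]
  ring

theorem exists_tree {r k L : ℕ} (hr : 0 < r) {m : ℕ → ℕ} {Ω : ℕ → Type}
    [∀ n, MeasurableSpace (Ω n)] {μ : ∀ n, Measure (Ω n)} [∀ n, IsProbabilityMeasure (μ n)]
    {M : ∀ n, Ω n → Matrix (Fin (m n)) (Fin n) ℝ} {ζ η τ b p ρ : ℝ} (hp : 0 ≤ p) (hρ : 0 ≤ ρ)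
    {time : ℕ → ℕ → ℝ} {tL space T spC : ℕ → ℝ} (htL : ∀ n, ∀ a ≤ L, time n a ≤ tL n)
    (ι : Type) [DecidableEq ι] (β : ℝ) (h : ℕ) :
    ∀ (ν : ℕ → ℕ) (code : ∀ j : Fin h, Fin (ν j) → Fin r → Fin (ν ((j : ℕ) + 1))),
      (∀ j ≤ h, IsWeakIdentification (μ (ν j)) (M (ν j)) encList k ζ η τ b p (time (ν j))
        (space (ν j))) →
      (∀ j, IsListRecoverable (code j) ρ ⌊b⌋₊ L) →
      (∀ j, IsRecoverableInTime (code j) ρ ⌊b⌋₊ (T (ν j)) (spC (ν j))) →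
      ∃ S : Scheme (ν 0), S.m = ∑ j ∈ range (h + 1), r ^ j * m (ν j) ∧
        S.Sound ⌊b⌋₊
          (∑ j ∈ range h, (r : ℝ) ^ j * (T (ν j) + tL (ν j) + (15 * L + 8 * r + 30)) +
            (r : ℝ) ^ h * (time (ν h) (ν h) + 15 * (ν h : ℕ) + 30))
          (∑ j ∈ range h, (r : ℝ) ^ j * (space (ν j) + spC (ν j) + (7 * r + 40)) +
            (r : ℝ) ^ h * (space (ν h) + 2 * (ν h : ℕ) + 30)) ∧
        S.Accurate (ι := ι) (fun X y φ => GoodTree k (τ * Real.sqrt (η / k)) β X h ν code y φ)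
          ((β + ζ * k) * ∑ j ∈ range (h + 1), lossFactor r ρ ^ j)
          (p * ∑ j ∈ range (h + 1), (r : ℝ) ^ j) := by
  induction h with
  | zero =>
    intro ν code hW _ _
    obtain ⟨S, h1, h2, h3⟩ := exists_leaf (hW 0 le_rfl) ι β
    refine ⟨S, by simpa using h1, ?_, ?_⟩
    · simpa using h2
    · simpa [GoodTree] using h3
  | succ h ih =>
    intro ν code hW hL hT
    obtain ⟨S', h1, h2, h3⟩ := ih (fun j => ν (j + 1)) (fun j => code j.succ)
      (fun j hj => hW (j + 1) (by omega)) (fun j => hL j.succ) (fun j => hT j.succ)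
    obtain ⟨S, g1, g2, g3⟩ := exists_node hr hp (hW 0 (Nat.zero_le _)) (htL (ν 0)) hρ
      (hL ⟨0, Nat.succ_pos h⟩) (hT ⟨0, Nat.succ_pos h⟩) h2 (by positivity) h3 β
    refine ⟨S, ?_, ?_, ?_⟩
    · rw [g1, h1, Finset.sum_range_succ' _ (h + 1), Finset.mul_sum, pow_zero, one_mul, add_comm]
      congr 1
      exact Finset.sum_congr rfl fun j _ => by ring
    · have e1 := sum_pow_succ_leaf r
        (fun j => T (ν j) + tL (ν j) + (15 * (L : ℝ) + 8 * r + 30))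
        (fun j => time (ν j) (ν j) + 15 * (ν j : ℕ) + 30) h
      have e2 := sum_pow_succ_leaf r (fun j => space (ν j) + spC (ν j) + (7 * (r : ℝ) + 40))
        (fun j => space (ν j) + 2 * (ν j : ℕ) + 30) h
      rw [← e1, ← e2]
      exact g2
    · have e1 := sum_pow_succ (lossFactor r ρ) (fun _ => β + ζ * k) (h + 1)
      have e2 := sum_pow_succ r (fun _ => p) (h + 1)
      rw [← Finset.sum_mul, ← Finset.sum_mul] at e1 e2
      have e1' : (β + ζ * k) * ∑ j ∈ range (h + 1 + 1), lossFactor r ρ ^ j =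
          β + ζ * k + lossFactor r ρ *
            ((β + ζ * k) * ∑ j ∈ range (h + 1), lossFactor r ρ ^ j) := by
        rw [mul_comm, ← e1]; ring
      have e2' : p * ∑ j ∈ range (h + 1 + 1), (r : ℝ) ^ j =
          p + r * (p * ∑ j ∈ range (h + 1), (r : ℝ) ^ j) := by
        rw [mul_comm, ← e2]; ring
      rw [e1', e2']
      exact g3

theorem Balanced.comp {N n q r : ℕ} {f : Fin N → Fin n} (hf : Balanced f)
    {C : Fin n → Fin r → Fin q} (hC : IsUniform C) (hn : 0 < n) (c : Fin r) :
    Balanced (fun i => C (f i) c) := by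
  intro a
  have h1 : (univ.filter fun i => C (f i) c = a).card =
      ∑ b ∈ univ.filter (fun b => C b c = a), (univ.filter fun i => f i = b).card := by
    rw [Finset.card_eq_sum_card_fiberwise (f := f) (t := univ.filter fun b => C b c = a)
      (by intro i hi; simpa using hi)]
    refine Finset.sum_congr rfl fun b hb => congrArg _ ?_
    ext i
    simp only [mem_filter, mem_univ, true_and] at hb ⊢
    exact ⟨fun h => h.2, fun h => ⟨h ▸ hb, h⟩⟩
  have h2 : n * (q * (univ.filter fun i => C (f i) c = a).card) = n * N := by
    calc n * (q * (univ.filter fun i => C (f i) c = a).card)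
        = q * ∑ b ∈ univ.filter (fun b => C b c = a), n * (univ.filter fun i => f i = b).card := by
          rw [h1, ← Finset.mul_sum]; ring
      _ = q * ((univ.filter fun b => C b c = a).card * N) := by
          rw [Finset.sum_congr rfl fun b _ => hf b, Finset.sum_const, smul_eq_mul]
      _ = n * N := by rw [← mul_assoc, hC c a]
  exact Nat.eq_of_mul_eq_mul_left hn h2

theorem Balanced.le {N n : ℕ} {f : Fin N → Fin n} (hf : Balanced f) (hn : 0 < n) (hN : 0 < N) :
    n ≤ N :=
  Nat.le_of_dvd hN ⟨_, (hf ⟨0, hn⟩).symm⟩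

theorem card_not_goodTree_le {N k r : ℕ} {τ ζ η A : ℝ} (hτ : 0 < τ) (hζ : 0 < ζ) (hζ1 : ζ < 1)
    (hη : 0 < η) (hη1 : η < 1) (hk : 1 ≤ k) (hN : 0 < N) (hA0 : 0 < A)
    (hA : hashBound τ ≤ A / k * (ζ * η) ^ 2)
    (x : Fin N → ℝ) (H : Finset (Fin N)) (hH : H.card ≤ k) (h : ℕ) :
    ∀ (ν : ℕ → ℕ) (code : ∀ j : Fin h, Fin (ν j) → Fin r → Fin (ν ((j : ℕ) + 1))),
      (∀ j ≤ h, A ≤ ν j) → (∀ j, IsUniform (code j)) →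
      ∀ f : Fin N → Fin (ν 0), Balanced f →
      ((univ.filter fun p : Equiv.Perm (Fin N) × (Fin N → Bool) =>
        ¬ GoodTree k (τ * Real.sqrt (η / k)) (10 * ζ * k) (heavy k η (17 * τ) x H) h ν code
          (fold (f ∘ p.1) (signed p.2 x)) (f ∘ p.1)).card : ℝ) ≤
      N.factorial * 2 ^ N * (4 * (A / k) ^ (-(hashRate τ / 2 * ζ * k))) *
        ∑ j ∈ range (h + 1), (r : ℝ) ^ j := by
  induction h with
  | zero =>
    intro ν code hν _ f hf
    have hn : 0 < ν 0 := by
      have : (0 : ℝ) < ν 0 := hA0.trans_le (hν 0 le_rfl)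
      exact_mod_cast this
    simpa [GoodTree] using card_not_nodeGood_le_rpow hf hτ hζ hζ1 hη hη1 hk (hν 0 le_rfl)
      (hf.le hn hN) hA x H hH
  | succ h ih =>
    intro ν code hν hU f hf
    have hn : 0 < ν 0 := by
      have : (0 : ℝ) < ν 0 := hA0.trans_le (hν 0 (Nat.zero_le _))
      exact_mod_cast this
    set P := N.factorial * 2 ^ N * (4 * (A / k) ^ (-(hashRate τ / 2 * ζ * k))) with hP
    set B := univ.filter fun p : Equiv.Perm (Fin N) × (Fin N → Bool) =>
      ¬ NodeGood k (τ * Real.sqrt (η / k)) (10 * ζ * k)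
        (fold (f ∘ p.1) (signed p.2 x)) (heavy k η (17 * τ) x H) (f ∘ p.1) with hB
    set f' : Fin r → Fin N → Fin (ν 1) := fun c i => code ⟨0, Nat.succ_pos h⟩ (f i) c with hf'
    set D : Fin r → Finset (Equiv.Perm (Fin N) × (Fin N → Bool)) := fun c => univ.filter fun p =>
      ¬ GoodTree k (τ * Real.sqrt (η / k)) (10 * ζ * k) (heavy k η (17 * τ) x H) h
        (fun j => ν (j + 1)) (fun j => code j.succ) (fold (f' c ∘ p.1) (signed p.2 x))
        (f' c ∘ p.1) with hD
    have hb : (B.card : ℝ) ≤ P := card_not_nodeGood_le_rpow hf hτ hζ hζ1 hη hη1 hk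
      (hν 0 (Nat.zero_le _)) (hf.le hn hN) hA x H hH
    have hd : ∀ c, ((D c).card : ℝ) ≤ P * ∑ j ∈ range (h + 1), (r : ℝ) ^ j := fun c =>
      ih (fun j => ν (j + 1)) (fun j => code j.succ) (fun j hj => hν (j + 1) (by omega))
        (fun j => hU j.succ) (f' c) (hf.comp (hU ⟨0, Nat.succ_pos h⟩) hn c)
    have hsub : (univ.filter fun p : Equiv.Perm (Fin N) × (Fin N → Bool) =>
        ¬ GoodTree k (τ * Real.sqrt (η / k)) (10 * ζ * k) (heavy k η (17 * τ) x H) (h + 1) ν code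
          (fold (f ∘ p.1) (signed p.2 x)) (f ∘ p.1)) ⊆ B ∪ univ.biUnion D := by
      intro p hp
      by_contra hnot
      simp only [mem_union, mem_biUnion, mem_univ, true_and, not_or, not_exists, hB, hD,
        mem_filter, not_not] at hnot
      refine (mem_filter.mp hp).2 ⟨hnot.1, fun c => ?_⟩
      rw [fold_fold]
      exact hnot.2 c
    have hcard : ((univ.filter fun p : Equiv.Perm (Fin N) × (Fin N → Bool) =>
        ¬ GoodTree k (τ * Real.sqrt (η / k)) (10 * ζ * k) (heavy k η (17 * τ) x H) (h + 1) ν code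
          (fold (f ∘ p.1) (signed p.2 x)) (f ∘ p.1)).card : ℝ) ≤
        B.card + ∑ c, ((D c).card : ℝ) := by
      exact_mod_cast (card_le_card hsub).trans ((card_union_le _ _).trans
        (Nat.add_le_add_left card_biUnion_le _))
    have e := sum_pow_succ r (fun _ => P) (h + 1)
    rw [← Finset.sum_mul, ← Finset.sum_mul] at e
    calc _ ≤ (B.card : ℝ) + ∑ c, ((D c).card : ℝ) := hcard
      _ ≤ P + ∑ _c : Fin r, P * ∑ j ∈ range (h + 1), (r : ℝ) ^ j := by
        gcongr with c
        exact hd c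
      _ = P + r * ((∑ j ∈ range (h + 1), (r : ℝ) ^ j) * P) := by
        rw [Finset.sum_const, card_univ, Fintype.card_fin, nsmul_eq_mul]; ring
      _ = _ := by rw [e]; ring

/-! ### The root: random permutation and signs -/

/-- The random choices of the hash functions. -/
def HashSpace (N : ℕ) : Type := Equiv.Perm (Fin N) × (Fin N → Bool)

instance (N : ℕ) : Fintype (HashSpace N) :=
  inferInstanceAs (Fintype (Equiv.Perm (Fin N) × (Fin N → Bool)))

instance (N : ℕ) : Nonempty (HashSpace N) :=
  inferInstanceAs (Nonempty (Equiv.Perm (Fin N) × (Fin N → Bool)))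

instance (N : ℕ) : MeasurableSpace (HashSpace N) := ⊤

instance (N : ℕ) : DiscreteMeasurableSpace (HashSpace N) := ⟨fun _ => trivial⟩

theorem card_hashSpace (N : ℕ) : Fintype.card (HashSpace N) = N.factorial * 2 ^ N := by
  have : Fintype.card (HashSpace N) = Fintype.card (Equiv.Perm (Fin N) × (Fin N → Bool)) := rfl
  rw [this, Fintype.card_prod, Fintype.card_perm, Fintype.card_fin, Fintype.card_fun,
    Fintype.card_bool, Fintype.card_fin]

/-- The uniform distribution of the random choices. -/
def hashMeasure (N : ℕ) : Measure (HashSpace N) := ProbabilityTheory.uniformOn Set.univ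

instance (N : ℕ) : IsProbabilityMeasure (hashMeasure N) :=
  ProbabilityTheory.isProbabilityMeasure_uniformOn Set.finite_univ Set.univ_nonempty

theorem hashMeasure_le {N : ℕ} (p : HashSpace N → Prop)
    [DecidablePred p] {P : ℝ} (h : ((univ.filter p).card : ℝ) ≤ N.factorial * 2 ^ N * P) :
    hashMeasure N {ω | p ω} ≤ ENNReal.ofReal P := by
  have h0 : (0 : ℝ) < N.factorial * 2 ^ N := by positivity
  rw [hashMeasure, ProbabilityTheory.uniformOn_univ, card_hashSpace]
  have h1 : {ω | p ω} = ((univ.filter p : Finset (HashSpace N)) : Set (HashSpace N)) := by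
    ext; simp
  rw [h1, Measure.count_apply_finset]
  rw [ENNReal.div_le_iff (by exact_mod_cast h0.ne') (ENNReal.natCast_ne_top _)]
  rw [← ENNReal.ofReal_natCast, ← ENNReal.ofReal_natCast, mul_comm,
    ← ENNReal.ofReal_mul (by positivity)]
  apply ENNReal.ofReal_le_ofReal
  push_cast
  exact h

/-- The matrix that permutes the coordinates and attaches signs first. -/
def rootMatrix {m N : ℕ} (M : Matrix (Fin m) (Fin N) ℝ) (ω : HashSpace N) :
    Matrix (Fin m) (Fin N) ℝ :=
  fun i a => M i (ω.1 a) * sgn (ω.2 a)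

theorem rootMatrix_mulVec {m N : ℕ} (M : Matrix (Fin m) (Fin N) ℝ) (ω : HashSpace N)
    (x : Fin N → ℝ) :
    (rootMatrix M ω).mulVec x = M.mulVec (fold ω.1 (signed ω.2 x)) := by
  funext i
  simp only [Matrix.mulVec, dotProduct, rootMatrix]
  rw [← sum_fold]
  exact Finset.sum_congr rfl fun a _ => by rw [signed]; ring

/-- Undo the permutation and keep the elements of the candidate set. -/
def postOut {N : ℕ} (π : Equiv.Perm (Fin N)) (s l : List (Fin N)) : List (Fin N) :=
  l.foldl (fun acc a => if π.symm a ∈ s then π.symm a :: acc else acc) []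

theorem postOut_eq {N : ℕ} (π : Equiv.Perm (Fin N)) (s l : List (Fin N)) :
    postOut π s l = ((l.map π.symm).filter (· ∈ s)).reverse := by
  have key : ∀ acc, l.foldl (fun acc a => if π.symm a ∈ s then π.symm a :: acc else acc) acc =
      ((l.map π.symm).filter (· ∈ s)).reverse ++ acc := by
    induction l with
    | nil => intro acc; simp
    | cons a l ih =>
      intro acc
      rw [List.foldl_cons, ih]
      by_cases h : π.symm a ∈ s <;> simp [h]
  rw [postOut, key, List.append_nil]

theorem mem_postOut {N : ℕ} (π : Equiv.Perm (Fin N)) (s l : List (Fin N)) (i : Fin N) :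
    i ∈ postOut π s l ↔ i ∈ s ∧ π i ∈ l := by
  rw [postOut_eq]
  simp only [List.mem_reverse, List.mem_filter, List.mem_map, decide_eq_true_eq]
  constructor
  · rintro ⟨⟨a, ha, rfl⟩, hs⟩
    exact ⟨hs, by simpa using ha⟩
  · rintro ⟨hs, hl⟩
    exact ⟨⟨π i, hl, by simp⟩, hs⟩

theorem postOut_nodup {N : ℕ} (π : Equiv.Perm (Fin N)) (s : List (Fin N)) {l : List (Fin N)}
    (hl : l.Nodup) : (postOut π s l).Nodup := by
  rw [postOut_eq, List.nodup_reverse]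
  exact (hl.map π.symm.injective).filter _

theorem postOut_length_le {N : ℕ} (π : Equiv.Perm (Fin N)) (s l : List (Fin N)) :
    (postOut π s l).length ≤ l.length := by
  rw [postOut_eq, List.length_reverse]
  exact (List.length_filter_le _ _).trans (by simp)

/-- The table of the inverse of a permutation. -/
def permTable {N : ℕ} (π : Equiv.Perm (Fin N)) : Val :=
  .arr N fun a => if h : a < N then encIdx (π.symm ⟨a, h⟩) else .nil

theorem size_permTable {N : ℕ} (π : Equiv.Perm (Fin N)) : (permTable π).size = 1 + N := by
  simp only [permTable, Val.size]
  rw [Finset.sum_congr rfl (g := fun _ => 1), Finset.sum_const, card_range, smul_eq_mul, mul_one]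
  intro a ha
  simp [mem_range.mp ha, encIdx, Val.size]

/-- The program for `postOut`. -/
def postProg (tab : Val) : Prog :=
  .un .snd (.loop (.bin .mkPair (.var 0) (.const .nil))
    (.bin .intSub (.const (.int 1)) (.un .isNil (.un .fst (.var 0))))
    (.bind (.bin .get (.const tab) (.un .fst (.un .fst (.var 0))))
      (.bin .mkPair (.un .snd (.un .fst (.var 1)))
        (.cond (.bin .get (.un .snd (.var 3)) (.var 0))
          (.bin .mkPair (.var 0) (.un .snd (.var 1))) (.un .snd (.var 1))))))

theorem size_postProg (tab : Val) : (postProg tab).size = tab.size + 30 := by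
  simp only [postProg, Prog.size, Val.size]
  ring

theorem encList_cons {N : ℕ} (a : Fin N) (l : List (Fin N)) :
    encList (a :: l) = .pair (encIdx a) (encList l) := by
  rw [encList_eq, encList_eq]; rfl

theorem runs_postProg {N : ℕ} (π : Equiv.Perm (Fin N)) (s l : List (Fin N)) (y : Val) :
    Runs [encList l, .pair y (encBits s)] (postProg (permTable π)) (encList (postOut π s l))
      (26 * l.length + 10) := by
  have hbody : ∀ (a : Fin N) (l' acc : List (Fin N)),
      Runs (.pair (encSeq ((a :: l').map encIdx)) (encList acc) ::
        [encList l, .pair y (encBits s)])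
      (.bind (.bin .get (.const (permTable π)) (.un .fst (.un .fst (.var 0))))
      (.bin .mkPair (.un .snd (.un .fst (.var 1)))
        (.cond (.bin .get (.un .snd (.var 3)) (.var 0))
          (.bin .mkPair (.var 0) (.un .snd (.var 1))) (.un .snd (.var 1)))))
      (.pair (encSeq (l'.map encIdx))
        (encList (if π.symm a ∈ s then π.symm a :: acc else acc))) 19 := by
    intro a l' acc
    have hget : ∀ (f : ℕ → Val) (i : Fin N), BinOp.get.apply (.arr N f) (encIdx i) =
        some (f i) := by
      intro f i
      have : (0 : ℤ) ≤ ((i : ℕ) : ℤ) ∧ ((i : ℕ) : ℤ) < N :=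
        ⟨by positivity, by exact_mod_cast i.isLt⟩
      simp only [encIdx, BinOp.apply, this, and_self, if_true, Int.toNat_natCast]
    refine (Runs.bind (Runs.bin .const (.un (.un (.var (by rfl)) (by rfl)) (by rfl))
      (w := encIdx (π.symm a)) ?_) (Runs.bin (.un (.un (.var (by rfl)) (by rfl)) (by rfl))
        (Runs.cond (b := π.symm a ∈ s) (T₂ := 4) (.bin (.un (.var (by rfl)) (by rfl))
          (.var (by rfl)) ?_) ?_ ?_) (by rfl))).mono (by norm_num)
    · refine (hget _ a).trans ?_
      simp
    · refine (hget _ (π.symm a)).trans ?_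
      simp
    · intro h
      rw [if_pos h, encList_cons]
      exact (Runs.bin (.var (by rfl)) (.un (.var (by rfl)) (by rfl)) (by rfl)).mono (by norm_num)
    · intro h
      rw [if_neg h]
      exact (Runs.un (.var (by rfl)) (by rfl)).mono (by norm_num)
  have hloop := Runs.loop_list (Γ := [encList l, .pair y (encBits s)]) encIdx
    (encList : List (Fin N) → Val)
    (fun acc a => if π.symm a ∈ s then π.symm a :: acc else acc) (T := 19) (T₁ := 3)
    (p := .bin .mkPair (.var 0) (.const .nil)) hbody l []
    ((Runs.bin (.var (by rfl)) .const (by rw [encList_eq]; rfl)).mono (by norm_num))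
  refine (Runs.un hloop (by rfl)).mono ?_
  linarith

theorem exists_root {N k : ℕ} {S : Scheme N} {b time space Lmax : ℝ} (hb : 0 ≤ b)
    (hS : S.Sound ⌊b⌋₊ time space) (hL : ∀ y ω, ((S.out y ω).length : ℝ) ≤ Lmax)
    {good : Finset (Fin N) → (Fin N → ℝ) → (Fin N → Fin N) → Prop} {F Q P η Γ Γ' b' ζ' : ℝ}
    (hacc : S.Accurate good F Q) (hQ : 0 ≤ Q) (hP : 0 ≤ P) (hΓ : Γ ≤ Γ') (hb' : b ≤ b')
    (hF : F ≤ ζ' * k)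
    (hbad : ∀ (x : Fin N → ℝ) (H : Finset (Fin N)), H.card ≤ k →
      ((univ.filter fun p : HashSpace N =>
        ¬ good (heavy k η Γ x H) (fold p.1 (signed p.2 x)) p.1).card : ℝ) ≤
        N.factorial * 2 ^ N * P) :
    ∃ (Ω' : Type) (_ : MeasurableSpace Ω') (μ' : Measure Ω') (_ : IsProbabilityMeasure μ')
      (M' : Ω' → Matrix (Fin S.m) (Fin N) ℝ),
      IsWeakIdentification μ' M' encBits k ζ' η Γ' b' (Q + P)
        (fun _ => time + 26 * Lmax + 14) (space + N + 35) := by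
  refine ⟨S.Ω × HashSpace N, inferInstance, S.μ.prod (hashMeasure N), inferInstance,
    fun w => rootMatrix (S.M w.1) w.2, fun i j => ?_, fun w =>
      .bind (.bind (.un .fst (.var 0)) (S.prog w.1)) (postProg (permTable w.2.1)),
    fun s x w => postOut w.2.1 s (S.out (fold w.2.1 (signed w.2.2 x)) w.1), fun w => ?_, ?_⟩
  · refine measurable_from_prod_countable_left fun ω => ?_
    exact (hS.meas_M i (ω.1 j)).mul_const (sgn (ω.2 j))
  · have := hS.size_le w.1
    simp only [Prog.size, size_postProg, size_permTable]
    push_cast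
    linarith
  intro s hs x
  have hom : LevelMeasurable fun w : S.Ω × HashSpace N =>
      (w.2, S.out (fold w.2.1 (signed w.2.2 x)) w.1) :=
    LevelMeasurable.dependent (H := fun ω : HashSpace N => ω)
      (G := fun a ω => (a, S.out (fold a.1 (signed a.2 x)) ω))
      (fun a => LevelMeasurable.comp (hS.meas_out _) (Prod.mk a))
      (fun a => MeasurableSet.of_discrete)
  refine ⟨fun w => ⟨postOut_nodup _ _ (hS.nodup _ _), fun i hi => ((mem_postOut _ _ _ _).mp hi).1,
    ?_⟩, fun I => ?_, fun H hH => ?_⟩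
  · have h1 := hS.runs (fold w.2.1 (signed w.2.2 x)) w.1
    rw [← rootMatrix_mulVec] at h1
    have h2 := hL (fold w.2.1 (signed w.2.2 x)) w.1
    refine Runs.computes ((Runs.bind (Runs.bind (.un (.var (by rfl)) (by rfl)) (h1.append _))
      (runs_postProg w.2.1 s _ _)).mono ?_)
    linarith
  · exact hom.setOf fun a => postOut a.1.1 s a.2 = I
  · set X := heavy k η Γ x H with hX
    set B : Set (HashSpace N) := {ω | ¬ good X (fold ω.1 (signed ω.2 x)) ω.1} with hB
    set E : Set (S.Ω × HashSpace N) := {w | F < ((X.filter fun i =>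
      w.2.1 i ∉ S.out (fold w.2.1 (signed w.2.2 x)) w.1).card : ℝ)} with hE
    have hsub : {w : S.Ω × HashSpace N |
        ¬ (((postOut w.2.1 s (S.out (fold w.2.1 (signed w.2.2 x)) w.1)).length : ℝ) ≤ b' ∧
          ((missed k η Γ' x H s
            (postOut w.2.1 s (S.out (fold w.2.1 (signed w.2.2 x)) w.1))).card : ℝ) ≤ ζ' * k)} ⊆
        E := by
      intro w hw
      by_contra hnot
      simp only [hE, Set.mem_ofPred_eq, not_lt] at hnot hw
      refine hw ⟨?_, ?_⟩
      · have h1 := (postOut_length_le w.2.1 s _).trans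
          (hS.length_le (fold w.2.1 (signed w.2.2 x)) w.1)
        have h2 : ((postOut w.2.1 s (S.out (fold w.2.1 (signed w.2.2 x)) w.1)).length : ℝ) ≤
          ⌊b⌋₊ := by exact_mod_cast h1
        exact h2.trans ((Nat.floor_le hb).trans hb')
      · refine le_trans ?_ (hnot.trans hF)
        have : missed k η Γ' x H s
            (postOut w.2.1 s (S.out (fold w.2.1 (signed w.2.2 x)) w.1)) ⊆ X.filter fun i =>
            w.2.1 i ∉ S.out (fold w.2.1 (signed w.2.2 x)) w.1 := by
          intro i hi
          obtain ⟨h1, h2, h3, h4⟩ := mem_filter.mp hi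
          refine mem_filter.mpr ⟨mem_filter.mpr ⟨h1, lt_of_le_of_lt ?_ h3⟩, fun h =>
            h4 ((mem_postOut _ _ _ _).mpr ⟨h2, h⟩)⟩
          have : 0 ≤ tailNorm x H := Real.sqrt_nonneg _
          gcongr
        exact_mod_cast card_le_card this
    have hmE : MeasurableSet E := hom.setOf fun a => F < ((X.filter fun i =>
      a.1.1 i ∉ a.2).card : ℝ)
    refine (measure_mono hsub).trans ?_
    rw [Measure.prod_apply_symm hmE]
    calc _ ≤ ∫⁻ ω, (ENNReal.ofReal Q + B.indicator 1 ω) ∂(hashMeasure N) := by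
          refine lintegral_mono fun ω => ?_
          by_cases hω : ω ∈ B
          · rw [Set.indicator_of_mem hω]
            exact prob_le_one.trans le_add_self
          · rw [Set.indicator_of_notMem hω, add_zero]
            have h1 : good X (fold ω.1 (signed ω.2 x)) ω.1 := not_not.mp hω
            exact hacc X (fold ω.1 (signed ω.2 x)) ω.1 h1
      _ = ENNReal.ofReal Q + hashMeasure N B := by
          rw [lintegral_add_left measurable_const, lintegral_const,
            measure_univ, mul_one, lintegral_indicator_one MeasurableSet.of_discrete]
      _ ≤ ENNReal.ofReal Q + ENNReal.ofReal P := by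
          gcongr
          exact hashMeasure_le (fun ω => ¬ good X (fold ω.1 (signed ω.2 x)) ω.1) (hbad x H hH)
      _ = ENNReal.ofReal (Q + P) := (ENNReal.ofReal_add hQ hP).symm

/-! ### The random matrix of the tree -/

theorem IsWeakIdentification.mono {Ω : Type} [MeasurableSpace Ω] {μ : Measure Ω} {m n : ℕ}
    {M : Ω → Matrix (Fin m) (Fin n) ℝ} {encS : List (Fin n) → Val} {k : ℕ}
    {ζ η τ ℓ p p' : ℝ} {time : ℕ → ℝ} {space space' : ℝ}
    (hM : IsWeakIdentification μ M encS k ζ η τ ℓ p time space) (hp : p ≤ p')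
    (hs : space ≤ space') : IsWeakIdentification μ M encS k ζ η τ ℓ p' time space' := by
  obtain ⟨h1, prog, out, h2, h3⟩ := hM
  refine ⟨h1, prog, out, fun ω => (h2 ω).trans hs, fun s hs' x => ?_⟩
  obtain ⟨g1, g2, g3⟩ := h3 s hs' x
  exact ⟨g1, g2, fun H hH => (g3 H hH).trans (ENNReal.ofReal_le_ofReal hp)⟩

theorem card_hash_bad_le {k r : ℕ} {τ ζ η : ℝ} (hτ : 0 < τ) (hζ : 0 < ζ) (hζ1 : ζ < 1)
    (hη : 0 < η) (hη1 : η < 1) (hk : 1 ≤ k) {h : ℕ} {ν : ℕ → ℕ}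
    {code : ∀ j : Fin h, Fin (ν j) → Fin r → Fin (ν ((j : ℕ) + 1))}
    (hA0 : 0 < ν h) (hνA : ∀ j ≤ h, ν h ≤ ν j)
    (hA : 0 < h → hashBound τ ≤ (ν h : ℝ) / k * (ζ * η) ^ 2) (hU : ∀ j, IsUniform (code j))
    (x : Fin (ν 0) → ℝ) (H : Finset (Fin (ν 0))) (hH : H.card ≤ k) :
    ((univ.filter fun p : HashSpace (ν 0) =>
      ¬ GoodTree k (τ * Real.sqrt (η / k)) (10 * ζ * k) (heavy k η (17 * τ) x H) h ν code
        (fold p.1 (signed p.2 x)) p.1).card : ℝ) ≤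
      (ν 0).factorial * 2 ^ (ν 0) * (4 * ((ν h : ℝ) / k) ^ (-(hashRate τ / 2 * ζ * k)) *
        ∑ j ∈ range (h + 1), (r : ℝ) ^ j) := by
  rcases Nat.eq_zero_or_pos h with rfl | hh
  · rw [Finset.filter_eq_empty_iff.mpr]
    · rw [card_empty, Nat.cast_zero]
      positivity
    · intro p _
      rw [not_not, GoodTree]
      refine nodeGood_of_injective (by positivity) _ p.1.bijective _ _ H _ hH
        (filter_subset _ _) fun i hi => ?_
      refine lt_of_le_of_lt ?_ (mem_filter.mp hi).2
      have : 0 ≤ tailNorm x H := Real.sqrt_nonneg _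
      gcongr
      linarith
  · have hN : 0 < ν 0 := hA0.trans_le (hνA 0 (Nat.zero_le _))
    have := card_not_goodTree_le (r := r) hτ hζ hζ1 hη hη1 hk hN (Nat.cast_pos.mpr hA0) (hA hh)
      x H hH h ν code (fun j hj => Nat.cast_le.mpr (hνA j hj)) hU id
      (fun a => by
        rw [Finset.card_eq_one.mpr ⟨a, by ext; simp⟩, mul_one])
    rw [← mul_assoc]
    exact this

theorem exists_matrix {r k L : ℕ} (hr : 0 < r) {m : ℕ → ℕ} {Ω : ℕ → Type}
    [∀ n, MeasurableSpace (Ω n)] {μ : ∀ n, Measure (Ω n)} [∀ n, IsProbabilityMeasure (μ n)]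
    {M : ∀ n, Ω n → Matrix (Fin (m n)) (Fin n) ℝ} {ζ η τ b b' Γ p ρ : ℝ} (hτ : 0 < τ)
    (hζ : 0 < ζ) (hζ1 : ζ < 1) (hη : 0 < η) (hη1 : η < 1) (hk : 1 ≤ k) (hb : 0 ≤ b)
    (hb' : b ≤ b') (hΓ : 17 * τ ≤ Γ) (hp : 0 ≤ p) (hρ : 0 ≤ ρ)
    {time : ℕ → ℕ → ℝ} {tL space T spC : ℕ → ℝ} (htL : ∀ n, ∀ a ≤ L, time n a ≤ tL n)
    {h : ℕ} {ν : ℕ → ℕ} {code : ∀ j : Fin h, Fin (ν j) → Fin r → Fin (ν ((j : ℕ) + 1))}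
    (hA0 : 0 < ν h) (hνA : ∀ j ≤ h, ν h ≤ ν j)
    (hA : 0 < h → hashBound τ ≤ (ν h : ℝ) / k * (ζ * η) ^ 2) (hbA : 0 < h → b ≤ ν h)
    (hW : ∀ j ≤ h, IsWeakIdentification (μ (ν j)) (M (ν j)) encList k ζ η τ b p (time (ν j))
      (space (ν j)))
    (hU : ∀ j, IsUniform (code j)) (hL : ∀ j, IsListRecoverable (code j) ρ ⌊b⌋₊ L)
    (hT : ∀ j, IsRecoverableInTime (code j) ρ ⌊b⌋₊ (T (ν j)) (spC (ν j))) :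
    ∃ (Ω' : Type) (_ : MeasurableSpace Ω') (μ' : Measure Ω') (_ : IsProbabilityMeasure μ')
      (M' : Ω' → Matrix (Fin (∑ j ∈ range (h + 1), r ^ j * m (ν j))) (Fin (ν 0)) ℝ),
      IsWeakIdentification μ' M' encBits k
        (11 * ζ * ∑ j ∈ range (h + 1), lossFactor r ρ ^ j) η Γ b'
        ((p + 4 * ((ν h : ℝ) / k) ^ (-(hashRate τ / 2 * ζ * k))) *
          ∑ j ∈ range (h + 1), (r : ℝ) ^ j)
        (fun _ => ∑ j ∈ range h, (r : ℝ) ^ j * (T (ν j) + tL (ν j) + (15 * L + 8 * r + 30)) +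
          (r : ℝ) ^ h * (time (ν h) (ν h) + 15 * (ν h : ℕ) + 30) + 26 * (ν h : ℕ) + 14)
        (∑ j ∈ range h, (r : ℝ) ^ j * (space (ν j) + spC (ν j) + (7 * r + 40)) +
          (r : ℝ) ^ h * (space (ν h) + 2 * (ν h : ℕ) + 30) + (ν 0 : ℕ) + 35) := by
  obtain ⟨S, hm, hS, hacc⟩ := exists_tree hr hp hρ htL (Fin (ν 0)) (10 * ζ * k) h ν code hW hL hT
  rw [← hm, add_mul]
  refine exists_root hb hS (fun y ω => ?_) hacc (by positivity) (by positivity) hΓ hb'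
    (le_of_eq (by ring)) (fun x H hH =>
      card_hash_bad_le hτ hζ hζ1 hη hη1 hk hA0 hνA hA hU x H hH)
  rcases Nat.eq_zero_or_pos h with rfl | hh
  · have := (hS.nodup y ω).length_le_card
    rw [Fintype.card_fin] at this
    exact_mod_cast this
  · calc ((S.out y ω).length : ℝ) ≤ ⌊b⌋₊ := by exact_mod_cast hS.length_le y ω
      _ ≤ b := Nat.floor_le hb
      _ ≤ ν h := hbA hh

/-! ### The sizes of the levels -/

theorem tower_log {b : ℝ} (hb : 1 < b) {h : ℕ} {ν : ℕ → ℕ}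
    (hν : ∀ j < h, (ν (j + 1) : ℝ) = (ν j : ℝ) ^ (1 / b)) :
    ∀ j ≤ h, b ^ j * Real.log (ν j) = Real.log (ν 0) := by
  intro j
  induction j with
  | zero => simp
  | succ j ih =>
    intro hj
    have hb0 : b ≠ 0 := by positivity
    rw [hν j hj, ← ih (by omega)]
    rcases Nat.eq_zero_or_pos (ν j) with h0 | h0
    · rw [h0, Nat.cast_zero, Real.zero_rpow (by positivity), Real.log_zero, mul_zero, mul_zero]
    · rw [Real.log_rpow (by exact_mod_cast h0), pow_succ]
      field_simp

theorem tower_le {b : ℝ} (hb : 1 < b) {h : ℕ} {ν : ℕ → ℕ}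
    (hν : ∀ j < h, (ν (j + 1) : ℝ) = (ν j : ℝ) ^ (1 / b)) (hA : 1 < ν h) :
    ∀ j ≤ h, ν h ≤ ν j := by
  intro j hj
  have hlog : 0 < Real.log (ν h) := Real.log_pos (by exact_mod_cast hA)
  have h1 := tower_log hb hν h le_rfl
  have h2 := tower_log hb hν j hj
  have hpos : 0 < b ^ j := by positivity
  have h3 : b ^ j * Real.log (ν h) ≤ b ^ j * Real.log (ν j) := by
    rw [h2, ← h1]
    exact mul_le_mul_of_nonneg_right (pow_le_pow_right₀ hb.le hj) hlog.le
  have h4 : Real.log (ν h) ≤ Real.log (ν j) := le_of_mul_le_mul_left h3 hpos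
  have h5 : (0 : ℝ) < ν j := by
    rcases Nat.eq_zero_or_pos (ν j) with h0 | h0
    · rw [h0, Nat.cast_zero, Real.log_zero] at h4
      linarith
    · exact_mod_cast h0
  exact_mod_cast (Real.log_le_log_iff (by positivity) h5).mp h4

theorem tower_logb {b : ℝ} (hb : 1 < b) {h : ℕ} {ν : ℕ → ℕ}
    (hν : ∀ j < h, (ν (j + 1) : ℝ) = (ν j : ℝ) ^ (1 / b)) (hA : 1 < ν h) :
    Real.logb (ν h) (ν 0) = b ^ h := by
  have hlog : 0 < Real.log (ν h) := Real.log_pos (by exact_mod_cast hA)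
  rw [Real.logb, ← tower_log hb hν h le_rfl, mul_div_assoc, div_self hlog.ne', mul_one]

theorem tower_log_div_le {b : ℝ} (hb : 1 < b) {h k : ℕ} {ν : ℕ → ℕ}
    (hν : ∀ j < h, (ν (j + 1) : ℝ) = (ν j : ℝ) ^ (1 / b)) (hA : 1 < ν h) (hk : 1 ≤ k)
    {j : ℕ} (hj : j ≤ h) :
    Real.log (ν j / k) ≤ Real.log (ν 0 / k) / b ^ j := by
  have hk0 : (k : ℝ) ≠ 0 := by positivity
  have h0 : ∀ i ≤ h, (ν i : ℝ) ≠ 0 := fun i hi => by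
    have := tower_le hb hν hA i hi
    exact_mod_cast (show ν i ≠ 0 by omega)
  have hpos : 0 < b ^ j := by positivity
  rw [le_div_iff₀ hpos, Real.log_div (h0 j hj) hk0, Real.log_div (h0 0 (Nat.zero_le _)) hk0,
    ← tower_log hb hν j hj]
  have h1 : 0 ≤ Real.log k := Real.log_nonneg (by exact_mod_cast hk)
  have h2 : 1 ≤ b ^ j := one_le_pow₀ hb.le
  nlinarith

theorem rpow_log_div_log {b s : ℝ} (hb : 1 < b) (hs : 0 < s) (h : ℕ) :
    (b ^ h) ^ (Real.log s / Real.log b) = s ^ h := by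
  have hlog : 0 < Real.log b := Real.log_pos hb
  have hb0 : 0 < b := by linarith
  rw [Real.rpow_def_of_pos (by positivity), Real.log_pow, ← Real.exp_log (pow_pos hs h),
    Real.log_pow]
  congr 1
  field_simp

theorem geom_sum_le {s : ℝ} (hs : 1 < s) (h : ℕ) :
    ∑ j ∈ range (h + 1), s ^ j ≤ s / (s - 1) * s ^ h := by
  have h1 : 0 < s - 1 := by linarith
  rw [geom_sum_eq hs.ne', div_mul_eq_mul_div, pow_succ]
  gcongr
  nlinarith

theorem sum_pow_le {r : ℕ} (hr : 2 ≤ r) (h : ℕ) :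
    ∑ j ∈ range (h + 1), (r : ℝ) ^ j ≤ 2 * (r : ℝ) ^ h := by
  have hr' : (2 : ℝ) ≤ r := by exact_mod_cast hr
  refine (geom_sum_le (by linarith) h).trans ?_
  gcongr
  rw [div_le_iff₀ (by linarith)]
  linarith

/-- The loss accumulated along the tree is a power of the number of nodes. -/
theorem loss_le {r : ℕ} (hr : 2 ≤ r) {ρ ρ₀ C : ℝ} (hρ : 0 < ρ) (hρ₀ : ρ ≤ ρ₀) (hρ1 : ρ₀ < 1)
    (hC1 : 1 ≤ C)
    (hC : Real.log (11 / (1 - ρ₀)) / (Real.log (1 / ρ₀) / Real.log r * Real.log 22) ≤ C)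
    (h : ℕ) :
    11 * ∑ j ∈ range (h + 1), (1 / ρ) ^ j ≤
      (22 * (r : ℝ) ^ h) ^ (C * (Real.log (1 / ρ) / Real.log r)) := by
  have hr' : (2 : ℝ) ≤ r := by exact_mod_cast hr
  have hr0 : (0 : ℝ) < r := by linarith
  have hr1 : 0 < Real.log r := Real.log_pos (by linarith)
  have hρ0 : 0 < ρ₀ := hρ.trans_le hρ₀
  have h22 : 0 < Real.log 22 := Real.log_pos (by norm_num)
  set a := Real.log (1 / ρ) / Real.log r with ha
  set a₀ := Real.log (1 / ρ₀) / Real.log r with ha₀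
  have ha₀pos : 0 < a₀ := div_pos (Real.log_pos (by rw [lt_div_iff₀ hρ0]; linarith)) hr1
  have haa : a₀ ≤ a := by
    rw [ha, ha₀]
    gcongr
  have hsum : ∑ j ∈ range (h + 1), (1 / ρ) ^ j ≤ (1 / (1 - ρ₀)) * (1 / ρ) ^ h := by
    have h1 : 1 < 1 / ρ := by rw [lt_div_iff₀ hρ]; linarith
    have : 1 / ρ / (1 / ρ - 1) = 1 / (1 - ρ) := by
      have : 1 - ρ ≠ 0 := by linarith
      have : 1 / ρ - 1 ≠ 0 := by linarith
      field_simp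
    refine (geom_sum_le h1 h).trans ?_
    rw [this]
    gcongr
  have h1 : 11 / (1 - ρ₀) ≤ (22 : ℝ) ^ (C * a) := by
    rw [div_le_iff₀ (by positivity)] at hC
    have hpos : 0 < 11 / (1 - ρ₀) := div_pos (by norm_num) (by linarith)
    rw [← Real.log_le_log_iff hpos (by positivity), Real.log_rpow (by norm_num)]
    refine hC.trans ?_
    rw [mul_assoc]
    gcongr
  have h2 : (1 / ρ) ^ h ≤ ((r : ℝ) ^ h) ^ (C * a) := by
    have h3 : ((r : ℝ) ^ h) ^ a = (1 / ρ) ^ h :=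
      rpow_log_div_log (by linarith) (by positivity) h
    rw [← h3]
    refine Real.rpow_le_rpow_of_exponent_le (one_le_pow₀ (by linarith)) ?_
    nlinarith
  calc 11 * ∑ j ∈ range (h + 1), (1 / ρ) ^ j ≤ 11 * ((1 / (1 - ρ₀)) * (1 / ρ) ^ h) := by gcongr
    _ = 11 / (1 - ρ₀) * (1 / ρ) ^ h := by ring
    _ ≤ (22 : ℝ) ^ (C * a) * ((r : ℝ) ^ h) ^ (C * a) := by gcongr
    _ = _ := (Real.mul_rpow (by norm_num) (by positivity)).symm

theorem half_le_log {x : ℝ} (hx : 2 ≤ x) : 1 / 2 ≤ Real.log x := by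
  have := Real.log_two_gt_d9
  have : Real.log 2 ≤ Real.log x := Real.log_le_log (by norm_num) hx
  linarith

/-- The time spent at an inner node. -/
theorem node_time_le {r L : ℕ} {ct Z C x : ℝ} (hct : 0 < ct) (hZ : 1 ≤ Z) (hL : 1 ≤ L)
    (hC : 2 * ct + 90 + 16 * r ≤ C) (hx : 2 ≤ x) :
    ct * Z * ((L : ℝ) + 1) * Real.log x + (15 * L + 8 * r + 30) ≤
      C * (Z * L * Real.log x) := by
  have hL' : (1 : ℝ) ≤ L := by exact_mod_cast hL
  have hlog := half_le_log hx
  have hr : (0 : ℝ) ≤ r := by positivity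
  have h2 : (15 * (L : ℝ) + 8 * r + 30) ≤ (45 + 8 * r) * L := by nlinarith
  have h3 : (L : ℝ) ≤ 2 * (Z * L * Real.log x) := by
    have : 1 ≤ 2 * (Z * Real.log x) := by nlinarith
    nlinarith
  have h4 : 0 ≤ Z * L * Real.log x := by positivity
  calc ct * Z * ((L : ℝ) + 1) * Real.log x + (15 * L + 8 * r + 30)
      ≤ ct * Z * (L + L) * Real.log x + (45 + 8 * r) * L := by
        gcongr
    _ ≤ ct * Z * (L + L) * Real.log x + (45 + 8 * r) * (2 * (Z * L * Real.log x)) := by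
        gcongr
    _ = (2 * ct + 90 + 16 * r) * (Z * L * Real.log x) := by ring
    _ ≤ _ := by gcongr

/-- The time spent at the leaves and at the end. -/
theorem leaf_time_le {ct Z C A R : ℝ} (hct : 0 < ct) (hZ : 1 ≤ Z) (hR : 1 ≤ R)
    (hC : 2 * ct + 200 ≤ C) (hA : 2 ≤ A) :
    R * (ct * Z * (A + 1) * Real.log A + 15 * A + 30) + 26 * A + 14 ≤
      C * (Z * (22 * R) * A * Real.log A) := by
  have hlog := half_le_log hA
  have h1 : A ≤ 2 * (Z * A * Real.log A) := by
    have : 1 ≤ 2 * (Z * Real.log A) := by nlinarith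
    nlinarith
  have h0 : 0 ≤ Z * A * Real.log A := by positivity
  have h2 : R * (ct * Z * (A + 1) * Real.log A + 15 * A + 30) + 26 * A + 14 ≤
      R * (ct * Z * (A + A) * Real.log A + 100 * A) := by
    have h3 : ct * Z * (A + 1) * Real.log A ≤ ct * Z * (A + A) * Real.log A := by
      gcongr
      linarith
    nlinarith
  refine h2.trans ?_
  calc R * (ct * Z * (A + A) * Real.log A + 100 * A)
      ≤ R * (ct * Z * (A + A) * Real.log A + 100 * (2 * (Z * A * Real.log A))) := by gcongr
    _ = (2 * ct + 200) * (R * (Z * A * Real.log A)) := by ring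
    _ ≤ C * (22 * (R * (Z * A * Real.log A))) := by
        have : 0 ≤ R * (Z * A * Real.log A) := by positivity
        exact mul_le_mul hC (by linarith) this (by linarith)
    _ = _ := by ring

theorem total_time_le {r L h : ℕ} {ct Y Z C A : ℝ} {t x : ℕ → ℝ} (hr : 1 ≤ r) (hct : 0 < ct)
    (hZ : 1 ≤ Y * Z) (hL : 1 ≤ L) (hC : 2 * ct + 200 + 16 * r ≤ C) (hA : 2 ≤ A)
    (hx : ∀ j < h, 2 ≤ x j) :
    ∑ j ∈ range h, (r : ℝ) ^ j * (t j + ct * Y * Z * ((L : ℝ) + 1) * Real.log (x j) +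
        (15 * L + 8 * r + 30)) +
      (r : ℝ) ^ h * (ct * Y * Z * (A + 1) * Real.log A + 15 * A + 30) + 26 * A + 14 ≤
      C * (Y * Z * (22 * (r : ℝ) ^ h) * A * Real.log A) +
        ∑ j ∈ range h, (r : ℝ) ^ j * (t j + C * (Y * Z * L * Real.log (x j))) := by
  have hr0 : (0 : ℝ) ≤ r := by positivity
  have h1 := leaf_time_le (ct := ct) (C := C) (R := (r : ℝ) ^ h) hct hZ
    (one_le_pow₀ (by exact_mod_cast hr)) (by linarith) hA
  have h2 : ∑ j ∈ range h, (r : ℝ) ^ j * (t j + ct * Y * Z * ((L : ℝ) + 1) * Real.log (x j) +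
      (15 * L + 8 * r + 30)) ≤
      ∑ j ∈ range h, (r : ℝ) ^ j * (t j + C * (Y * Z * L * Real.log (x j))) := by
    refine Finset.sum_le_sum fun j hj => ?_
    have h4 := node_time_le (r := r) (ct := ct) (C := C) hct hZ hL (by linarith)
      (hx j (mem_range.mp hj))
    rw [← mul_assoc] at h4
    rw [add_assoc]
    gcongr
  rw [← mul_assoc] at h1
  linarith

/-- The size of the programs. -/
theorem space_le {r h d : ℕ} (hr : 2 ≤ r) {b C : ℝ} (hb : 1 < b) {ν : ℕ → ℕ}
    (hν : ∀ j < h, (ν (j + 1) : ℝ) = (ν j : ℝ) ^ (1 / b)) (hA : 1 < ν h)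
    (hC : Real.log r / Real.log b + (d + 1) + Real.log (14 * r + 153) / Real.log 2 ≤ C) :
    ∑ j ∈ range h, (r : ℝ) ^ j * ((ν j : ℝ) ^ d + (ν j : ℝ) ^ d + (7 * r + 40)) +
      (r : ℝ) ^ h * ((ν h : ℝ) ^ d + 2 * (ν h : ℕ) + 30) + (ν 0 : ℕ) + 35 ≤ (ν 0 : ℝ) ^ C := by
  have hr' : (2 : ℝ) ≤ r := by exact_mod_cast hr
  have hr0 : (0 : ℝ) < r := by linarith
  have hlb : 0 < Real.log b := Real.log_pos hb
  have hlr : 0 < Real.log r := Real.log_pos (by linarith)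
  have hl2 : 0 < Real.log 2 := Real.log_pos (by norm_num)
  have hle := tower_le hb hν hA
  have hA' : (2 : ℝ) ≤ ν h := by exact_mod_cast hA
  set N : ℝ := ((ν 0 : ℕ) : ℝ) with hN
  have hνN : ∀ j ≤ h, (ν j : ℝ) ≤ N := by
    intro j hj
    have h1 : (0 : ℝ) < ν j := by
      have := hle j hj
      exact_mod_cast (show 0 < ν j by omega)
    have h2 : 0 ≤ Real.log (ν j) := Real.log_natCast_nonneg _
    have h3 := tower_log hb hν j hj
    have hN0 : 0 < N := by
      have := hle 0 (Nat.zero_le _)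
      rw [hN]
      exact_mod_cast (show 0 < ν 0 by omega)
    refine (Real.log_le_log_iff h1 hN0).mp ?_
    rw [hN, ← h3]
    exact le_mul_of_one_le_left h2 (one_le_pow₀ hb.le)
  have hAN := hνN h le_rfl
  have hN2 : 2 ≤ N := hA'.trans hAN
  have hN0 : 0 < N := by linarith
  have hpow : ∀ j ≤ h, (ν j : ℝ) ^ d ≤ N ^ d := fun j hj => by
    have := hνN j hj
    gcongr
  have hNd : 1 ≤ N ^ d := one_le_pow₀ (by linarith)
  have hR1 : 1 ≤ (r : ℝ) ^ h := one_le_pow₀ (by linarith)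
  have hNd1 : N ≤ N ^ (d + 1) := by rw [pow_succ]; nlinarith
  have hNd2 : N ^ d ≤ N ^ (d + 1) := pow_le_pow_right₀ (by linarith) (Nat.le_succ d)
  have hNd3 : 1 ≤ N ^ (d + 1) := by linarith
  have hsum : ∑ j ∈ range h, (r : ℝ) ^ j * ((ν j : ℝ) ^ d + (ν j : ℝ) ^ d + (7 * r + 40)) ≤
      2 * (r : ℝ) ^ h * (2 * N ^ d + (7 * r + 40)) := by
    calc _ ≤ ∑ j ∈ range h, (r : ℝ) ^ j * (N ^ d + N ^ d + (7 * r + 40)) := by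
          refine Finset.sum_le_sum fun j hj => ?_
          have := hpow j (mem_range.mp hj).le
          gcongr
      _ = (∑ j ∈ range h, (r : ℝ) ^ j) * (2 * N ^ d + (7 * r + 40)) := by
          rw [Finset.sum_mul]
          exact Finset.sum_congr rfl fun j _ => by ring
      _ ≤ (∑ j ∈ range (h + 1), (r : ℝ) ^ j) * (2 * N ^ d + (7 * r + 40)) := by
          gcongr
          exact Nat.le_succ h
      _ ≤ _ := by
          gcongr
          exact sum_pow_le hr h
  have hall : ∑ j ∈ range h, (r : ℝ) ^ j * ((ν j : ℝ) ^ d + (ν j : ℝ) ^ d + (7 * r + 40)) +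
      (r : ℝ) ^ h * ((ν h : ℝ) ^ d + 2 * (ν h : ℕ) + 30) + N + 35 ≤
      (r : ℝ) ^ h * (N ^ (d + 1) * (14 * r + 153)) := by
    have h1 : (r : ℝ) ^ h * ((ν h : ℝ) ^ d + 2 * (ν h : ℕ) + 30) ≤
        (r : ℝ) ^ h * (N ^ (d + 1) + 2 * N ^ (d + 1) + 30 * N ^ (d + 1)) := by
      have := hpow h le_rfl
      gcongr
      · linarith
      · linarith
      · linarith
    have h2 : N + 35 ≤ (r : ℝ) ^ h * (N ^ (d + 1) + 35 * N ^ (d + 1)) := by nlinarith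
    have h3 : 2 * (r : ℝ) ^ h * (2 * N ^ d + (7 * r + 40)) ≤
        2 * (r : ℝ) ^ h * (2 * N ^ (d + 1) + (7 * r + 40) * N ^ (d + 1)) := by
      gcongr
      nlinarith
    have h4 : (0 : ℝ) ≤ (r : ℝ) ^ h * N ^ (d + 1) := by positivity
    nlinarith
  refine hall.trans ?_
  have hlogN : Real.log 2 ≤ Real.log N := Real.log_le_log (by norm_num) hN2
  have e1 : (r : ℝ) ^ h ≤ N ^ (Real.log r / Real.log b) := by
    rw [← rpow_log_div_log hb hr0 h]
    refine Real.rpow_le_rpow (by positivity) ?_ (by positivity)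
    have h1 : b ^ h * Real.log 2 ≤ N * Real.log 2 := by
      have h2 : b ^ h * Real.log 2 ≤ Real.log N := by
        rw [hN, ← tower_log hb hν h le_rfl]
        gcongr
      have h3 : Real.log N ≤ N * Real.log 2 := by
        have h5 : Real.log (N / 2) ≤ N / 2 - 1 := Real.log_le_sub_one_of_pos (by positivity)
        rw [Real.log_div hN0.ne' (by norm_num)] at h5
        have := Real.log_two_gt_d9
        have := Real.log_two_lt_d9
        nlinarith
      linarith
    exact le_of_mul_le_mul_right h1 hl2
  have e2 : (14 * r + 153 : ℝ) ≤ N ^ (Real.log (14 * r + 153) / Real.log 2) := by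
    rw [← Real.log_le_log_iff (by positivity) (by positivity), Real.log_rpow hN0,
      div_mul_eq_mul_div, le_div_iff₀ hl2]
    have : 0 ≤ Real.log (14 * r + 153 : ℝ) := Real.log_nonneg (by linarith)
    gcongr
  calc (r : ℝ) ^ h * (N ^ (d + 1) * (14 * r + 153))
      ≤ N ^ (Real.log r / Real.log b) * (N ^ ((d : ℝ) + 1) *
          N ^ (Real.log (14 * r + 153) / Real.log 2)) := by
        have : N ^ ((d : ℝ) + 1) = N ^ (d + 1) := by
          exact_mod_cast Real.rpow_natCast N (d + 1)
        rw [this]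
        gcongr
    _ = N ^ (Real.log r / Real.log b + (d + 1) + Real.log (14 * r + 153) / Real.log 2) := by
        rw [Real.rpow_add hN0 (Real.log r / Real.log b + (d + 1)),
          Real.rpow_add hN0 (Real.log r / Real.log b), mul_assoc]
    _ ≤ N ^ C := Real.rpow_le_rpow_of_exponent_le (by linarith) hC

theorem le_bottom {b α ζ η C : ℝ} (hb : 1 < b) (hα0 : 0 < α) (hα : α < 1 / 2) (hζ : 0 < ζ)
    (hη : 0 < η) (hC : 0 ≤ C) {h k : ℕ} {ν : ℕ → ℕ} (hk : 1 ≤ k) (hh : 0 < h)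
    (hν : ∀ j < h, (ν (j + 1) : ℝ) = (ν j : ℝ) ^ (1 / b)) (hkA : k < ν h)
    (hN : Real.exp (b / (b - 1)) ≤ ν 0)
    (hA : C * ζ⁻¹ ^ 6 * η⁻¹ ^ 2 * (k : ℝ) ^ ((1 - α) / (1 - 2 * α)) *
      Real.log (ν 0 / k) ^ 2 ≤ ν h) :
    C * ζ⁻¹ ^ 6 * η⁻¹ ^ 2 * k ≤ ν h := by
  have hk1 : (1 : ℝ) ≤ k := by exact_mod_cast hk
  have hkA' : (k : ℝ) ≤ ν h := by exact_mod_cast hkA.le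
  have hN0 : (0 : ℝ) < ν 0 := (Real.exp_pos _).trans_le hN
  have hb1 : 0 < b - 1 := by linarith
  have h1 : b / (b - 1) ≤ Real.log (ν 0) := (Real.le_log_iff_exp_le hN0).mpr hN
  rw [div_le_iff₀ hb1] at h1
  have h2 : b * Real.log k ≤ Real.log (ν 0) := by
    rw [← tower_log hb hν h le_rfl]
    have h3 : Real.log k ≤ Real.log (ν h) := Real.log_le_log (by linarith) hkA'
    have h4 : 0 ≤ Real.log k := Real.log_nonneg hk1
    have h5 : b ≤ b ^ h := le_self_pow₀ hb.le hh.ne'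
    gcongr
  have h3 : 1 ≤ Real.log (ν 0 / k) := by
    rw [Real.log_div hN0.ne' (by positivity)]
    nlinarith
  have h4 : (k : ℝ) ≤ (k : ℝ) ^ ((1 - α) / (1 - 2 * α)) := by
    refine (Real.rpow_one (k : ℝ)).symm.le.trans (Real.rpow_le_rpow_of_exponent_le hk1 ?_)
    rw [le_div_iff₀ (by linarith)]
    linarith
  refine le_trans ?_ hA
  have h5 : 1 ≤ Real.log (ν 0 / k) ^ 2 := one_le_pow₀ h3
  calc C * ζ⁻¹ ^ 6 * η⁻¹ ^ 2 * k
      ≤ C * ζ⁻¹ ^ 6 * η⁻¹ ^ 2 * (k : ℝ) ^ ((1 - α) / (1 - 2 * α)) := by gcongr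
    _ ≤ _ := le_mul_of_one_le_right (by positivity) h5

/-- The number of rows. -/
theorem rows_le {r h k : ℕ} {b g : ℝ} (hb : 1 < b) {m ν : ℕ → ℕ}
    (hν : ∀ j < h, (ν (j + 1) : ℝ) = (ν j : ℝ) ^ (1 / b)) (hA : 1 < ν h) (hk : 1 ≤ k)
    (hg : 0 ≤ g) (hm : ∀ j ≤ h, (m (ν j) : ℝ) ≤ g * k * Real.log (ν j / k)) :
    ((∑ j ∈ range (h + 1), r ^ j * m (ν j) : ℕ) : ℝ) ≤
      g * k * Real.log (ν 0 / k) * ∑ j ∈ range (h + 1), ((r : ℝ) / b) ^ j := by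
  push_cast
  rw [Finset.mul_sum]
  refine Finset.sum_le_sum fun j hj => ?_
  have hj' : j ≤ h := Nat.lt_succ_iff.mp (mem_range.mp hj)
  calc (r : ℝ) ^ j * m (ν j) ≤ (r : ℝ) ^ j * (g * k * (Real.log (ν 0 / k) / b ^ j)) := by
        have := tower_log_div_le hb hν hA hk hj'
        have := hm j hj'
        gcongr
        refine this.trans ?_
        gcongr
    _ = _ := by rw [div_pow]; ring

theorem exists_forall_le (l : List ℝ) : ∃ C : ℝ, ∀ x ∈ l, x ≤ C :=
  (List.finite_toSet l).bddAbove

end SparseRec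

end

set_option maxHeartbeats 1000000 in
theorem mainTheorem8
    -- fixed parameters: codeword length, rate parameter, exponent parameter, error bound,
    -- and the constants hidden in the guarantees of the given family of matrices
    (r : ℕ) (hr : 2 ≤ r) (b : ℝ) (hb : 1 < b)
    (α : ℝ) (hα0 : 0 < α) (hα : α < 1 / 2)
    (ρ₀ : ℝ) (hρ₀ : ρ₀ < 1)
    (τ cℓ cp ct : ℝ) (hτ : 0 < τ) (hcℓ : 0 < cℓ) (hcp : 0 < cp) (hct : 0 < ct) (d : ℕ) :
    ∃ C c : ℝ, 0 < C ∧ 0 < c ∧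
    ∀ ζ η : ℝ, 0 < ζ → ζ < 1 → 0 < η → η < 1 →
    ∃ N₀ : ℕ,
    ∀ (k : ℕ), 1 ≤ k →
    -- the given family of weak identification matrices
    ∀ (g : ℝ) (m : ℕ → ℕ) (Ω : ℕ → Type) [∀ n, MeasurableSpace (Ω n)]
      (μ : ∀ n, MeasureTheory.Measure (Ω n)) [∀ n, MeasureTheory.IsProbabilityMeasure (μ n)]
      (M : ∀ n, Ω n → Matrix (Fin (m n)) (Fin n) ℝ),
      (∀ n : ℕ, ζ⁻¹ ^ 2 ≤ (n : ℝ) → k < n →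
        (m n : ℝ) ≤ g * k * Real.log (n / k) ∧
        SparseRec.IsWeakIdentification (μ n) (M n) SparseRec.encList k ζ η τ
          (cℓ * k / η) (((n : ℝ) / k) ^ (-(cp * ζ * k)))
          (fun a => ct * ζ⁻¹ ^ 3 * η⁻¹ ^ 2 * ((a : ℝ) + 1) * Real.log n) ((n : ℝ) ^ d)) →
    -- the tree of height `h`: level `j` has the domain size `ν j = N ^ (1 / b ^ j)`
    ∀ (N A h : ℕ) (ν : ℕ → ℕ), N₀ ≤ N → ν 0 = N → ν h = A →
      (∀ j < h, (ν (j + 1) : ℝ) = (ν j : ℝ) ^ (1 / b)) →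
      k < A →
      C * ζ⁻¹ ^ 6 * η⁻¹ ^ 2 * (k : ℝ) ^ ((1 - α) / (1 - 2 * α)) * Real.log (N / k) ^ 2 ≤ A →
    -- the given codes
    ∀ (ρ : ℝ), 0 ≤ ρ → ρ ≤ ρ₀ →
    ∀ (L : ℕ) (T : ℕ → ℕ → ℝ → ℝ)
      (code : ∀ j : Fin h, Fin (ν j) → Fin r → Fin (ν ((j : ℕ) + 1))), 1 ≤ L →
      (∀ j, SparseRec.IsUniform (code j)) →
      (∀ j, SparseRec.IsListRecoverable (code j) ρ ⌊cℓ * k / η⌋₊ L) →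
      (∀ j, SparseRec.IsRecoverableInTime (code j) ρ ⌊cℓ * k / η⌋₊
        (T ⌊cℓ * k / η⌋₊ (ν j) b) ((ν j : ℝ) ^ d)) →
    -- the resulting matrix
    ∃ (nodes m' : ℕ) (ζ' p' D : ℝ) (Ω' : Type) (_ : MeasurableSpace Ω')
      (μ' : MeasureTheory.Measure Ω') (_ : MeasureTheory.IsProbabilityMeasure μ')
      (M' : Ω' → Matrix (Fin m') (Fin N) ℝ),
      SparseRec.IsWeakIdentification μ' M' SparseRec.encBits k ζ' η C
        (C * k / η) p' (fun _ => D) ((N : ℝ) ^ C) ∧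
      (h : ℝ) ≤ C * Real.logb r (Real.logb A N) ∧
      (nodes : ℝ) ≤ C * Real.logb A N ^ (Real.log r / Real.log b) ∧
      (0 < ρ → ζ' ≤ ζ * (nodes : ℝ) ^ (C * (Real.log (1 / ρ) / Real.log r))) ∧
      (ρ = 0 → ζ' ≤ ζ * nodes) ∧
      p' ≤ nodes * ((A : ℝ) / k) ^ (-(c * ζ * k)) ∧
      (m' : ℝ) ≤ C * (g * k * Real.log (N / k) * ∑ j ∈ Finset.range (h + 1), ((r : ℝ) / b) ^ j) ∧
      (b < r → (m' : ℝ) ≤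
        C * (g * k * Real.log (N / k) * Real.logb A N ^ (Real.log (r / b) / Real.log b))) ∧
      D ≤ C * (ζ⁻¹ ^ 3 * η⁻¹ ^ 2 * nodes * A * Real.log A) +
        ∑ j ∈ Finset.range h, (r : ℝ) ^ j *
          (T ⌊cℓ * k / η⌋₊ (ν j) b + C * (ζ⁻¹ ^ 3 * η⁻¹ ^ 2 * L * Real.log (ν j))) := by
  have hr' : (2 : ℝ) ≤ r := by exact_mod_cast hr
  have hr0 : (0 : ℝ) < r := by linarith
  have hlb : 0 < Real.log b := Real.log_pos hb
  have hlr : 0 < Real.log r := Real.log_pos (by linarith)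
  have hb0 : 0 < b := by linarith
  obtain ⟨C, hC⟩ := SparseRec.exists_forall_le [22, 17 * τ, cℓ, SparseRec.hashBound τ,
    Real.log r / Real.log b,
    Real.log (11 / (1 - ρ₀)) / (Real.log (1 / ρ₀) / Real.log r * Real.log 22),
    (r / b) / (r / b - 1), 2 * ct + 200 + 16 * r,
    Real.log r / Real.log b + (d + 1) + Real.log (14 * r + 153) / Real.log 2]
  simp only [List.mem_cons, List.not_mem_nil, or_false, forall_eq_or_imp, forall_eq] at hC
  obtain ⟨hC22, hCτ, hCℓ, hCB, hCh, hCρ, hCg, hCt, hCs⟩ := hC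
  have hC0 : 0 < C := by linarith
  refine ⟨C, min cp (SparseRec.hashRate τ / 2), hC0,
    lt_min hcp (half_pos (SparseRec.hashRate_pos τ)), fun ζ η hζ hζ1 hη hη1 =>
    ⟨⌈Real.exp (b / (b - 1))⌉₊ + ⌈ζ⁻¹ ^ 2⌉₊, ?_⟩⟩
  intro k hk g m Ω _ μ _ M hfam N A h ν hN hν0 hνh hν hkA hA ρ hρ hρρ₀ L T code hL1 hU hLR hRT
  subst hν0 hνh
  have hk1 : (1 : ℝ) ≤ k := by exact_mod_cast hk
  have hk0 : (0 : ℝ) < k := by linarith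
  have hA1 : 1 < ν h := lt_of_le_of_lt hk hkA
  have hA2 : (2 : ℝ) ≤ ν h := by exact_mod_cast hA1
  have hle := SparseRec.tower_le hb hν hA1
  have hζi : 1 ≤ ζ⁻¹ := (one_le_inv₀ hζ).mpr hζ1.le
  have hηi : 1 ≤ η⁻¹ := (one_le_inv₀ hη).mpr hη1.le
  have hN' : (⌈Real.exp (b / (b - 1))⌉₊ : ℝ) + ⌈ζ⁻¹ ^ 2⌉₊ ≤ ν 0 := by exact_mod_cast hN
  have hN1 : Real.exp (b / (b - 1)) ≤ ν 0 := by
    have := Nat.le_ceil (Real.exp (b / (b - 1)))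
    have : (0 : ℝ) ≤ ⌈ζ⁻¹ ^ 2⌉₊ := by positivity
    linarith
  have hN2 : ζ⁻¹ ^ 2 ≤ ν 0 := by
    have := Nat.le_ceil (ζ⁻¹ ^ 2)
    have : (0 : ℝ) ≤ ⌈Real.exp (b / (b - 1))⌉₊ := by positivity
    linarith
  have hbot : 0 < h → C * ζ⁻¹ ^ 6 * η⁻¹ ^ 2 * k ≤ ν h := fun hh =>
    SparseRec.le_bottom hb hα0 hα hζ hη hC0.le hk hh hν hkA hN1 hA
  have hζA : ζ⁻¹ ^ 2 ≤ (ν h : ℝ) := by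
    rcases Nat.eq_zero_or_pos h with rfl | hh
    · exact hN2
    · refine le_trans ?_ (hbot hh)
      calc ζ⁻¹ ^ 2 ≤ ζ⁻¹ ^ 6 := pow_le_pow_right₀ hζi (by norm_num)
        _ = 1 * ζ⁻¹ ^ 6 * 1 ^ 2 * 1 := by ring
        _ ≤ C * ζ⁻¹ ^ 6 * η⁻¹ ^ 2 * k := by
          gcongr
          linarith
  have hfam' : ∀ j ≤ h, _ := fun j hj => hfam (ν j)
    (hζA.trans (Nat.cast_le.mpr (hle j hj))) (hkA.trans_le (hle j hj))
  have hAk : 1 < (ν h : ℝ) / k := by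
    rw [lt_div_iff₀ hk0, one_mul]
    exact_mod_cast hkA
  have hg : 0 ≤ g := by
    have h1 := (Nat.cast_nonneg _).trans (hfam' h le_rfl).1
    have h2 : 0 < k * Real.log (ν h / k) := mul_pos hk0 (Real.log_pos hAk)
    rw [mul_assoc] at h1
    exact nonneg_of_mul_nonneg_left h1 h2
  have hℓ : cℓ * k / η ≤ C * k / η := by gcongr
  have hℓ0 : 0 ≤ cℓ * k / η := by positivity
  have hbA : 0 < h → cℓ * k / η ≤ ν h := fun hh => by
    refine le_trans ?_ (hbot hh)
    calc cℓ * k / η = cℓ * 1 ^ 6 * η⁻¹ ^ 1 * k := by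
          rw [one_pow, pow_one, div_eq_mul_inv]; ring
      _ ≤ C * ζ⁻¹ ^ 6 * η⁻¹ ^ 2 * k := by
          gcongr
          norm_num
  have hBA : 0 < h → SparseRec.hashBound τ ≤ (ν h : ℝ) / k * (ζ * η) ^ 2 := fun hh => by
    have h1 : C * ζ⁻¹ ^ 6 * η⁻¹ ^ 2 ≤ (ν h : ℝ) / k := by
      rw [le_div_iff₀ hk0]
      exact hbot hh
    calc SparseRec.hashBound τ ≤ C * 1 ^ 4 := by rw [one_pow, mul_one]; exact hCB
      _ ≤ C * ζ⁻¹ ^ 4 := by gcongr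
      _ = C * ζ⁻¹ ^ 6 * η⁻¹ ^ 2 * (ζ * η) ^ 2 := by field_simp
      _ ≤ _ := by gcongr
  set X := ((ν h : ℝ) / k) ^ (-(min cp (SparseRec.hashRate τ / 2) * ζ * k)) with hX
  set p := ((ν h : ℝ) / k) ^ (-(cp * ζ * k)) with hp
  have hp0 : 0 ≤ p := by positivity
  have hpX : p ≤ X := by
    refine Real.rpow_le_rpow_of_exponent_le hAk.le (neg_le_neg ?_)
    gcongr
    exact min_le_left _ _
  have hqX : ((ν h : ℝ) / k) ^ (-(SparseRec.hashRate τ / 2 * ζ * k)) ≤ X := by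
    refine Real.rpow_le_rpow_of_exponent_le hAk.le (neg_le_neg ?_)
    gcongr
    exact min_le_right _ _
  have hW : ∀ j ≤ h, SparseRec.IsWeakIdentification (μ (ν j)) (M (ν j)) SparseRec.encList k ζ η τ
      (cℓ * k / η) p
      (fun a => ct * ζ⁻¹ ^ 3 * η⁻¹ ^ 2 * ((a : ℝ) + 1) * Real.log (ν j)) ((ν j : ℝ) ^ d) :=
    fun j hj => (hfam' j hj).2.mono (Real.rpow_le_rpow_of_nonpos (by linarith)
      (by
        have : (ν h : ℝ) ≤ ν j := Nat.cast_le.mpr (hle j hj)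
        gcongr) (neg_nonpos.mpr (by positivity))) le_rfl
  have hsum := SparseRec.sum_pow_le hr h
  have hR1 : 1 ≤ (r : ℝ) ^ h := one_le_pow₀ (by linarith)
  obtain ⟨Ω', hΩ', μ', hμ', M', hM'⟩ := SparseRec.exists_matrix (L := L) (b' := C * k / η)
    (Γ := C) (p := p) (ρ := ρ)
    (time := fun n a => ct * ζ⁻¹ ^ 3 * η⁻¹ ^ 2 * ((a : ℝ) + 1) * Real.log n)
    (tL := fun n => ct * ζ⁻¹ ^ 3 * η⁻¹ ^ 2 * ((L : ℝ) + 1) * Real.log n)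
    (space := fun n => (n : ℝ) ^ d) (spC := fun n => (n : ℝ) ^ d)
    (T := fun n => T ⌊cℓ * k / η⌋₊ n b)
    (by omega : 0 < r) hτ hζ hζ1 hη hη1 hk hℓ0 hℓ hCτ hp0 hρ
    (fun n a ha => by
      have : (a : ℝ) ≤ L := Nat.cast_le.mpr ha
      have : 0 ≤ Real.log n := Real.log_natCast_nonneg n
      gcongr)
    (hA1.trans' Nat.zero_lt_one) hle hBA hbA hW hU hLR hRT
  have hlogb := SparseRec.tower_logb hb hν hA1
  have hrows := SparseRec.rows_le (r := r) hb hν hA1 hk hg fun j hj => (hfam' j hj).1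
  have hG : 0 ≤ g * k * Real.log (ν 0 / k) := by
    have : 1 < (ν 0 : ℝ) / k := hAk.trans_le (by
      have : (ν h : ℝ) ≤ ν 0 := Nat.cast_le.mpr (hle 0 (Nat.zero_le _))
      gcongr)
    have := Real.log_pos this
    positivity
  have hnodes : ((22 * r ^ h : ℕ) : ℝ) = 22 * (r : ℝ) ^ h := by push_cast; ring
  have hZ : 1 ≤ ζ⁻¹ ^ 3 * η⁻¹ ^ 2 := one_le_mul_of_one_le_of_one_le (one_le_pow₀ hζi)
    (one_le_pow₀ hηi)
  refine ⟨22 * r ^ h, _, _, _, _, Ω', hΩ', μ', hμ', M', hM'.mono le_rfl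
    (SparseRec.space_le hr hb hν hA1 hCs), ?_, ?_, ?_, ?_, ?_, ?_, ?_, ?_⟩
  · rw [hlogb, Real.logb, Real.log_pow]
    calc (h : ℝ) = Real.log r / Real.log b * (h * Real.log b / Real.log r) := by field_simp
      _ ≤ C * (h * Real.log b / Real.log r) := by gcongr
  · rw [hlogb, SparseRec.rpow_log_div_log hb hr0, hnodes]
    gcongr
  · intro hρ0
    have := SparseRec.loss_le hr hρ0 hρρ₀ hρ₀ (by linarith) hCρ h
    rw [hnodes]
    refine le_trans (le_of_eq ?_) (mul_le_mul_of_nonneg_left this hζ.le)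
    simp only [SparseRec.lossFactor, if_pos hρ0]
    ring
  · intro hρ0
    rw [hnodes]
    simp only [SparseRec.lossFactor, hρ0, lt_self_iff_false, if_false]
    nlinarith
  · rw [hnodes]
    calc _ ≤ (X + 4 * X) * (2 * (r : ℝ) ^ h) := by gcongr
      _ ≤ _ := by
        have : 0 ≤ X * (r : ℝ) ^ h := by positivity
        nlinarith
  · refine hrows.trans (le_mul_of_one_le_left (by positivity) (by linarith))
  · intro hbr
    have h1 : 1 < r / b := by rwa [lt_div_iff₀ hb0, one_mul]
    rw [hlogb, SparseRec.rpow_log_div_log hb (by positivity)]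
    calc _ ≤ g * k * Real.log (ν 0 / k) * ((r / b) / (r / b - 1) * (r / b) ^ h) := by
          refine hrows.trans ?_
          gcongr
          exact SparseRec.geom_sum_le h1 h
      _ ≤ g * k * Real.log (ν 0 / k) * (C * (r / b) ^ h) := by gcongr
      _ = _ := by ring
  · rw [hnodes]
    exact SparseRec.total_time_le (t := fun j => T ⌊cℓ * k / η⌋₊ (ν j) b)
      (x := fun j => (ν j : ℝ)) (by omega) hct hZ hL1 (by linarith) hA2
      fun j hj => hA2.trans (Nat.cast_le.mpr (hle j hj.le))
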